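/- **Setting.** Let $\Omega\subset\mathbb R^2$ be a bounded open convex set with $\{|\xi|\le 8\}\subset\Omega$, and let $M$ be the smallest positive integer with $\overline\Omega\subset\{|\xi|<2^M\}$. Let $A$ be a real $2\times2$ matrix whose eigenvalues $\lambda_1,\lambda_2$ have positive real parts, and put $t^A=\exp(\log(t)A)$ for $t>0$. Assume that $(\Omega,A)$ is *compatible*: for each $\xi\neq0$ the orbit $\{t^A\xi:t>0\}$ meets $\partial\Omega$ exactly once, and $\Theta(\Omega,A)>0$, where $\Theta(\Omega,A)$ is the infimum, over $\xi\in\partial\Omega$ and supporting lines $\ell$ of $\Omega$ at $\xi$, of the angle between $A\xi$ (the tangent vector to the orbit) and $\ell$. Let $\rho(0)=0$ and, for $\xi\ne0$, let $\rho(\xi)$ be the unique $t>0$ with $t^{-A}\xi\in\partial\Omega$. Write $\mathcal F[g](x)=\int_{\mathbb R^2} e^{-i\langle x,\xi\rangle}g(\xi)\,d\xi$. **Fixed cutoffs.** Fix a Schwartz function $\Phi:\mathbb R\to\mathbb R$ supported in $[-1,1]$ with $|\Phi|\le1$; a nonnegative $\phi\in C^\infty(\mathbb R)$ supported in $[-1,1]$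 and equal to $1$ on $[-\frac12,\frac12]$, with $\phi_0(s)=\phi(s/2)-\phi(s)$; and $\alpha\in C^\infty(\mathbb R)$ with $0\le\alpha\le1$, $\alpha=1$ on $[-1,1]$, $\alpha=0$ off $[-\frac{101}{100},\frac{101}{100}]$. Fix also an integer $N\ge 0$ and real numbers $L$ and $c_k,d_k$ $(k\ge0)$. For small $\delta>0$ put $\psi_t=\mathcal F\big[\Phi\big(\delta^{-1}(\rho(\cdot)/t-1)\big)\big]$ and $r=\frac{1+2\delta}{1-2\delta}$. **Decomposition.** Let $\mathcal R_0=\mathrm{id},\mathcal R_1,\dots,\mathcal R_N$ be rotations about the origin. Let $\gamma_i(a)$ be the unique $y>0$ with $(a,y)\in\mathcal R_i\partial\Omega$; $\gamma'_{i,L},\gamma'_{i,R}$ denote its one-sided derivatives. Set $a_0=-1$. Given $a_{l-1}$, let $\beta_l(t)=(t-a_{l-1})|\gamma_{i,L}'(t)-\gamma_{i,R}'(a_{l-1})|$. If $\beta_l(t)>\delta$ for some $t\in(a_{l-1},1]$, let $a_l$ be the infimum of such $t$. Otherwise stop with $Q=l$ and $a_Q=1$ if $a_{l-1}\le1-2^{-M}\delta$,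 $a_Q=a_{l-1}+2^{-M}\delta$ if not. Let $b_0<\dots<b_J$ (depending on $i$) be a refinement of $a_0<\dots<a_Q$ with $b_0=a_0$, $b_J=a_Q$, such that, with $I_j=[b_j,b_{j+1}]$ for $0\le j<J$, each $[a_l,a_{l+1}]$ is a union of at most $L\log(1/\delta)$ of the $I_j$, and $\frac12|I_j|\le|I_{j+1}|\le2|I_j|$. **Partition functions.** * For $m\in\mathbb Z$ let $\psi_m\in C^\infty(\mathbb R)$ be real valued and supported in $[r^m(1-10\delta),r^m(1+10\delta)]$, with $|D^k\psi_m|\le c_k\delta^{-k}$ for all $k\ge0$ and $\sum_m\psi_m(s)=1$ for all $s>0$ in $\operatorname{supp}\phi_0$. * For $w,r_1,r_2>0$ let $S_i(w;r_1,r_2)$ be the set of $\xi$ with $r_1\le|\xi|\le r_2$ such that $\mathcal R_i\xi$ lies on the open ray from $0$ through some $(a,\gamma_i(a))$, $|a|\le w$. For $0\le i\le N$ let $\Psi_i\in C^\infty(\mathbb R^2)$ be real valued, supported in $S_i(\frac34;1,2^{M+3})$, equal to $1$ on $S_i(\frac14;2,2^{M+2})$, with $|D^k\Psi_i|\le d_k$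 for all $k\ge0$ and $\sum_i\Psi_i=1$ on $\{2\le|\xi|\le2^{M+2}\}$. * For $j<J$ let $e_j$ be the unit vector in the direction $(1,\gamma_{i,R}'(b_j))$ and $\alpha_{i,j}(\eta)=\alpha\big(|I_j|^{-1}\langle\eta-(b_j,\gamma_i(b_j)),e_j\rangle\big)$; put $\alpha_{i,J}=0$. For $0\le i\le N$, $0\le j<J$ and $m,n\in\mathbb Z$, with $\eta=r^{-mA}\xi$, define $$\sigma_{i,j,m,0}(\xi)=\phi_0(\rho(\xi))\,\Psi_i(\eta)\,\psi_m(\rho(\xi))\,\alpha_{i,j}(\mathcal R_i\eta)\,\bigl(1-\alpha_{i,j+1}(\mathcal R_i\eta)\bigr),$$ $$\sigma_{i,j,m,n}(\xi)=\sigma_{i,j,m,0}((2^{-n})^A\xi),\qquad K_{i,j,m,n}=\mathcal F[\sigma_{i,j,m,n}],$$ $$\overline Mf(x)=\sup_{i,j,m,n}\ \sup_{2^{n-10}\le t\le2^{n+10}}|\psi_t*K_{i,j,m,n}*f(x)|.$$ **Proposition.** There is a constant $C>0$ such that for every $\epsilon>0$ there is a constant $K>0$ for which, whenever $0<\delta<C$,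 $$\|\overline Mf\|_{L^2(\mathbb R^2)}\le K\,\delta^{-\epsilon}\,\|f\|_{L^2(\mathbb R^2)}\qquad\text{for all }f\in\mathcal S(\mathbb R^2).$$ Apart from the fixed data $\Phi,\phi,\alpha,N,L,(c_k),(d_k)$, the constant $C$ depends only on $M,\operatorname{Re}\lambda_1,\operatorname{Re}\lambda_2,\Theta(\Omega,A)$, and $K$ only on these and on $\epsilon$; neither depends otherwise on $\Omega$, $A$, $\delta$, $f$, or on the choice of $\mathcal R_i,b_j,\psi_m,\Psi_i$. -/

import Mathlib

open Set MeasureTheory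
open scoped ContDiff SchwartzMap Convolution

noncomputable section

namespace BochnerRiesz

/-- The Euclidean plane. -/
abbrev Plane := EuclideanSpace ℝ (Fin 2)

/-! ### Convex domains, nonisotropic dilations, compatible pairs -/

/-- `Ω` is a bounded open convex set containing the closed disc of radius `8` about the origin, and
`M` is the smallest positive integer with `closure Ω ⊆ {|ξ| < 2 ^ M}`. -/
structure IsConvexDomain (Ω : Set Plane) (M : ℕ) : Prop where
  isOpen : IsOpen Ω
  convex : Convex ℝ Ω
  ball_subset : Metric.closedBall 0 8 ⊆ Ω
  isLeast : IsLeast {k : ℕ | 0 < k ∧ closure Ω ⊆ Metric.ball 0 ((2 : ℝ) ^ k)} M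

/-- The linear map `ξ ↦ A ξ` of the plane. -/
def act (A : Matrix (Fin 2) (Fin 2) ℝ) : Plane →L[ℝ] Plane :=
  Matrix.toEuclideanCLM (n := Fin 2) (𝕜 := ℝ) A

/-- The dilation `t ^ A = exp (log t • A)`, for `t > 0`. -/
def dil (A : Matrix (Fin 2) (Fin 2) ℝ) (t : ℝ) : Plane →L[ℝ] Plane :=
  NormedSpace.exp (Real.log t • act A)

/-- `w` is a direction of a supporting line of the open convex set `Ω` at the boundary point `ξ`:
the line `ξ + ℝ w` does not meet `Ω`. -/
def IsSupportDir (Ω : Set Plane) (ξ w : Plane) : Prop :=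
  w ≠ 0 ∧ ∀ s : ℝ, ξ + s • w ∉ Ω

/-- The infimum `Θ(Ω, A)`, over all boundary points `ξ`, of the angles between the tangent vector
`A ξ` at `ξ` of the orbit `{t ^ A ξ : t > 0}` and the supporting lines of `Ω` at `ξ`. -/
def Theta (Ω : Set Plane) (A : Matrix (Fin 2) (Fin 2) ℝ) : ℝ :=
  sInf {θ : ℝ | ∃ ξ ∈ frontier Ω, ∃ w : Plane, IsSupportDir Ω ξ w ∧
    θ = min (InnerProductGeometry.angle (act A ξ) w) (InnerProductGeometry.angle (act A ξ) (-w))}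

/-- The pair `(Ω, A)` is compatible. -/
structure IsCompatible (Ω : Set Plane) (A : Matrix (Fin 2) (Fin 2) ℝ) : Prop where
  meets_once : ∀ ξ : Plane, ξ ≠ 0 → ∃! t : ℝ, 0 < t ∧ dil A t ξ ∈ frontier Ω
  theta_pos : 0 < Theta Ω A

open Classical in
/-- The norm function: `ρ(0) = 0`, and for `ξ ≠ 0` the number `ρ(ξ)` is the unique `t > 0` with
`t ^ (-A) ξ ∈ ∂Ω` (the set below is a singleton for a compatible pair). -/
def rho (Ω : Set Plane) (A : Matrix (Fin 2) (Fin 2) ℝ) (ξ : Plane) : ℝ :=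
  if ξ = 0 then 0 else sInf {t : ℝ | 0 < t ∧ dil A t⁻¹ ξ ∈ frontier Ω}

/-! ### Rotated boundary graphs and the decomposition of `[-1, 1]` -/

/-- Rotation about the origin by the angle `θ`. -/
def rot (θ : ℝ) (x : Plane) : Plane :=
  !₂[Real.cos θ * x 0 - Real.sin θ * x 1, Real.sin θ * x 0 + Real.cos θ * x 1]

/-- The function `γ` whose graph is the upper part of the rotated boundary: `γ(a)` is the unique
`y > 0` such that `(a, y)` lies in the image of `∂Ω` under the rotation by `θ`. -/
def bdry (Ω : Set Plane) (θ : ℝ) (a : ℝ) : ℝ :=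
  sSup {y : ℝ | 0 < y ∧ !₂[a, y] ∈ rot θ '' frontier Ω}

/-- Left derivative. -/
def leftDeriv (γ : ℝ → ℝ) (a : ℝ) : ℝ := derivWithin γ (Iio a) a

/-- Right derivative; it is `γ'(a)` wherever `γ` is differentiable. -/
def rightDeriv (γ : ℝ → ℝ) (a : ℝ) : ℝ := derivWithin γ (Ioi a) a

/-- How far the graph of `γ` over `[a, t]` is from being flat. The absolute value makes this
independent of whether the boundary arc is written as the graph of a convex or of a concave
function. -/
def bend (γ : ℝ → ℝ) (a t : ℝ) : ℝ := (t - a) * |leftDeriv γ t - rightDeriv γ a|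

/-- The graph of `γ` is flat at scale `δ` all the way from `a` to `1`. -/
def IsLastPiece (γ : ℝ → ℝ) (δ a : ℝ) : Prop := ∀ t ∈ Ioc a 1, bend γ a t ≤ δ

open Classical in
/-- The division point that follows `a`. -/
def nextBreak (γ : ℝ → ℝ) (M : ℕ) (δ a : ℝ) : ℝ :=
  if IsLastPiece γ δ a then
    if a ≤ 1 - ((2 : ℝ) ^ M)⁻¹ * δ then 1 else a + ((2 : ℝ) ^ M)⁻¹ * δ
  else sInf {t : ℝ | t ∈ Ioc a 1 ∧ δ < bend γ a t}

/-- The division points `a₀ = -1, a₁, a₂, …`. -/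
def breakPt (γ : ℝ → ℝ) (M : ℕ) (δ : ℝ) (l : ℕ) : ℝ := (nextBreak γ M δ)^[l] (-1)

/-- The index `Q` of the last division point: the construction stops after the first piece that is
a last piece. -/
def lastBreak (γ : ℝ → ℝ) (M : ℕ) (δ : ℝ) : ℕ :=
  sInf {l : ℕ | IsLastPiece γ δ (breakPt γ M δ l)} + 1

/-- `b 0 < b 1 < … < b J` is a refinement of `a₀ < … < a_Q`: each `[a_l, a_{l+1}]` is a union of at
most `L log (1/δ)` of the intervals `I_j = [b j, b (j + 1)]`, and neighbouring intervals have
comparable lengths. -/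
structure IsRefinement (γ : ℝ → ℝ) (M : ℕ) (δ L : ℝ) (J : ℕ) (b : ℕ → ℝ) : Prop where
  strictMono : StrictMonoOn b (Iic J)
  first : b 0 = breakPt γ M δ 0
  last : b J = breakPt γ M δ (lastBreak γ M δ)
  refines : ∀ l ≤ lastBreak γ M δ, ∃ j ≤ J, b j = breakPt γ M δ l
  card_le : ∀ l < lastBreak γ M δ,
    (({j : ℕ | j < J ∧ breakPt γ M δ l ≤ b j ∧ b (j + 1) ≤ breakPt γ M δ (l + 1)}).ncard : ℝ)
      ≤ L * Real.log δ⁻¹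
  comparable : ∀ j, j + 1 < J →
    (b (j + 1) - b j) / 2 ≤ b (j + 2) - b (j + 1) ∧ b (j + 2) - b (j + 1) ≤ 2 * (b (j + 1) - b j)

/-! ### The partition of unity -/

/-- The cutoff in the definition of the dyadic shells: smooth, nonnegative, supported in `[-1, 1]`,
equal to `1` on `[-1/2, 1/2]`. -/
structure IsShellCutoff (φ : ℝ → ℝ) : Prop where
  contDiff : ContDiff ℝ ∞ φ
  nonneg : ∀ s, 0 ≤ φ s
  support : Function.support φ ⊆ Icc (-1) 1
  eq_one : ∀ s ∈ Icc (-1 / 2 : ℝ) (1 / 2), φ s = 1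

/-- `φ₀(s) = φ(s / 2) - φ(s)`. -/
def shell (φ : ℝ → ℝ) (s : ℝ) : ℝ := φ (s / 2) - φ s

/-- The cutoff in the tangential direction: smooth, with values in `[0, 1]`, equal to `1` on
`[-1, 1]` and to `0` off `[-101/100, 101/100]`. -/
structure IsStripCutoff (α : ℝ → ℝ) : Prop where
  contDiff : ContDiff ℝ ∞ α
  mem_Icc : ∀ s, α s ∈ Icc (0 : ℝ) 1
  eq_one : ∀ s ∈ Icc (-1 : ℝ) 1, α s = 1
  eq_zero : ∀ s, s ∉ Icc (-101 / 100 : ℝ) (101 / 100) → α s = 0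

/-- The isotropic sector bounded by the circles of radii `r₁` and `r₂` about the origin and the rays
through those points of the upper part of the rotated boundary whose first coordinates are `-w` and
`w`, rotated back by `-θ`. -/
def sector (Ω : Set Plane) (θ w r₁ r₂ : ℝ) : Set Plane :=
  {ξ | r₁ ≤ ‖ξ‖ ∧ ‖ξ‖ ≤ r₂ ∧
    ∃ a ∈ Icc (-w) w, ∃ c : ℝ, 0 < c ∧ rot θ ξ = c • !₂[a, bdry Ω θ a]}

/-- The auxiliary choices that enter the partition of unity: the rotation angles, for each rotation
a division of `[-1, 1]` into `J i` intervals, the radial cutoffs `ψ_m` and the angular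
cutoffs `Ψ_i`. -/
structure Choices (N : ℕ) where
  angle : Fin (N + 1) → ℝ
  J : Fin (N + 1) → ℕ
  b : Fin (N + 1) → ℕ → ℝ
  radial : ℤ → ℝ → ℝ
  angular : Fin (N + 1) → Plane → ℝ

/-- The requirements on these choices. The numbers `c k`, `d k` and `L` are the implied constants in
the bounds for the derivatives of the `ψ_m`, for those of the `Ψ_i`, and for the number of
intervals. -/
structure Choices.IsAdmissible {N : ℕ} (P : Choices N) (Ω : Set Plane) (M : ℕ) (φ : ℝ → ℝ)
    (c d : ℕ → ℝ) (L δ : ℝ) : Prop where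
  angle_zero : P.angle 0 = 0
  refinement : ∀ i, IsRefinement (bdry Ω (P.angle i)) M δ L (P.J i) (P.b i)
  radial_contDiff : ∀ m, ContDiff ℝ ∞ (P.radial m)
  radial_support : ∀ m : ℤ, Function.support (P.radial m) ⊆
    Icc (((1 + 2 * δ) / (1 - 2 * δ)) ^ m * (1 - 10 * δ))
      (((1 + 2 * δ) / (1 - 2 * δ)) ^ m * (1 + 10 * δ))
  radial_bound : ∀ (k : ℕ) (m : ℤ) (s : ℝ), |iteratedDeriv k (P.radial m) s| ≤ c k * (δ ^ k)⁻¹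
  radial_sum : ∀ s ∈ tsupport (shell φ), 0 < s → HasSum (fun m : ℤ => P.radial m s) 1
  angular_contDiff : ∀ i, ContDiff ℝ ∞ (P.angular i)
  angular_support : ∀ i, Function.support (P.angular i) ⊆
    sector Ω (P.angle i) (3 / 4) 1 (2 ^ (M + 3))
  angular_eq_one : ∀ i, ∀ ξ ∈ sector Ω (P.angle i) (1 / 4) 2 (2 ^ (M + 2)), P.angular i ξ = 1
  angular_bound : ∀ (k : ℕ) (i : Fin (N + 1)) (ξ : Plane),
    ‖iteratedFDeriv ℝ k (P.angular i) ξ‖ ≤ d k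
  angular_sum : ∀ ξ : Plane, 2 ≤ ‖ξ‖ → ‖ξ‖ ≤ 2 ^ (M + 2) → ∑ i, P.angular i ξ = 1

/-- The unit tangent vector `e_j` at the point `(a, γ(a))`, that is, the unit vector orthogonal to
the normal line there. -/
def unitTangent (γ : ℝ → ℝ) (a : ℝ) : Plane :=
  (Real.sqrt (1 + rightDeriv γ a ^ 2))⁻¹ • !₂[1, rightDeriv γ a]

/-- The strip cutoff `α_j(η) = α(|I_j|⁻¹ ⟨η - (b_j, γ(b_j)), e_j⟩)` for `j < J`. After the last
interval there is nothing left to separate, and `α_J = 0`. -/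
def strip (α γ : ℝ → ℝ) (J : ℕ) (b : ℕ → ℝ) (j : ℕ) (η : Plane) : ℝ :=
  if j < J then
    α ((b (j + 1) - b j)⁻¹ * inner ℝ (η - !₂[b j, γ (b j)]) (unitTangent γ (b j)))
  else 0

/-- The function `σ_{i,j,m,0}`. -/
def sigmaZero {N : ℕ} (P : Choices N) (Ω : Set Plane) (A : Matrix (Fin 2) (Fin 2) ℝ)
    (φ α : ℝ → ℝ) (δ : ℝ) (i : Fin (N + 1)) (j : ℕ) (m : ℤ) (ξ : Plane) : ℝ :=
  let η := dil A (((1 - 2 * δ) / (1 + 2 * δ)) ^ m) ξ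
  let γ := bdry Ω (P.angle i)
  shell φ (rho Ω A ξ) * P.angular i η * P.radial m (rho Ω A ξ) *
    strip α γ (P.J i) (P.b i) j (rot (P.angle i) η) *
    (1 - strip α γ (P.J i) (P.b i) (j + 1) (rot (P.angle i) η))

/-- The function `σ_{i,j,m,n}(ξ) = σ_{i,j,m,0}((2 ^ (-n)) ^ A ξ)`. -/
def sigma {N : ℕ} (P : Choices N) (Ω : Set Plane) (A : Matrix (Fin 2) (Fin 2) ℝ)
    (φ α : ℝ → ℝ) (δ : ℝ) (i : Fin (N + 1)) (j : ℕ) (m n : ℤ) (ξ : Plane) : ℝ :=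
  sigmaZero P Ω A φ α δ i j m (dil A ((2 : ℝ) ^ (-n)) ξ)

/-! ### Kernels and the maximal function -/

/-- The Fourier transform `∫ e^{-i⟨x, ξ⟩} g(ξ) dξ`. -/
def fourier (g : Plane → ℂ) (x : Plane) : ℂ :=
  ∫ ξ, Complex.exp (-((inner ℝ x ξ : ℝ) : ℂ) * Complex.I) * g ξ

/-- The kernel `K_{i,j,m,n}`. -/
def kernelK {N : ℕ} (P : Choices N) (Ω : Set Plane) (A : Matrix (Fin 2) (Fin 2) ℝ)
    (φ α : ℝ → ℝ) (δ : ℝ) (i : Fin (N + 1)) (j : ℕ) (m n : ℤ) : Plane → ℂ :=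
  fourier fun ξ => (sigma P Ω A φ α δ i j m n ξ : ℂ)

/-- The kernel `ψ_t`, the Fourier transform of `Φ((ρ(ξ) / t - 1) / δ)`. -/
def psiKernel (Ω : Set Plane) (A : Matrix (Fin 2) (Fin 2) ℝ) (Φ : 𝓢(ℝ, ℝ)) (δ t : ℝ) : Plane → ℂ :=
  fourier fun ξ => (Φ ((rho Ω A ξ / t - 1) / δ) : ℂ)

/-- Convolution of complex-valued functions on the plane. -/
def conv (g h : Plane → ℂ) : Plane → ℂ := g ⋆[ContinuousLinearMap.mul ℝ ℂ, volume] h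

/-- The maximal function: the supremum of `|ψ_t * K_{i,j,m,n} * f|` over all `(i, j, m, n)` and all
`2 ^ (n - 10) ≤ t ≤ 2 ^ (n + 10)`. -/
def maxFn {N : ℕ} (P : Choices N) (Ω : Set Plane) (A : Matrix (Fin 2) (Fin 2) ℝ) (Φ : 𝓢(ℝ, ℝ))
    (φ α : ℝ → ℝ) (δ : ℝ) (f : Plane → ℂ) (x : Plane) : ENNReal :=
  ⨆ (i : Fin (N + 1)) (j : Fin (P.J i)) (m : ℤ) (n : ℤ)
    (t ∈ Icc ((2 : ℝ) ^ (n - 10)) ((2 : ℝ) ^ (n + 10))),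
    ‖conv (conv (psiKernel Ω A Φ δ t) (kernelK P Ω A φ α δ i j m n)) f x‖ₑ

end BochnerRiesz

end

/-! No cancellation between the pieces is needed: each supremum is replaced by something linear or
positive at a cost polynomial in `log (1/δ)`, and such a cost is absorbed by `δ ^ (-ε)`.

Indices `i`, `m`, `n`. The square of a supremum is at most the sum of squares. There are `N + 1`
rotations, and the frequency shells of the multipliers indexed by `(m, n)` overlap boundedly
(`tsum_indicator_shellSet_le`). Plancherel then reduces everything to one triple `(i, m, n)`,
treated in `exists_maximal_bound`; there the remaining supremum runs over `t` and `j`.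

Time `t`. On the shell `(m, n)` the value of `ρ` is `X (1 + O(δ))` with `X = 2 ^ n r ^ m`. Put `t =
X (1 + δ v)`. The multiplier `Φ ((ρ / t - 1) / δ)` vanishes on the shell unless `v` lies in a fixed
interval, and there its `v`-derivative is bounded uniformly in `δ`. By the fundamental theorem of
calculus the operators for all `t` are dominated by one function `q`, an integral over `v` of
absolute values. Cauchy–Schwarz and Plancherel bound `q` in `L²` (`enorm_fourier_time_le`,
`lintegral_paramAvg_sq_le`).

Strips `j`. The multiplier `α (⟨w, ξ⟩ - u)` is a superposition of characters with a rapidly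
decreasing density, so it acts by averaging translates along `w` and is dominated by averages
against the Cauchy kernel. For fixed `(i, m, n)` every `w` is a positive multiple of some `u₀ + s •
u₁`, with `s` a slope of the boundary graph. The product of two consecutive strip factors is
therefore dominated by a directional maximal function of `q`, applied once and twice.

Directional maximal theorem. The Cauchy average has the multiplier `π exp (-|⟨w, ξ⟩|)`. Its
increments in `s` are dominated by those of a function monotone in `s`, so their squares have
superadditive integrals. The Rademacher–Menshov inequality gives an `L²` bound with loss `p + 1` for
`2 ^ p` directions (`lintegral_iSup_cauchyAvg_sq_le`).

Counting. The boundary graph is concave with slopes `O(2 ^ M)`, so division points are at least a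
constant times `δ` apart. Between two of them lie at most `L log (1/δ)` intervals with neighbouring
lengths comparable, so every interval is at least a power of `δ` long. Hence the number of dyadic
strip widths, and the logarithm of the number of directions, are `O(1 + log (1/δ))`
(`scale_bounds`). -/

noncomputable section

namespace BochnerRiesz

open FourierTransform
open scoped ENNReal ComplexConjugate

/-! ### The Plancherel theorem -/

section Plancherel

variable {V : Type*} [NormedAddCommGroup V] [InnerProductSpace ℝ V] [FiniteDimensional ℝ V]
  [MeasurableSpace V] [BorelSpace V]

/-- On `L¹ ∩ L²` the Fourier transform of `L²` is given by the Fourier integral. -/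
theorem coeFn_fourier_toLp_ae_eq {h : V → ℂ} (h1 : Integrable h) (h2 : MemLp h 2 volume) :
    ((𝓕 (h2.toLp h) : Lp (α := V) ℂ 2 volume) : V → ℂ) =ᵐ[volume] 𝓕 h := by
  have hc : Continuous (𝓕 h) :=
    VectorFourier.fourierIntegral_continuous Real.continuous_fourierChar
      (by exact continuous_inner) h1
  -- Both sides are tested against smooth compactly supported functions. The distributional
  -- transform and the Fourier integral agree there, because each moves onto the test function.
  refine ae_eq_of_integral_contDiff_smul_eq
    ((Lp.memLp _).locallyIntegrable (by norm_num)) hc.locallyIntegrable ?_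
  intro g gs gc
  have hg₁ : HasCompactSupport (Complex.ofRealCLM ∘ g) := gc.comp_left rfl
  have hg₂ : ContDiff ℝ ∞ (Complex.ofRealCLM ∘ g) := by fun_prop
  set G : 𝓢(V, ℂ) := hg₁.toSchwartzMap hg₂ with hG
  have e1 := congrArg (fun T => T G) (Lp.fourier_toTemperedDistribution_eq (h2.toLp h))
  simp only [TemperedDistribution.fourier_apply, Lp.toTemperedDistribution_apply] at e1
  have e2 : ∫ x, G x • ((𝓕 (h2.toLp h) : Lp (α := V) ℂ 2 volume) : V → ℂ) x
      = ∫ x, (𝓕 G : 𝓢(V, ℂ)) x • h x := by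
    rw [← e1]
    refine integral_congr_ae ?_
    filter_upwards [h2.coeFn_toLp] with x hx
    rw [hx]
  have e3 : ∫ x, (𝓕 G : 𝓢(V, ℂ)) x • h x = ∫ x, G x • 𝓕 h x := by
    have := VectorFourier.integral_fourierIntegral_smul_eq_flip (L := innerₗ V)
      (μ := volume) (ν := volume) (e := Real.fourierChar) Real.continuous_fourierChar
      (by exact continuous_inner) G.integrable h1
    simpa using! this
  have e4 := e2.trans e3
  simpa [hG] using e4

theorem lintegral_enorm_fourier_sq {h : V → ℂ} (h1 : Integrable h) (h2 : MemLp h 2 volume) :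
    ∫⁻ x, ‖𝓕 h x‖ₑ ^ 2 = ∫⁻ x, ‖h x‖ₑ ^ 2 := by
  have e : eLpNorm (𝓕 h) 2 volume = eLpNorm h 2 volume := by
    rw [← eLpNorm_congr_ae (coeFn_fourier_toLp_ae_eq h1 h2), ← eLpNorm_congr_ae h2.coeFn_toLp,
      ← Lp.enorm_def, ← Lp.enorm_def, ← ofReal_norm, ← ofReal_norm, Lp.norm_fourier_eq]
  have k : ∀ q : V → ℂ, ∫⁻ x, ‖q x‖ₑ ^ 2 = eLpNorm q 2 volume ^ 2 := fun q => by
    have := eLpNorm_nnreal_pow_eq_lintegral (f := q) (μ := volume) (p := 2) (by norm_num)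
    simpa using this.symm
  rw [k, k, e]

theorem integral_conj_fourier_mul_fourier {g h : V → ℂ} (g1 : Integrable g)
    (g2 : MemLp g 2 volume) (h1 : Integrable h) (h2 : MemLp h 2 volume) :
    ∫ x, conj (𝓕 g x) * 𝓕 h x = ∫ x, conj (g x) * h x := by
  have e := Lp.inner_fourier_eq (g2.toLp g) (h2.toLp h)
  rw [L2.inner_def, L2.inner_def] at e
  have l : ∫ x, conj (𝓕 g x) * 𝓕 h x = ∫ x, inner ℂ (((𝓕 (g2.toLp g) : Lp (α := V) ℂ 2 volume) : V → ℂ) x)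
      (((𝓕 (h2.toLp h) : Lp (α := V) ℂ 2 volume) : V → ℂ) x) := by
    refine integral_congr_ae ?_
    filter_upwards [coeFn_fourier_toLp_ae_eq g1 g2, coeFn_fourier_toLp_ae_eq h1 h2] with x hx hy
    rw [hx, hy]; simp [mul_comm]
  rw [l, e]
  refine integral_congr_ae ?_
  filter_upwards [g2.coeFn_toLp, h2.coeFn_toLp] with x hx hy
  rw [hx, hy]; simp [mul_comm]

end Plancherel

/-! ### The Fourier transform without `2π` in the exponent, and its convolution formulas -/

theorem fourier_eq (g : Plane → ℂ) (x : Plane) :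
    fourier g x = 𝓕 g ((2 * Real.pi)⁻¹ • x) := by
  rw [Real.fourier_eq' g, fourier]
  refine integral_congr_ae (Filter.Eventually.of_forall fun ξ => ?_)
  simp only [smul_eq_mul]
  congr 2
  rw [inner_smul_right, real_inner_comm]
  push_cast
  have : (Real.pi : ℂ) ≠ 0 := by exact_mod_cast Real.pi_ne_zero
  simp
  field_simp

theorem lintegral_comp_smul_plane (f : Plane → ℝ≥0∞) :
    ∫⁻ x, f ((2 * Real.pi)⁻¹ • x) = ENNReal.ofReal ((2 * Real.pi) ^ 2) * ∫⁻ x, f x := by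
  have h0 : (2 * Real.pi)⁻¹ ≠ 0 := by positivity
  have := lintegral_map_equiv (μ := (volume : Measure Plane)) f
    (Homeomorph.smulOfNeZero (α := Plane) _ h0).toMeasurableEquiv
  have h1 : Measure.map (Homeomorph.smulOfNeZero (α := Plane) _ h0).toMeasurableEquiv volume
      = ENNReal.ofReal ((2 * Real.pi) ^ 2) • volume := by
    have := Measure.map_addHaar_smul (volume : Measure Plane) h0
    simp only [finrank_euclideanSpace_fin, inv_pow, inv_inv] at this
    rw [abs_of_pos (by positivity)] at this
    exact this
  rw [h1, lintegral_smul_measure] at this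
  exact this.symm

theorem integral_comp_smul_plane (f : Plane → ℂ) :
    ∫ x, f ((2 * Real.pi)⁻¹ • x) = ((2 * Real.pi) ^ 2 : ℂ) * ∫ x, f x := by
  have := Measure.integral_comp_smul (volume : Measure Plane) f ((2 * Real.pi)⁻¹)
  rw [this, finrank_euclideanSpace_fin, inv_pow, inv_inv, abs_of_pos (by positivity),
    Complex.real_smul]
  push_cast
  rfl

/-- The Plancherel theorem for functions in `L¹ ∩ L²`. -/
theorem lintegral_enorm_fourierPlane_sq {h : Plane → ℂ} (h1 : Integrable h)
    (h2 : MemLp h 2 volume) :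
    ∫⁻ x, ‖fourier h x‖ₑ ^ 2 = ENNReal.ofReal ((2 * Real.pi) ^ 2) * ∫⁻ x, ‖h x‖ₑ ^ 2 := by
  simp_rw [fourier_eq]
  rw [lintegral_comp_smul_plane (fun x => ‖𝓕 h x‖ₑ ^ 2), lintegral_enorm_fourier_sq h1 h2]

theorem continuous_fourierPlane {h : Plane → ℂ} (h1 : Integrable h) : Continuous (fourier h) := by
  have hc : Continuous (𝓕 h) :=
    VectorFourier.fourierIntegral_continuous Real.continuous_fourierChar
      (by exact continuous_inner) h1
  have : fourier h = fun x => 𝓕 h ((2 * Real.pi)⁻¹ • x) := funext (fourier_eq h)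
  rw [this]
  exact hc.comp (continuous_const_smul _)

theorem enorm_cexp_mul_I (t : ℝ) : ‖Complex.exp (-(t : ℂ) * Complex.I)‖ₑ = 1 := by
  rw [← ofReal_norm]
  have : ‖Complex.exp (-(t : ℂ) * Complex.I)‖ = 1 := by
    have := Complex.norm_exp_ofReal_mul_I (-t)
    simpa using this
  rw [this]; simp

theorem integrable_cexp_mul {α : Type*} [MeasurableSpace α] {μ : Measure α} {h : α → ℂ}
    (h1 : Integrable h μ) {u : α → ℝ} (hu : Measurable u) :
    Integrable (fun ξ => Complex.exp (-(u ξ : ℂ) * Complex.I) * h ξ) μ := by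
  refine h1.mono ?_ (Filter.Eventually.of_forall fun ξ => ?_)
  · exact (by fun_prop : Measurable fun ξ => Complex.exp (-(u ξ : ℂ) * Complex.I)).aestronglyMeasurable.mul h1.1
  · rw [norm_mul]
    have := Complex.norm_exp_ofReal_mul_I (-(u ξ))
    push_cast at this
    rw [this, one_mul]

theorem memLp_cexp_mul {α : Type*} [MeasurableSpace α] {μ : Measure α} {h : α → ℂ} {p : ℝ≥0∞}
    (h1 : MemLp h p μ) {u : α → ℝ} (hu : Measurable u) :
    MemLp (fun ξ => Complex.exp (-(u ξ : ℂ) * Complex.I) * h ξ) p μ := by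
  refine h1.mono ?_ (Filter.Eventually.of_forall fun ξ => ?_)
  · exact (by fun_prop : Measurable fun ξ => Complex.exp (-(u ξ : ℂ) * Complex.I)).aestronglyMeasurable.mul h1.1
  · rw [norm_mul]
    have := Complex.norm_exp_ofReal_mul_I (-(u ξ))
    push_cast at this
    rw [this, one_mul]

/-- The convolution of two Fourier transforms. -/
theorem conv_fourier_fourier {a b : Plane → ℂ} (a1 : Integrable a) (a2 : MemLp a 2 volume)
    (b1 : Integrable b) (b2 : MemLp b 2 volume) (x : Plane) :
    conv (fourier a) (fourier b) x = (2 * Real.pi) ^ 2 * fourier (fun ξ => a ξ * b ξ) x := by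
  -- As a function of `y`, `fourier b (x - y)` is the conjugate of `fourier g y`. The convolution is
  -- thus an `L²` pairing and Parseval applies, without any integrability of the kernels themselves.
  set g : Plane → ℂ := fun ξ => Complex.exp (-((-inner ℝ x ξ : ℝ) : ℂ) * Complex.I) * conj (b ξ)
    with hg
  have bc1 : Integrable (fun ξ => conj (b ξ)) :=
    (Complex.conjLIE.toContinuousLinearEquiv.toContinuousLinearMap.integrable_comp b1 : _)
  have bc2 : MemLp (fun ξ => conj (b ξ)) 2 volume := by
    refine b2.mono (Complex.continuous_conj.comp_aestronglyMeasurable b2.1) ?_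
    exact Filter.Eventually.of_forall fun ξ => by simp
  have hm : Measurable fun ξ : Plane => -inner ℝ x ξ := by fun_prop
  have g1 : Integrable g := integrable_cexp_mul bc1 hm
  have g2 : MemLp g 2 volume := memLp_cexp_mul bc2 hm
  have key : ∀ y, fourier b (x - y) = conj (fourier g y) := by
    intro y
    rw [fourier, fourier, ← integral_conj]
    refine integral_congr_ae (Filter.Eventually.of_forall fun ξ => ?_)
    simp only [hg, map_mul, Complex.conj_conj, ← Complex.exp_conj, map_neg, Complex.conj_ofReal,
      Complex.conj_I]
    rw [← mul_assoc, ← Complex.exp_add, inner_sub_left]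
    congr 2
    push_cast
    ring
  rw [conv, convolution_def]
  simp only [ContinuousLinearMap.mul_apply', key]
  simp_rw [fourier_eq]
  rw [integral_comp_smul_plane (fun y => 𝓕 a y * conj (𝓕 g y))]
  congr 1
  have := integral_conj_fourier_mul_fourier g1 g2 a1 a2
  simp_rw [mul_comm (𝓕 a _)]
  rw [this, ← fourier_eq, fourier]
  refine integral_congr_ae (Filter.Eventually.of_forall fun ξ => ?_)
  simp only [hg, map_mul, Complex.conj_conj, ← Complex.exp_conj, map_neg, Complex.conj_ofReal,
      Complex.conj_I]
  push_cast
  ring_nf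

/-- Convolution with a Fourier transform is a Fourier multiplier operator. -/
theorem conv_fourier_left {a f : Plane → ℂ} (a1 : Integrable a) (f1 : Integrable f) (x : Plane) :
    conv (fourier a) f x = fourier (fun ξ => a ξ * fourier f (-ξ)) x := by
  rw [conv, convolution_def]
  simp only [ContinuousLinearMap.mul_apply', fourier]
  have s1 : ∀ y, (∫ ξ, Complex.exp (-((inner ℝ y ξ : ℝ) : ℂ) * Complex.I) * a ξ) * f (x - y)
      = ∫ ξ, Complex.exp (-((inner ℝ y ξ : ℝ) : ℂ) * Complex.I) * (a ξ * f (x - y)) := by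
    intro y
    rw [← integral_mul_const]
    simp only [mul_assoc]
  simp_rw [s1]
  rw [integral_integral_swap]
  · refine integral_congr_ae (Filter.Eventually.of_forall fun ξ => ?_)
    dsimp only
    rw [← integral_const_mul, ← integral_const_mul,
      ← integral_sub_left_eq_self _ volume x]
    refine integral_congr_ae (Filter.Eventually.of_forall fun y => ?_)
    dsimp only
    rw [sub_sub_cancel]
    have : Complex.exp (-((inner ℝ (x - y) ξ : ℝ) : ℂ) * Complex.I)
      = Complex.exp (-((inner ℝ x ξ : ℝ) : ℂ) * Complex.I) *
        Complex.exp (-((inner ℝ (-ξ) y : ℝ) : ℂ) * Complex.I) := by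
      rw [← Complex.exp_add, inner_sub_left, inner_neg_left, real_inner_comm y ξ]
      congr 1
      push_cast
      ring
    rw [this]
    ring
  · have hi : Integrable (fun z : Plane × Plane => a z.2 * f (x - z.1)) (volume.prod volume) := by
      have := (f1.comp_sub_left x).mul_prod a1
      simpa [mul_comm] using this
    exact integrable_cexp_mul hi (u := fun z => inner ℝ z.1 z.2) (by fun_prop)

/-! ### Superpositions of translations -/

/-- A superposition of characters acts on Fourier transforms as an average of translations. -/
theorem fourier_superposition {κ : ℝ → ℂ} (hκ : Integrable κ) {h : Plane → ℂ} (hh : Integrable h)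
    (w x : Plane) :
    fourier (fun ξ => (∫ s, κ s * Complex.exp (((s * inner ℝ w ξ : ℝ) : ℂ) * Complex.I)) * h ξ) x
      = ∫ s, κ s * fourier h (x - s • w) := by
  simp only [fourier]
  have s1 : ∀ ξ, Complex.exp (-((inner ℝ x ξ : ℝ) : ℂ) * Complex.I) *
      ((∫ s, κ s * Complex.exp (((s * inner ℝ w ξ : ℝ) : ℂ) * Complex.I)) * h ξ)
      = ∫ s, Complex.exp (-((inner ℝ (x - s • w) ξ : ℝ) : ℂ) * Complex.I) * (h ξ * κ s) := by
    intro ξ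
    rw [← integral_mul_const, ← integral_const_mul]
    refine integral_congr_ae (Filter.Eventually.of_forall fun s => ?_)
    have : Complex.exp (-((inner ℝ (x - s • w) ξ : ℝ) : ℂ) * Complex.I)
      = Complex.exp (-((inner ℝ x ξ : ℝ) : ℂ) * Complex.I) *
        Complex.exp (((s * inner ℝ w ξ : ℝ) : ℂ) * Complex.I) := by
      rw [← Complex.exp_add, inner_sub_left, inner_smul_left]
      congr 1
      push_cast
      simp
      ring
    dsimp only
    rw [this]
    ring
  simp_rw [s1]
  rw [integral_integral_swap]
  · refine integral_congr_ae (Filter.Eventually.of_forall fun s => ?_)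
    dsimp only
    rw [← integral_const_mul]
    refine integral_congr_ae (Filter.Eventually.of_forall fun ξ => ?_)
    dsimp only
    ring
  · exact integrable_cexp_mul (hh.mul_prod hκ)
      (u := fun z : Plane × ℝ => inner ℝ (x - z.2 • w) z.1) (by fun_prop)

/-! ### The Fourier transform of the Cauchy kernel -/

theorem integrable_exp_neg_abs : Integrable fun y : ℝ => (Real.exp (-|y|) : ℂ) := by
  refine Integrable.ofReal (f := fun y : ℝ => Real.exp (-|y|)) ?_
  rw [← integrableOn_univ, ← Iic_union_Ioi (a := (0 : ℝ))]
  refine IntegrableOn.union ?_ ?_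
  · refine (integrableOn_exp_mul_Iic one_pos 0).congr_fun (fun x hx => ?_) measurableSet_Iic
    simp [abs_of_nonpos (show x ≤ 0 from hx)]
  · refine (integrableOn_exp_mul_Ioi (neg_lt_zero.2 one_pos) 0).congr_fun (fun x hx => ?_)
      measurableSet_Ioi
    simp [abs_of_pos (show 0 < x from hx)]

theorem fourier_exp_neg_abs (s : ℝ) :
    𝓕 (fun y : ℝ => (Real.exp (-|y|) : ℂ)) s = 2 / (1 + (2 * Real.pi * s) ^ 2) := by
  rw [Real.fourier_eq']
  set f : ℝ → ℂ := fun v =>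
    Complex.exp (((-2 * Real.pi * inner ℝ v s : ℝ) : ℂ) * Complex.I) • (Real.exp (-|v|) : ℂ) with hf
  have hI : Integrable f := by
    have := integrable_cexp_mul integrable_exp_neg_abs (u := fun v : ℝ => 2 * Real.pi * inner ℝ v s)
      (by fun_prop)
    simpa [hf] using this
  set z : ℂ := 2 * Real.pi * s * Complex.I with hz
  have hre : z.re = 0 := by simp [hz]
  rw [← intervalIntegral.integral_Iic_add_Ioi hI.integrableOn hI.integrableOn (b := 0)]
  have e1 : ∫ x in Iic (0 : ℝ), f x = ∫ x in Iic (0 : ℝ), Complex.exp ((1 - z) * x) := by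
    refine setIntegral_congr_fun measurableSet_Iic fun x hx => ?_
    have hx : x ≤ 0 := hx
    simp only [hf, hz, abs_of_nonpos hx, neg_neg, smul_eq_mul]
    push_cast
    rw [← Complex.exp_add]
    congr 1
    simp
    ring
  have e2 : ∫ x in Ioi (0 : ℝ), f x = ∫ x in Ioi (0 : ℝ), Complex.exp ((-(1 + z)) * x) := by
    refine setIntegral_congr_fun measurableSet_Ioi fun x hx => ?_
    have hx : 0 < x := hx
    simp only [hf, hz, abs_of_pos hx, smul_eq_mul]
    push_cast
    rw [← Complex.exp_add]
    congr 1
    simp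
    ring
  rw [e1, e2, integral_exp_mul_complex_Iic (by simp [hre]), integral_exp_mul_complex_Ioi (by simp [hre])]
  have n1 : 1 - z ≠ 0 := fun h => by have := congrArg Complex.re h; simp [hre] at this
  have n2 : 1 + z ≠ 0 := fun h => by have := congrArg Complex.re h; simp [hre] at this
  have n3 : (1 + (2 * Real.pi * s) ^ 2 : ℂ) = (1 - z) * (1 + z) := by
    have := Complex.I_sq
    simp only [hz]
    linear_combination ((2 * Real.pi * s : ℂ) ^ 2) * this
  rw [n3]
  have n4 : -(1 + z) ≠ 0 := neg_ne_zero.2 n2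
  simp only [Complex.ofReal_zero, mul_zero, Complex.exp_zero]
  field_simp
  ring

/-- Fourier inversion for `exp (-|y|)`. The Cauchy kernel is the averaging kernel of choice because
it is positive, dominates Schwartz functions up to a constant, and has an explicit multiplier of
bounded variation. -/
theorem integral_cauchy_mul_cexp (y : ℝ) :
    ∫ s : ℝ, ((1 + s ^ 2)⁻¹ : ℝ) * Complex.exp (((s * y : ℝ) : ℂ) * Complex.I)
      = (Real.pi * Real.exp (-|y|) : ℝ) := by
  have hF : 𝓕 (fun y : ℝ => (Real.exp (-|y|) : ℂ))
      = fun s : ℝ => (((2 * (1 + (2 * Real.pi * s) ^ 2)⁻¹ : ℝ)) : ℂ) := by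
    ext s
    rw [fourier_exp_neg_abs]
    push_cast
    rw [div_eq_mul_inv]
  have hint : Integrable (𝓕 (fun y : ℝ => (Real.exp (-|y|) : ℂ))) := by
    rw [hF]
    refine Integrable.ofReal (Integrable.const_mul ?_ _)
    exact integrable_inv_one_add_sq.comp_mul_left' (by positivity)
  have hcont : Continuous (fun y : ℝ => (Real.exp (-|y|) : ℂ)) := by fun_prop
  have key := congrFun (hcont.fourierInv_fourier_eq integrable_exp_neg_abs hint) y
  rw [hF, Real.fourierInv_eq'] at key
  have hs := Measure.integral_comp_mul_left
    (fun s : ℝ => (((1 + s ^ 2)⁻¹ : ℝ) : ℂ) * Complex.exp (((s * y : ℝ) : ℂ) * Complex.I)) (2 * Real.pi)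
  have e : ∫ v : ℝ, Complex.exp (((2 * Real.pi * inner ℝ v y : ℝ) : ℂ) * Complex.I) •
      (((2 * (1 + (2 * Real.pi * v) ^ 2)⁻¹ : ℝ)) : ℂ)
      = 2 * ∫ x : ℝ, (((1 + (2 * Real.pi * x) ^ 2)⁻¹ : ℝ) : ℂ) *
        Complex.exp ((((2 * Real.pi * x) * y : ℝ) : ℂ) * Complex.I) := by
    rw [← integral_const_mul]
    refine integral_congr_ae (Filter.Eventually.of_forall fun s => ?_)
    simp only [smul_eq_mul, RCLike.inner_apply, conj_trivial]
    push_cast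
    ring_nf
  rw [e, hs, abs_of_pos (by positivity), Complex.real_smul] at key
  have hpi : (Real.pi : ℂ) ≠ 0 := by exact_mod_cast Real.pi_ne_zero
  rw [Complex.ofReal_mul, ← key]
  rw [← mul_assoc, ← mul_assoc]
  have : (Real.pi : ℂ) * 2 * ((2 * Real.pi)⁻¹ : ℝ) = 1 := by
    push_cast
    field_simp
  rw [this, one_mul]

/-- The primitive of `exp (-|y|)` that vanishes at the origin. -/
def expPrimitive (y : ℝ) : ℝ := if 0 ≤ y then 1 - Real.exp (-y) else Real.exp y - 1

theorem expPrimitive_mono : Monotone expPrimitive := by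
  intro x y hxy
  unfold expPrimitive
  split_ifs with hx hy hy
  · have := Real.exp_le_exp.2 (neg_le_neg hxy); linarith
  · linarith
  · have h1 : Real.exp x ≤ 1 := Real.exp_le_one_iff.2 (by linarith)
    have h2 : Real.exp (-y) ≤ 1 := Real.exp_le_one_iff.2 (by linarith)
    linarith
  · have := Real.exp_le_exp.2 hxy; linarith

theorem abs_expPrimitive_le (y : ℝ) : |expPrimitive y| ≤ 1 := by
  unfold expPrimitive
  rw [abs_le]
  split_ifs with hy
  · have h2 : Real.exp (-y) ≤ 1 := Real.exp_le_one_iff.2 (by linarith)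
    have := Real.exp_pos (-y)
    constructor <;> linarith
  · have h2 : Real.exp y ≤ 1 := Real.exp_le_one_iff.2 (by linarith)
    have := Real.exp_pos y
    constructor <;> linarith

/-- The derivative of `exp (-|y|)` has absolute value `exp (-|y|)`, the derivative of
`expPrimitive`. The increments of a non-monotone function are thereby controlled by those of a
bounded monotone one. -/
theorem abs_exp_neg_abs_sub_le (x y : ℝ) :
    |Real.exp (-|x|) - Real.exp (-|y|)| ≤ |expPrimitive x - expPrimitive y| := by
  wlog h : x ≤ y generalizing x y
  · rw [abs_sub_comm, abs_sub_comm (expPrimitive x)]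
    exact this y x (le_of_not_ge h)
  rw [abs_sub_comm (expPrimitive x), abs_of_nonneg (sub_nonneg.2 (expPrimitive_mono h)), abs_le]
  unfold expPrimitive
  split_ifs with hy hx hx
  · rw [abs_of_nonneg hx, abs_of_nonneg hy]
    have := Real.exp_le_exp.2 (neg_le_neg h)
    constructor <;> linarith
  · rw [abs_of_nonneg hy, abs_of_neg (not_le.1 hx), neg_neg]
    have h1 : Real.exp x ≤ 1 := Real.exp_le_one_iff.2 (by linarith)
    have h2 : Real.exp (-y) ≤ 1 := Real.exp_le_one_iff.2 (by linarith)
    constructor <;> linarith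
  · linarith
  · rw [abs_of_neg (not_le.1 hy), abs_of_neg (not_le.1 hx), neg_neg, neg_neg]
    have := Real.exp_le_exp.2 h
    constructor <;> linarith

theorem measurable_expPrimitive : Measurable expPrimitive := expPrimitive_mono.measurable

/-! ### The Rademacher–Menshov inequality -/

/-- The two sides differ by `(q a - b) ^ 2`. The weights are those that turn the constant `q ^ 2`
into `(q + 1) ^ 2` in the induction below. -/
theorem enorm_sq_weighted_add_le (q : ℕ) (hq : 1 ≤ q) (a b : ℝ≥0∞) :
    (q : ℝ≥0∞) * (a + b) ^ 2 ≤ q * (q + 1) * a ^ 2 + (q + 1) * b ^ 2 := by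
  have hq0 : (q : ℝ≥0∞) ≠ 0 := by exact_mod_cast (by omega : q ≠ 0)
  induction a with
  | top => simp [hq0]
  | coe a =>
    induction b with
    | top => simp
    | coe b =>
      have : (q : ℝ) * (a + b) ^ 2 ≤ q * (q + 1) * a ^ 2 + (q + 1) * b ^ 2 := by
        nlinarith [sq_nonneg ((q : ℝ) * a - b)]
      have h2 : (q : NNReal) * (a + b) ^ 2 ≤ q * (q + 1) * a ^ 2 + (q + 1) * b ^ 2 := by
        exact_mod_cast this
      exact_mod_cast h2

/-- The Rademacher–Menshov inequality: a maximal function over `2 ^ p + 1` functions whose square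
increments are controlled by a superadditive function `D` is bounded with the loss `p + 1`. -/
theorem lintegral_iSup_enorm_sub_sq_le {X : Type*} [MeasurableSpace X] {μ : Measure X}
    (U : ℕ → X → ℂ) (hU : ∀ k, Measurable (U k)) (D : ℕ → ℕ → ℝ≥0∞)
    (hD : ∀ k l, k ≤ l → ∫⁻ x, ‖U l x - U k x‖ₑ ^ 2 ∂μ ≤ D k l)
    (hs : ∀ k l m, k ≤ l → l ≤ m → D k l + D l m ≤ D k m) (p : ℕ) (a : ℕ) :
    ∫⁻ x, (⨆ k ∈ Finset.Icc a (a + 2 ^ p), ‖U k x - U a x‖ₑ) ^ 2 ∂μ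
      ≤ ((p + 1 : ℕ) : ℝ≥0∞) ^ 2 * D a (a + 2 ^ p) := by
  have hm : ∀ a b c, Measurable fun x => ⨆ k ∈ Finset.Icc a b, ‖U k x - U c x‖ₑ := by
    intro a b c
    exact Measurable.biSup _ (Finset.countable_toSet _) fun k _ => ((hU k).sub (hU c)).enorm
  induction p generalizing a with
  | zero =>
    refine le_trans (lintegral_mono fun x => ?_) (le_trans (hD a (a + 1) (by omega)) (by simp))
    gcongr
    refine iSup₂_le fun k hk => ?_
    simp only [pow_zero, Finset.mem_Icc] at hk
    obtain rfl | rfl : k = a ∨ k = a + 1 := by omega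
    · simp
    · exact le_rfl
  | succ p ih =>
    set q := p + 1 with hq
    have e2 : 2 ^ (p + 1) = 2 ^ p + 2 ^ p := by ring
    set b := a + 2 ^ p with hb
    have hbc : a + 2 ^ q = b + 2 ^ p := by rw [hq, e2]; omega
    -- The range is halved at `b`. In the right half `U k - U a` passes through `U b`, so both
    -- halves are governed by one increment and two maximal functions of half the size.
    have h1 : ∀ x, (q : ℝ≥0∞) * (⨆ k ∈ Finset.Icc a (a + 2 ^ q), ‖U k x - U a x‖ₑ) ^ 2 ≤
        q * (q + 1) * ‖U b x - U a x‖ₑ ^ 2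
        + (q + 1) * ((⨆ k ∈ Finset.Icc a b, ‖U k x - U a x‖ₑ) ^ 2 +
          (⨆ k ∈ Finset.Icc b (b + 2 ^ p), ‖U k x - U b x‖ₑ) ^ 2) := by
      intro x
      set L := ⨆ k ∈ Finset.Icc a b, ‖U k x - U a x‖ₑ with hL
      set R := ⨆ k ∈ Finset.Icc b (b + 2 ^ p), ‖U k x - U b x‖ₑ with hR
      have hmax : (max L R) ^ 2 ≤ L ^ 2 + R ^ 2 := by
        rcases le_total L R with h | h
        · rw [max_eq_right h]; exact le_add_self
        · rw [max_eq_left h]; exact le_self_add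
      calc (q : ℝ≥0∞) * (⨆ k ∈ Finset.Icc a (a + 2 ^ q), ‖U k x - U a x‖ₑ) ^ 2
          ≤ q * (‖U b x - U a x‖ₑ + max L R) ^ 2 := by
            gcongr
            refine iSup₂_le fun k hk => ?_
            rw [Finset.mem_Icc] at hk
            by_cases hkb : k ≤ b
            · refine le_trans ?_ le_add_self
              refine le_trans ?_ (le_max_left _ _)
              exact le_iSup₂ (f := fun k (_ : k ∈ Finset.Icc a b) => ‖U k x - U a x‖ₑ) k
                (Finset.mem_Icc.2 ⟨hk.1, hkb⟩)
            · have : U k x - U a x = (U b x - U a x) + (U k x - U b x) := by ring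
              rw [this]
              refine (enorm_add_le _ _).trans ?_
              gcongr
              refine le_trans ?_ (le_max_right _ _)
              exact le_iSup₂ (f := fun k (_ : k ∈ Finset.Icc b (b + 2 ^ p)) => ‖U k x - U b x‖ₑ) k
                (Finset.mem_Icc.2 ⟨by omega, by omega⟩)
        _ ≤ q * (q + 1) * ‖U b x - U a x‖ₑ ^ 2 + (q + 1) * (max L R) ^ 2 :=
            enorm_sq_weighted_add_le q (by omega) _ _
        _ ≤ _ := by gcongr
    have h2 := lintegral_mono (μ := μ) h1
    have mq : Measurable fun x => ‖U b x - U a x‖ₑ ^ 2 := ((hU b).sub (hU a)).enorm.pow_const 2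
    have mL := (hm a b a).pow_const 2
    have mR := (hm b (b + 2 ^ p) b).pow_const 2
    rw [lintegral_const_mul _ ((hm _ _ _).pow_const 2), lintegral_add_left (mq.const_mul _),
      lintegral_const_mul _ mq, lintegral_const_mul _ (by exact mL.add mR),
      lintegral_add_left mL] at h2
    have hab : a ≤ b := Nat.le_add_right _ _
    have hD1 := hD a b hab
    have hsup := hs a b (b + 2 ^ p) hab (Nat.le_add_right _ _)
    have i1 := ih a
    have i2 := ih b
    rw [hbc] at h2 ⊢
    have hDm : D a b ≤ D a (b + 2 ^ p) := le_trans le_self_add hsup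
    -- Superadditivity lets the two halves share one `D a (b + 2 ^ p)`, and `q (q + 1) + (q + 1) q ^
    -- 2 = q (q + 1) ^ 2`; the factor `q` is cancelled at the end.
    have h3 : (q : ℝ≥0∞) * ∫⁻ x, (⨆ k ∈ Finset.Icc a (b + 2 ^ p), ‖U k x - U a x‖ₑ) ^ 2 ∂μ
        ≤ q * (((q + 1 : ℕ) : ℝ≥0∞) ^ 2 * D a (b + 2 ^ p)) := by
      calc _ ≤ _ := h2
        _ ≤ q * (q + 1) * D a (b + 2 ^ p)
            + (q + 1) * ((q : ℝ≥0∞) ^ 2 * D a b + (q : ℝ≥0∞) ^ 2 * D b (b + 2 ^ p)) := by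
            gcongr
            exact hD1.trans hDm
        _ = q * (q + 1) * D a (b + 2 ^ p)
            + (q + 1) * ((q : ℝ≥0∞) ^ 2 * (D a b + D b (b + 2 ^ p))) := by ring
        _ ≤ q * (q + 1) * D a (b + 2 ^ p)
            + (q + 1) * ((q : ℝ≥0∞) ^ 2 * D a (b + 2 ^ p)) := by gcongr
        _ = _ := by push_cast; ring
    have hq0 : (q : ℝ≥0∞) ≠ 0 := by exact_mod_cast (by omega : q ≠ 0)
    exact (ENNReal.mul_le_mul_iff_right hq0 (ENNReal.natCast_ne_top q)).1 h3

/-! ### Averages along lines and the directional maximal theorem -/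

/-- The average of `q` along the line through `x` in the direction `w` against the Cauchy kernel. -/
def cauchyAvg (w : Plane) (q : Plane → ℝ≥0∞) (x : Plane) : ℝ≥0∞ :=
  ∫⁻ s : ℝ, ENNReal.ofReal (1 + s ^ 2)⁻¹ * q (x - s • w)

theorem measurable_cauchyAvg (w : Plane) {q : Plane → ℝ≥0∞} (hq : Measurable q) :
    Measurable (cauchyAvg w q) := by
  refine Measurable.lintegral_prod_right' (f := fun z : Plane × ℝ =>
    ENNReal.ofReal (1 + z.2 ^ 2)⁻¹ * q (z.1 - z.2 • w)) ?_
  fun_prop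

theorem lintegral_cauchy : ∫⁻ s : ℝ, ENNReal.ofReal (1 + s ^ 2)⁻¹ = ENNReal.ofReal Real.pi := by
  rw [← ofReal_integral_eq_lintegral_ofReal integrable_inv_one_add_sq
    (Filter.Eventually.of_forall fun s => by positivity), integral_univ_inv_one_add_sq]

theorem cauchyAvg_le_of_le {w : Plane} {q : Plane → ℝ≥0∞} {B : ℝ≥0∞} (h : ∀ x, q x ≤ B)
    (x : Plane) : cauchyAvg w q x ≤ ENNReal.ofReal Real.pi * B := by
  calc cauchyAvg w q x ≤ ∫⁻ s : ℝ, ENNReal.ofReal (1 + s ^ 2)⁻¹ * B :=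
        lintegral_mono fun _ => by gcongr; exact h _
    _ = _ := by rw [lintegral_mul_const _ (by fun_prop), lintegral_cauchy]

/-- The Cauchy–Schwarz inequality for a weight. -/
theorem sq_lintegral_mul_le {X : Type*} [MeasurableSpace X] {μ : Measure X} {k q : X → ℝ≥0∞}
    (hk : Measurable k) (hq : Measurable q) :
    (∫⁻ x, k x * q x ∂μ) ^ 2 ≤ (∫⁻ x, k x ∂μ) * ∫⁻ x, k x * q x ^ 2 ∂μ := by
  have h := ENNReal.lintegral_mul_le_Lp_mul_Lq μ Real.HolderConjugate.two_two
    (f := fun x => k x ^ (1 / 2 : ℝ)) (g := fun x => k x ^ (1 / 2 : ℝ) * q x)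
    (by fun_prop) (by fun_prop)
  have e0 : ∀ y : ℝ≥0∞, y ^ (1 / 2 : ℝ) * y ^ (1 / 2 : ℝ) = y := fun y => by
    rw [← ENNReal.rpow_add_of_nonneg _ _ (by norm_num) (by norm_num)]; norm_num
  have e1 : ∀ y : ℝ≥0∞, (y ^ (1 / 2 : ℝ)) ^ (2 : ℝ) = y := fun y => by
    rw [← ENNReal.rpow_mul]; norm_num
  simp only [Pi.mul_apply, ← mul_assoc, e0, ENNReal.mul_rpow_of_nonneg _ _ (zero_le_two (α := ℝ)), e1]
    at h
  calc _ ≤ _ := pow_le_pow_left₀ (zero_le) h 2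
    _ = _ := by
      rw [mul_pow]
      simp only [← ENNReal.rpow_natCast, Nat.cast_ofNat, e1]

/-- Cauchy–Schwarz against a kernel of mass `π`, then translation invariance. This bound for a
single direction serves only for the approximation error, where summing over directions is harmless.
-/
theorem lintegral_cauchyAvg_sq_le (w : Plane) {q : Plane → ℝ≥0∞} (hq : Measurable q) :
    ∫⁻ x, cauchyAvg w q x ^ 2 ≤ ENNReal.ofReal (Real.pi ^ 2) * ∫⁻ x, q x ^ 2 := by
  calc ∫⁻ x, cauchyAvg w q x ^ 2
      ≤ ∫⁻ x, ENNReal.ofReal Real.pi *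
          ∫⁻ s : ℝ, ENNReal.ofReal (1 + s ^ 2)⁻¹ * q (x - s • w) ^ 2 := by
        refine lintegral_mono fun x => ?_
        have := sq_lintegral_mul_le (μ := (volume : Measure ℝ))
          (k := fun s => ENNReal.ofReal (1 + s ^ 2)⁻¹) (q := fun s => q (x - s • w))
          (by fun_prop) (by fun_prop)
        rwa [lintegral_cauchy] at this
    _ = ENNReal.ofReal Real.pi *
          ∫⁻ s : ℝ, ∫⁻ x, ENNReal.ofReal (1 + s ^ 2)⁻¹ * q (x - s • w) ^ 2 := by
        rw [lintegral_const_mul, lintegral_lintegral_swap]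
        · exact Measurable.aemeasurable (by fun_prop)
        · exact Measurable.lintegral_prod_right' (f := fun z : Plane × ℝ =>
            ENNReal.ofReal (1 + z.2 ^ 2)⁻¹ * q (z.1 - z.2 • w) ^ 2) (by fun_prop)
    _ = ENNReal.ofReal Real.pi *
          ∫⁻ s : ℝ, ENNReal.ofReal (1 + s ^ 2)⁻¹ * ∫⁻ x, q x ^ 2 := by
        congr 2
        ext s
        rw [lintegral_const_mul _ (by fun_prop), lintegral_sub_right_eq_self (fun x => q x ^ 2)]
    _ = _ := by
        rw [lintegral_mul_const _ (by fun_prop), lintegral_cauchy, ← mul_assoc,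
          ← ENNReal.ofReal_mul Real.pi_pos.le, sq]

theorem lintegral_comp_mul_left {f : ℝ → ℝ≥0∞} {r : ℝ} (hr : 0 < r) :
    ∫⁻ x, f (r * x) = ENNReal.ofReal r⁻¹ * ∫⁻ x, f x := by
  have := lintegral_map_equiv (μ := (volume : Measure ℝ)) f
    (Homeomorph.mulLeft₀ r hr.ne').toMeasurableEquiv
  have h1 : Measure.map (Homeomorph.mulLeft₀ r hr.ne').toMeasurableEquiv volume
      = ENNReal.ofReal r⁻¹ • volume := by
    have := Real.map_volume_mul_left hr.ne'
    rw [abs_of_pos (by positivity)] at this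
    exact this
  rw [h1, lintegral_smul_measure] at this
  exact this.symm

/-- Averages over comparable lengths are comparable. -/
theorem cauchyAvg_smul_le {c : ℝ} (hc : 1 ≤ c) (w : Plane) (q : Plane → ℝ≥0∞) (x : Plane) :
    cauchyAvg (c • w) q x ≤ ENNReal.ofReal c * cauchyAvg w q x := by
  have hc0 : 0 < c := by linarith
  have h := lintegral_comp_mul_left
    (f := fun s => ENNReal.ofReal (1 + (s / c) ^ 2)⁻¹ * q (x - s • w)) hc0
  have e : cauchyAvg (c • w) q x = ∫⁻ s, ENNReal.ofReal (1 + ((c * s) / c) ^ 2)⁻¹ *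
      q (x - (c * s) • w) := by
    unfold cauchyAvg
    refine lintegral_congr fun s => ?_
    rw [mul_div_cancel_left₀ _ hc0.ne', smul_smul, mul_comm s]
  rw [e, h]
  unfold cauchyAvg
  rw [← lintegral_const_mul' _ _ ENNReal.ofReal_ne_top, ← lintegral_const_mul' _ _ ENNReal.ofReal_ne_top]
  refine lintegral_mono fun s => ?_
  rw [← mul_assoc, ← mul_assoc, ← ENNReal.ofReal_mul hc0.le, ← ENNReal.ofReal_mul (by positivity)]
  refine mul_le_mul_left (ENNReal.ofReal_le_ofReal ?_) _
  -- The dilated kernel is `c / (c ^ 2 + s ^ 2)`, at most `c / (1 + s ^ 2)` because `c ≥ 1`.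
  have : c⁻¹ * (1 + (s / c) ^ 2)⁻¹ = c * (c ^ 2 + s ^ 2)⁻¹ := by
    have : (0 : ℝ) < c ^ 2 + s ^ 2 := by positivity
    field_simp
  rw [this]
  gcongr
  nlinarith

/-- The multiplier of the average in the direction `w`. -/
theorem integral_cauchy_mul_fourier {h : Plane → ℂ} (hh : Integrable h) (w x : Plane) :
    ∫ s : ℝ, ((1 + s ^ 2)⁻¹ : ℝ) * fourier h (x - s • w)
      = fourier (fun ξ => (Real.pi * Real.exp (-|inner ℝ w ξ|) : ℝ) * h ξ) x := by
  rw [← fourier_superposition (κ := fun s : ℝ => (((1 + s ^ 2)⁻¹ : ℝ) : ℂ))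
    integrable_inv_one_add_sq.ofReal hh]
  simp_rw [integral_cauchy_mul_cexp]

/-- For increments of the same sign the cross term in the square of their sum is nonnegative. -/
theorem sq_enorm_sub_superadditive {a b c : ℝ} (h : (a ≤ b ∧ b ≤ c) ∨ (c ≤ b ∧ b ≤ a)) :
    ‖b - a‖ₑ ^ 2 + ‖c - b‖ₑ ^ 2 ≤ ‖c - a‖ₑ ^ 2 := by
  have e : ∀ t : ℝ, ‖t‖ₑ ^ 2 = ENNReal.ofReal (t ^ 2) := fun t => by
    rw [← ofReal_norm, ← ENNReal.ofReal_pow (norm_nonneg _), Real.norm_eq_abs, sq_abs]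
  rw [e, e, e, ← ENNReal.ofReal_add (by positivity) (by positivity)]
  refine ENNReal.ofReal_le_ofReal ?_
  rcases h with ⟨h1, h2⟩ | ⟨h1, h2⟩
  · nlinarith [mul_nonneg (sub_nonneg.2 h1) (sub_nonneg.2 h2)]
  · nlinarith [mul_nonneg (sub_nonneg.2 h1) (sub_nonneg.2 h2)]

/-- The directional maximal theorem for a monotone family of slopes, on the Fourier side. -/
theorem lintegral_iSup_fourier_exp_sq_le {h : Plane → ℂ} (h1 : Integrable h)
    (h2 : MemLp h 2 volume) (u₀ u₁ : Plane) {s : ℕ → ℝ} (hs : Monotone s) (p : ℕ) :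
    ∫⁻ x, (⨆ k ∈ Finset.Icc 0 (2 ^ p), ‖fourier (fun ξ =>
        (Real.pi * Real.exp (-|inner ℝ (u₀ + s k • u₁) ξ|) : ℝ) * h ξ) x‖ₑ) ^ 2
      ≤ ENNReal.ofReal (10 * Real.pi ^ 2 * (p + 1) ^ 2) * ∫⁻ x, ‖fourier h x‖ₑ ^ 2 := by
  set y : ℕ → Plane → ℝ := fun k ξ => inner ℝ (u₀ + s k • u₁) ξ with hy
  set m : ℕ → Plane → ℂ := fun k ξ => ((Real.pi * Real.exp (-|y k ξ|) : ℝ) : ℂ) * h ξ with hm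
  have ymeas : ∀ k, Measurable (y k) := fun k => by fun_prop
  have hle : ∀ k ξ, ‖m k ξ‖ ≤ Real.pi * ‖h ξ‖ := by
    intro k ξ
    simp only [hm, norm_mul, Complex.norm_real, Real.norm_eq_abs]
    refine mul_le_mul_of_nonneg_right ?_ (norm_nonneg _)
    rw [abs_of_pos Real.pi_pos, abs_of_pos (Real.exp_pos _)]
    have : Real.exp (-|y k ξ|) ≤ 1 := Real.exp_le_one_iff.2 (by simp)
    nlinarith [Real.pi_pos]
  have hmeas : ∀ k, AEStronglyMeasurable (m k) volume := fun k =>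
    (by fun_prop : Measurable fun ξ => ((Real.pi * Real.exp (-|y k ξ|) : ℝ) : ℂ)).aestronglyMeasurable.mul h1.1
  have m1 : ∀ k, Integrable (m k) := fun k =>
    (h1.norm.const_mul Real.pi).mono' (hmeas k) (Filter.Eventually.of_forall (hle k))
  have m2 : ∀ k, MemLp (m k) 2 volume := fun k =>
    h2.of_le_mul (hmeas k) (Filter.Eventually.of_forall (hle k))
  have hU : ∀ k, Measurable (fourier (m k)) := fun k => (continuous_fourierPlane (m1 k)).measurable
  set c : ℝ≥0∞ := ENNReal.ofReal ((2 * Real.pi) ^ 2) with hc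
  set I : ℝ≥0∞ := ∫⁻ x, ‖h x‖ₑ ^ 2 with hI
  set pe : ℝ≥0∞ := ENNReal.ofReal (Real.pi ^ 2) with hpe
  set D : ℕ → ℕ → ℝ≥0∞ := fun k l => c * (pe *
    ∫⁻ ξ, ‖expPrimitive (y l ξ) - expPrimitive (y k ξ)‖ₑ ^ 2 * ‖h ξ‖ₑ ^ 2) with hD
  have enorm_sq : ∀ t : ℝ, ‖t‖ₑ ^ 2 = ENNReal.ofReal (t ^ 2) := fun t => by
    rw [← ofReal_norm, ← ENNReal.ofReal_pow (norm_nonneg _), Real.norm_eq_abs, sq_abs]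
  have hsub : ∀ k l x, fourier (m l) x - fourier (m k) x = fourier (fun ξ => m l ξ - m k ξ) x := by
    intro k l x
    unfold fourier
    rw [← integral_sub]
    · simp only [mul_sub]
    · exact integrable_cexp_mul (m1 l) (by fun_prop)
    · exact integrable_cexp_mul (m1 k) (by fun_prop)
  have hDbound : ∀ k l, k ≤ l → ∫⁻ x, ‖fourier (m l) x - fourier (m k) x‖ₑ ^ 2 ≤ D k l := by
    intro k l _
    simp_rw [hsub]
    rw [lintegral_enorm_fourierPlane_sq (h := fun ξ => m l ξ - m k ξ) ((m1 l).sub (m1 k))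
      ((m2 l).sub (m2 k))]
    simp only [hD]
    gcongr
    rw [← lintegral_const_mul' _ _ ENNReal.ofReal_ne_top]
    refine lintegral_mono fun ξ => ?_
    rw [← mul_assoc, enorm_sq, ← ENNReal.ofReal_mul (by positivity)]
    simp only [hm]
    rw [← sub_mul, enorm_mul, mul_pow, ← Complex.ofReal_sub]
    gcongr
    have : ‖((Real.pi * Real.exp (-|y l ξ|) - Real.pi * Real.exp (-|y k ξ|) : ℝ) : ℂ)‖ₑ
      = ‖(Real.pi * Real.exp (-|y l ξ|) - Real.pi * Real.exp (-|y k ξ|) : ℝ)‖ₑ := by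
      rw [← ofReal_norm, ← ofReal_norm, Complex.norm_real]
    rw [this, enorm_sq, ← mul_sub, mul_pow]
    exact ENNReal.ofReal_le_ofReal (mul_le_mul_of_nonneg_left
      (sq_le_sq.2 (abs_exp_neg_abs_sub_le (y l ξ) (y k ξ))) (by positivity))
  have ysq : ∀ k l ξ, y l ξ = y k ξ + (s l - s k) * inner ℝ u₁ ξ := by
    intro k l ξ
    simp only [hy, inner_add_left, inner_smul_left, conj_trivial]
    ring
  -- For fixed `ξ` the number `y k ξ` is affine in `s k`, hence monotone in `k`, in the sense given
  -- by the sign of `⟨u₁, ξ⟩`. `expPrimitive` preserves this order, and superadditivity holds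
  -- pointwise in `ξ`.
  have hDsup : ∀ k l n, k ≤ l → l ≤ n → D k l + D l n ≤ D k n := by
    intro k l n hkl hln
    simp only [hD]
    rw [← mul_add, ← mul_add, ← lintegral_add_right']
    · gcongr with ξ
      rw [← add_mul]
      gcongr
      apply sq_enorm_sub_superadditive
      have a1 := sub_nonneg.2 (hs hkl)
      have a2 := sub_nonneg.2 (hs hln)
      rcases le_total 0 (inner ℝ u₁ ξ) with h | h
      · left
        constructor <;> apply expPrimitive_mono
        · rw [ysq k l]; nlinarith
        · rw [ysq l n]; nlinarith
      · right
        constructor <;> apply expPrimitive_mono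
        · rw [ysq l n]; nlinarith
        · rw [ysq k l]; nlinarith
    · have := h1.1.enorm
      have e1 := (measurable_expPrimitive.comp (ymeas n)).sub (measurable_expPrimitive.comp (ymeas l))
      exact (e1.enorm.aemeasurable.pow_const 2).mul (this.pow_const 2)
  have hDle : ∀ k l, D k l ≤ c * (pe * (4 * I)) := by
    intro k l
    simp only [hD]
    gcongr
    rw [hI, ← lintegral_const_mul' _ _ (by norm_num)]
    gcongr with ξ
    rw [enorm_sq]
    have h4 : (4 : ℝ≥0∞) = ENNReal.ofReal 4 := by norm_num
    rw [h4]
    refine ENNReal.ofReal_le_ofReal ?_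
    have b1 := abs_le.1 (abs_expPrimitive_le (y l ξ))
    have b2 := abs_le.1 (abs_expPrimitive_le (y k ξ))
    have : |expPrimitive (y l ξ) - expPrimitive (y k ξ)| ≤ 2 :=
      abs_le.2 ⟨by linarith [b1.1, b2.2], by linarith [b1.2, b2.1]⟩
    calc _ ≤ (2 : ℝ) ^ 2 := sq_le_sq' (by linarith [(abs_le.1 this).1]) (abs_le.1 this).2
      _ = 4 := by norm_num
  have hRM := lintegral_iSup_enorm_sub_sq_le (μ := volume) (fun k => fourier (m k)) hU D hDbound
    hDsup p 0
  rw [zero_add] at hRM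
  have h0 : ∫⁻ x, ‖fourier (m 0) x‖ₑ ^ 2 ≤ c * (pe * I) := by
    rw [lintegral_enorm_fourierPlane_sq (m1 0) (m2 0)]
    gcongr
    rw [hI, ← lintegral_const_mul' _ _ ENNReal.ofReal_ne_top]
    gcongr with ξ
    rw [ENNReal.ofReal_pow Real.pi_pos.le, ← mul_pow]
    gcongr
    rw [← ofReal_norm, ← ofReal_norm, ← ENNReal.ofReal_mul Real.pi_pos.le]
    exact ENNReal.ofReal_le_ofReal (hle 0 ξ)
  have hptw : ∀ x, (⨆ k ∈ Finset.Icc 0 (2 ^ p), ‖fourier (m k) x‖ₑ) ^ 2 ≤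
      2 * ‖fourier (m 0) x‖ₑ ^ 2
      + 2 * (⨆ k ∈ Finset.Icc 0 (2 ^ p), ‖fourier (m k) x - fourier (m 0) x‖ₑ) ^ 2 := by
    intro x
    have := enorm_sq_weighted_add_le 1 le_rfl (‖fourier (m 0) x‖ₑ)
      (⨆ k ∈ Finset.Icc 0 (2 ^ p), ‖fourier (m k) x - fourier (m 0) x‖ₑ)
    rw [Nat.cast_one, one_mul, one_mul, one_add_one_eq_two] at this
    refine le_trans ?_ this
    gcongr
    refine iSup₂_le fun k hk => ?_
    have e : fourier (m k) x = fourier (m 0) x + (fourier (m k) x - fourier (m 0) x) := by ring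
    calc ‖fourier (m k) x‖ₑ ≤ ‖fourier (m 0) x‖ₑ + ‖fourier (m k) x - fourier (m 0) x‖ₑ := by
          conv_lhs => rw [e]
          exact enorm_add_le _ _
      _ ≤ _ := by
          gcongr
          exact le_iSup₂ (f := fun k (_ : k ∈ Finset.Icc 0 (2 ^ p)) =>
            ‖fourier (m k) x - fourier (m 0) x‖ₑ) k hk
  calc _ ≤ ∫⁻ x, (2 * ‖fourier (m 0) x‖ₑ ^ 2
      + 2 * (⨆ k ∈ Finset.Icc 0 (2 ^ p), ‖fourier (m k) x - fourier (m 0) x‖ₑ) ^ 2) :=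
        lintegral_mono hptw
    _ = 2 * (∫⁻ x, ‖fourier (m 0) x‖ₑ ^ 2)
      + 2 * ∫⁻ x, (⨆ k ∈ Finset.Icc 0 (2 ^ p), ‖fourier (m k) x - fourier (m 0) x‖ₑ) ^ 2 := by
        rw [lintegral_add_left ((((hU 0).enorm).pow_const 2).const_mul 2),
          lintegral_const_mul' _ _ (by norm_num), lintegral_const_mul' _ _ (by norm_num)]
    _ ≤ 2 * (c * (pe * I)) + 2 * (((p + 1 : ℕ) : ℝ≥0∞) ^ 2 * (c * (pe * (4 * I)))) := by
        gcongr
        exact hRM.trans (by gcongr; exact hDle _ _)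
    _ ≤ 2 * (((p + 1 : ℕ) : ℝ≥0∞) ^ 2 * (c * (pe * I)))
        + 2 * (((p + 1 : ℕ) : ℝ≥0∞) ^ 2 * (c * (pe * (4 * I)))) := by
        gcongr 2 * ?_ + _
        refine le_mul_of_one_le_left (zero_le) ?_
        exact one_le_pow₀ (by exact_mod_cast Nat.le_add_left 1 p)
    -- `10 = 2 + 2 * 4`: the first term of the sequence, and the increments, which are bounded
    -- through `|expPrimitive| ≤ 1`.
    _ = (10 * pe * ((p + 1 : ℕ) : ℝ≥0∞) ^ 2) * (c * I) := by ring
    _ = _ := by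
        rw [lintegral_enorm_fourierPlane_sq h1 h2, ENNReal.ofReal_mul (by positivity),
          ENNReal.ofReal_mul (by positivity)]
        congr 2
        · rw [hpe, ENNReal.ofReal_ofNat]
        · rw [ENNReal.ofReal_pow (by positivity), ← Nat.cast_add_one, ENNReal.ofReal_natCast]

/-! ### From Fourier transforms to averages of arbitrary nonnegative functions -/

theorem memLp_two_of_bounded {X : Type*} [MeasurableSpace X] {μ : Measure X} {h : X → ℂ}
    (h1 : Integrable h μ) {B : ℝ} (hB : ∀ x, ‖h x‖ ≤ B) : MemLp h 2 μ := by
  rw [memLp_two_iff_integrable_sq_norm h1.1]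
  refine (h1.norm.const_mul B).mono' (h1.1.norm.pow 2) (Filter.Eventually.of_forall fun x => ?_)
  rw [Real.norm_of_nonneg (by positivity), sq]
  exact mul_le_mul_of_nonneg_right (hB x) (norm_nonneg _)

/-- Every Schwartz function is the Fourier transform of a function in `L¹ ∩ L²`. -/
theorem exists_fourier_eq_schwartz (f : 𝓢(Plane, ℂ)) :
    ∃ h : Plane → ℂ, Integrable h ∧ MemLp h 2 volume ∧ fourier h = f := by
  set φ : 𝓢(Plane, ℂ) := 𝓕⁻ f with hφ
  have hpi : (Real.pi : ℂ) ≠ 0 := by exact_mod_cast Real.pi_ne_zero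
  have h0 : (2 * Real.pi)⁻¹ ≠ 0 := by positivity
  set h : Plane → ℂ := fun ξ => ((2 * Real.pi) ^ 2 : ℂ)⁻¹ * φ ((2 * Real.pi)⁻¹ • ξ) with hh
  have h1 : Integrable h := (φ.integrable.comp_smul h0).const_mul _
  refine ⟨h, h1, memLp_two_of_bounded h1 (B := ‖((2 * Real.pi) ^ 2 : ℂ)⁻¹‖ *
    ‖φ.toBoundedContinuousFunction‖) fun x => ?_, ?_⟩
  · simp only [hh, norm_mul]
    gcongr
    exact φ.toBoundedContinuousFunction.norm_coe_le_norm _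
  · ext x
    have e := integral_comp_smul_plane (fun η =>
      Complex.exp (-((inner ℝ x ((2 * Real.pi) • η) : ℝ) : ℂ) * Complex.I) * φ η)
    have e2 : fourier h x = ((2 * Real.pi) ^ 2 : ℂ)⁻¹ * ∫ ξ, Complex.exp (-((inner ℝ x ((2 * Real.pi) •
        (2 * Real.pi)⁻¹ • ξ) : ℝ) : ℂ) * Complex.I) * φ ((2 * Real.pi)⁻¹ • ξ) := by
      rw [fourier, ← integral_const_mul]
      refine integral_congr_ae (Filter.Eventually.of_forall fun ξ => ?_)
      dsimp only
      rw [smul_smul, mul_inv_cancel₀ (by positivity), one_smul]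
      simp only [hh]
      ring
    have e3 : (f : Plane → ℂ) x = 𝓕 (φ : Plane → ℂ) x := by
      rw [← SchwartzMap.fourier_coe, hφ, FourierTransform.fourier_fourierInv_eq]
    rw [e2, e, ← mul_assoc, inv_mul_cancel₀
      (pow_ne_zero 2 (mul_ne_zero two_ne_zero hpi)), one_mul, e3, Real.fourier_eq']
    refine integral_congr_ae (Filter.Eventually.of_forall fun ξ => ?_)
    dsimp only
    rw [smul_eq_mul, inner_smul_right, real_inner_comm]
    congr 2
    push_cast
    ring

/-- The Fourier argument needs a smooth function, while the majorants to be averaged are merely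
measurable. Replacing `q` by an approximation `f` gives a complex-valued average, to which the
multiplier bound applies, and an average of `|q - f|` as error. -/
theorem cauchyAvg_le_add (w : Plane) {q : Plane → ℝ≥0∞} (hq : Measurable q) (hfin : ∀ x, q x ≠ ⊤)
    {f : Plane → ℂ} (hf : Measurable f) {B : ℝ} (hB : ∀ x, ‖f x‖ ≤ B) (x : Plane) :
    cauchyAvg w q x ≤ ‖∫ s : ℝ, (((1 + s ^ 2)⁻¹ : ℝ) : ℂ) * f (x - s • w)‖ₑ
      + cauchyAvg w (fun x => ‖((q x).toReal : ℂ) - f x‖ₑ) x := by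
  by_cases hT : cauchyAvg w (fun x => ‖((q x).toReal : ℂ) - f x‖ₑ) x = ⊤
  -- An infinite error makes the claim trivial; a finite one is what makes the Bochner integrals
  -- below converge.
  · rw [hT]; simp
  set k : ℝ → ℝ := fun s => (1 + s ^ 2)⁻¹ with hk
  have kpos : ∀ s, 0 ≤ k s := fun s => by positivity
  have kmeas : Measurable fun s => ((k s : ℝ) : ℂ) := by fun_prop
  set F : ℝ → ℂ := fun s => (k s : ℂ) * f (x - s • w)
  set R : ℝ → ℂ := fun s => (k s : ℂ) * (((q (x - s • w)).toReal : ℂ) - f (x - s • w))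
  have fm : Measurable fun s : ℝ => f (x - s • w) := by fun_prop
  have qm : Measurable fun s : ℝ => (((q (x - s • w)).toReal : ℝ) : ℂ) := by fun_prop
  have enk : ∀ s, ‖(k s : ℂ)‖ₑ = ENNReal.ofReal (k s) := fun s => by
    rw [← ofReal_norm, Complex.norm_real, Real.norm_of_nonneg (kpos s)]
  have hF : Integrable F := by
    refine (integrable_inv_one_add_sq.mul_const B).mono' (kmeas.mul fm).aestronglyMeasurable
      (Filter.Eventually.of_forall fun s => ?_)
    simp only [F, norm_mul, Complex.norm_real, Real.norm_of_nonneg (kpos s)]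
    exact mul_le_mul_of_nonneg_left (hB _) (kpos s)
  have hRe : ∫⁻ s, ‖R s‖ₑ = cauchyAvg w (fun x => ‖((q x).toReal : ℂ) - f x‖ₑ) x := by
    refine lintegral_congr fun s => ?_
    simp only [R, enorm_mul, enk]
    rfl
  have hR : Integrable R := by
    refine ⟨(kmeas.mul (qm.sub fm)).aestronglyMeasurable, ?_⟩
    rw [HasFiniteIntegral, hRe]
    exact lt_top_iff_ne_top.2 hT
  have hsum : ∀ s, F s + R s = ((k s * (q (x - s • w)).toReal : ℝ) : ℂ) := fun s => by
    simp only [F, R]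
    push_cast
    ring
  have hint : Integrable fun s => ((k s * (q (x - s • w)).toReal : ℝ) : ℂ) := by
    have := hF.add hR
    exact this.congr (Filter.Eventually.of_forall hsum)
  have hintR : Integrable fun s => k s * (q (x - s • w)).toReal := by
    have := hint.re
    simpa using! this
  have e1 : cauchyAvg w q x = ‖∫ s, (F s + R s)‖ₑ := by
    simp_rw [hsum]
    rw [integral_complex_ofReal, ← ofReal_norm, Complex.norm_real, Real.norm_of_nonneg
      (integral_nonneg fun s => mul_nonneg (kpos s) ENNReal.toReal_nonneg),
      ofReal_integral_eq_lintegral_ofReal hintR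
      (Filter.Eventually.of_forall fun s => mul_nonneg (kpos s) ENNReal.toReal_nonneg)]
    refine lintegral_congr fun s => ?_
    rw [ENNReal.ofReal_mul (kpos s), ENNReal.ofReal_toReal (hfin _)]
  rw [e1, integral_add hF hR]
  refine (enorm_add_le _ _).trans ?_
  gcongr
  rw [← hRe]
  exact enorm_integral_le_lintegral_enorm _

theorem sq_add_le_two_mul (a b : ℝ≥0∞) : (a + b) ^ 2 ≤ 2 * a ^ 2 + 2 * b ^ 2 := by
  have := enorm_sq_weighted_add_le 1 le_rfl a b
  rwa [Nat.cast_one, one_mul, one_mul, one_add_one_eq_two] at this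

theorem sq_biSup_le_sum {ι : Type*} (s : Finset ι) (f : ι → ℝ≥0∞) :
    (⨆ i ∈ s, f i) ^ 2 ≤ ∑ i ∈ s, f i ^ 2 := by
  rcases s.eq_empty_or_nonempty with rfl | hs
  · simp
  obtain ⟨i, hi, h⟩ := s.exists_max_image f hs
  have : (⨆ i ∈ s, f i) = f i := le_antisymm (iSup₂_le h) (le_iSup₂ (f := fun i (_ : i ∈ s) => f i) i hi)
  rw [this]
  exact Finset.single_le_sum (f := fun i => f i ^ 2) (fun _ _ => zero_le) hi

theorem exists_schwartz_approx {q : Plane → ℝ≥0∞} (hq : Measurable q) (hfin : ∀ x, q x ≠ ⊤)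
    (hq2 : ∫⁻ x, q x ^ 2 ≠ ⊤) {η : ℝ} (hη : 0 < η) :
    ∃ f : 𝓢(Plane, ℂ), ∫⁻ x, ‖((q x).toReal : ℂ) - f x‖ₑ ^ 2 ≤ ENNReal.ofReal (η ^ 2) := by
  have k : ∀ g : Plane → ℂ, ∫⁻ x, ‖g x‖ₑ ^ 2 = eLpNorm g 2 volume ^ 2 := fun g => by
    have := eLpNorm_nnreal_pow_eq_lintegral (f := g) (μ := (volume : Measure Plane)) (p := 2)
      (by norm_num)
    simpa using this.symm
  have e : ∀ x, ‖((q x).toReal : ℂ)‖ₑ = q x := fun x => by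
    rw [← ofReal_norm, Complex.norm_real, Real.norm_of_nonneg ENNReal.toReal_nonneg,
      ENNReal.ofReal_toReal (hfin x)]
  have hm : MemLp (fun x => ((q x).toReal : ℂ)) 2 (volume : Measure Plane) := by
    refine ⟨Measurable.aestronglyMeasurable (by fun_prop), ?_⟩
    have := k fun x => ((q x).toReal : ℂ)
    simp_rw [e] at this
    rw [this] at hq2
    rw [lt_top_iff_ne_top]
    intro h
    simp [h] at hq2
  obtain ⟨g, hg₁, hg₂, hg₃⟩ := hm.exist_eLpNorm_sub_le (by norm_num) (by norm_num) hη
  refine ⟨hg₁.toSchwartzMap hg₂, ?_⟩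
  rw [k, ENNReal.ofReal_pow hη.le]
  gcongr
  exact hg₃

/-- The maximal theorem for averages in the directions `u₀ + s k • u₁`. -/
theorem lintegral_iSup_cauchyAvg_sq_le_of_monotone {q : Plane → ℝ≥0∞} (hq : Measurable q)
    (hfin : ∀ x, q x ≠ ⊤) (u₀ u₁ : Plane) {s : ℕ → ℝ} (hs : Monotone s) (p : ℕ) :
    ∫⁻ x, (⨆ k ∈ Finset.Icc 0 (2 ^ p), cauchyAvg (u₀ + s k • u₁) q x) ^ 2
      ≤ ENNReal.ofReal (40 * Real.pi ^ 2 * (p + 1) ^ 2) * ∫⁻ x, q x ^ 2 := by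
  set T := Finset.Icc 0 (2 ^ p) with hT
  -- The final `40` is four times the `10` of the Fourier-side bound: one doubling separates main
  -- term and error, another compares `f` with `q`.
  set c := ENNReal.ofReal (10 * Real.pi ^ 2 * (p + 1) ^ 2) with hc
  have c4 : ENNReal.ofReal (40 * Real.pi ^ 2 * (p + 1) ^ 2) = 4 * c := by
    rw [hc, show (4 : ℝ≥0∞) = ENNReal.ofReal 4 by norm_num, ← ENNReal.ofReal_mul (by norm_num)]
    ring_nf
  have hcpos : c ≠ 0 := by
    rw [hc, Ne, ENNReal.ofReal_eq_zero, not_le]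
    positivity
  by_cases hq2 : ∫⁻ x, q x ^ 2 = ⊤
  · rw [hq2, c4, ENNReal.mul_top (by simp [hcpos])]
    exact le_top
  -- This constant depends on the number of directions, but it multiplies only `η ^ 2`, and `η` is
  -- arbitrary.
  set C' : ℝ≥0∞ := 4 * c + 2 * (T.card * ENNReal.ofReal (Real.pi ^ 2)) with hC'
  have hC't : C' ≠ ⊤ := by
    rw [hC']
    refine ENNReal.add_ne_top.2 ⟨ENNReal.mul_ne_top (by norm_num) ENNReal.ofReal_ne_top,
      ENNReal.mul_ne_top (by norm_num) (ENNReal.mul_ne_top (by simp) ENNReal.ofReal_ne_top)⟩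
  have main : ∀ η : ℝ, 0 < η → ∫⁻ x, (⨆ k ∈ T, cauchyAvg (u₀ + s k • u₁) q x) ^ 2
      ≤ 4 * c * (∫⁻ x, q x ^ 2) + C' * ENNReal.ofReal (η ^ 2) := by
    intro η hη
    obtain ⟨f, hf⟩ := exists_schwartz_approx hq hfin hq2 hη
    obtain ⟨h, h1, h2, hfour⟩ := exists_fourier_eq_schwartz f
    set r : Plane → ℝ≥0∞ := fun x => ‖((q x).toReal : ℂ) - f x‖ₑ with hr
    have fm : Measurable f := f.continuous.measurable
    have rm : Measurable r := by fun_prop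
    have hB : ∀ x, ‖f x‖ ≤ ‖f.toBoundedContinuousFunction‖ := fun x =>
      f.toBoundedContinuousFunction.norm_coe_le_norm x
    have hRM := lintegral_iSup_fourier_exp_sq_le h1 h2 u₀ u₁ hs p
    simp_rw [← integral_cauchy_mul_fourier h1, hfour] at hRM
    set A : Plane → ℝ≥0∞ := fun x => ⨆ k ∈ T,
      ‖∫ t : ℝ, (((1 + t ^ 2)⁻¹ : ℝ) : ℂ) * f (x - t • (u₀ + s k • u₁))‖ₑ with hA
    set B : Plane → ℝ≥0∞ := fun x => ⨆ k ∈ T, cauchyAvg (u₀ + s k • u₁) r x with hBd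
    have Bm : Measurable B :=
      Measurable.biSup _ (Finset.countable_toSet _) fun k _ => measurable_cauchyAvg _ rm
    have hle : ∀ x, (⨆ k ∈ T, cauchyAvg (u₀ + s k • u₁) q x) ^ 2 ≤ 2 * A x ^ 2 + 2 * B x ^ 2 := by
      intro x
      refine le_trans ?_ (sq_add_le_two_mul _ _)
      gcongr
      refine iSup₂_le fun k hk => ?_
      refine (cauchyAvg_le_add _ hq hfin fm hB x).trans ?_
      gcongr
      · exact le_iSup₂ (f := fun k (_ : k ∈ T) =>
          ‖∫ t : ℝ, (((1 + t ^ 2)⁻¹ : ℝ) : ℂ) * f (x - t • (u₀ + s k • u₁))‖ₑ) k hk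
      · exact le_iSup₂ (f := fun k (_ : k ∈ T) => cauchyAvg (u₀ + s k • u₁) r x) k hk
    have hBint : ∫⁻ x, B x ^ 2 ≤ T.card * (ENNReal.ofReal (Real.pi ^ 2) * ∫⁻ x, r x ^ 2) := by
      calc ∫⁻ x, B x ^ 2 ≤ ∫⁻ x, ∑ k ∈ T, cauchyAvg (u₀ + s k • u₁) r x ^ 2 :=
            lintegral_mono fun x => sq_biSup_le_sum _ _
        _ = ∑ k ∈ T, ∫⁻ x, cauchyAvg (u₀ + s k • u₁) r x ^ 2 :=
            lintegral_finsetSum _ fun k _ => (measurable_cauchyAvg _ rm).pow_const 2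
        _ ≤ ∑ k ∈ T, ENNReal.ofReal (Real.pi ^ 2) * ∫⁻ x, r x ^ 2 :=
            Finset.sum_le_sum fun k _ => lintegral_cauchyAvg_sq_le _ rm
        _ = _ := by rw [Finset.sum_const, nsmul_eq_mul]
    have hfq : ∫⁻ x, ‖f x‖ₑ ^ 2 ≤ 2 * (∫⁻ x, q x ^ 2) + 2 * ∫⁻ x, r x ^ 2 := by
      rw [← lintegral_const_mul' _ _ (by norm_num), ← lintegral_const_mul' _ _ (by norm_num),
        ← lintegral_add_right _ (by fun_prop)]
      refine lintegral_mono fun x => ?_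
      refine le_trans ?_ (sq_add_le_two_mul _ _)
      gcongr
      have e : ‖((q x).toReal : ℂ)‖ₑ = q x := by
        rw [← ofReal_norm, Complex.norm_real, Real.norm_of_nonneg ENNReal.toReal_nonneg,
          ENNReal.ofReal_toReal (hfin x)]
      calc ‖f x‖ₑ = ‖((q x).toReal : ℂ) - (((q x).toReal : ℂ) - f x)‖ₑ := by rw [sub_sub_cancel]
        _ ≤ ‖((q x).toReal : ℂ)‖ₑ + ‖((q x).toReal : ℂ) - f x‖ₑ := enorm_sub_le
        _ = _ := by rw [e]
    calc ∫⁻ x, (⨆ k ∈ T, cauchyAvg (u₀ + s k • u₁) q x) ^ 2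
        ≤ ∫⁻ x, (2 * A x ^ 2 + 2 * B x ^ 2) := lintegral_mono hle
      _ = 2 * (∫⁻ x, A x ^ 2) + 2 * ∫⁻ x, B x ^ 2 := by
          rw [lintegral_add_right _ (by fun_prop), lintegral_const_mul' _ _ (by norm_num),
            lintegral_const_mul' _ _ (by norm_num)]
      _ ≤ 2 * (c * (2 * (∫⁻ x, q x ^ 2) + 2 * ∫⁻ x, r x ^ 2))
          + 2 * (T.card * (ENNReal.ofReal (Real.pi ^ 2) * ∫⁻ x, r x ^ 2)) := by
          gcongr
          exact hRM.trans (mul_le_mul' le_rfl hfq)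
      _ = 4 * c * (∫⁻ x, q x ^ 2) + C' * ∫⁻ x, r x ^ 2 := by rw [hC']; ring
      _ ≤ _ := by gcongr
  rw [c4]
  refine ENNReal.le_of_forall_pos_le_add fun ε hε _ => ?_
  have hpos : 0 < (ε : ℝ) / (C'.toReal + 1) := by positivity
  refine (main (Real.sqrt (ε / (C'.toReal + 1))) (Real.sqrt_pos.2 hpos)).trans ?_
  refine add_le_add le_rfl ?_
  rw [Real.sq_sqrt hpos.le, ← ENNReal.ofReal_toReal hC't, ← ENNReal.ofReal_mul ENNReal.toReal_nonneg,
    ← ENNReal.ofReal_coe_nnreal]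
  refine ENNReal.ofReal_le_ofReal ?_
  rw [ENNReal.toReal_ofReal ENNReal.toReal_nonneg, mul_div_assoc', div_le_iff₀ (by positivity)]
  nlinarith [ε.2, C'.toReal_nonneg]

/-- The maximal theorem for averages in finitely many directions. -/
theorem lintegral_iSup_cauchyAvg_sq_le {q : Plane → ℝ≥0∞} (hq : Measurable q)
    (hfin : ∀ x, q x ≠ ⊤) (u₀ u₁ : Plane) (S : Finset ℝ) {p : ℕ} (hp : S.card ≤ 2 ^ p) :
    ∫⁻ x, (⨆ s ∈ S, cauchyAvg (u₀ + s • u₁) q x) ^ 2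
      ≤ ENNReal.ofReal (40 * Real.pi ^ 2 * (p + 1) ^ 2) * ∫⁻ x, q x ^ 2 := by
  rcases S.eq_empty_or_nonempty with rfl | hS
  · simp
  have hc : 0 < S.card := hS.card_pos
  -- The slopes in increasing order, constant after the last one, so that the sequence is monotone
  -- on all of `ℕ`.
  set s : ℕ → ℝ := fun k => S.orderEmbOfFin rfl ⟨min k (S.card - 1), by omega⟩ with hs
  have hmono : Monotone s := by
    intro a b hab
    refine (S.orderEmbOfFin rfl).monotone ?_
    simp only [Fin.mk_le_mk]
    omega
  refine le_trans (lintegral_mono fun x => ?_)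
    (lintegral_iSup_cauchyAvg_sq_le_of_monotone hq hfin u₀ u₁ hmono p)
  gcongr
  refine iSup₂_le fun t ht => ?_
  have : t ∈ Set.range (S.orderEmbOfFin rfl) := by
    rw [Finset.range_orderEmbOfFin]; exact ht
  obtain ⟨⟨k, hk⟩, rfl⟩ := this
  have e : S.orderEmbOfFin rfl ⟨k, hk⟩ = s k := by
    simp only [hs]
    congr
    omega
  rw [e]
  exact le_iSup₂ (f := fun k (_ : k ∈ Finset.Icc 0 (2 ^ p)) => cauchyAvg (u₀ + s k • u₁) q x) k
    (Finset.mem_Icc.2 ⟨by omega, by omega⟩)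

/-! ### Directions combined with dyadic lengths -/

/-- The maximal function over finitely many directions and dyadic lengths. -/
def dirMax (u₀ u₁ : Plane) (S : Finset ℝ) (a : ℝ) (K : ℕ) (q : Plane → ℝ≥0∞) (x : Plane) : ℝ≥0∞ :=
  ⨆ k ∈ Finset.range K, ⨆ s ∈ S, cauchyAvg ((a * 2 ^ k) • u₀ + s • (a * 2 ^ k) • u₁) q x

theorem measurable_dirMax (u₀ u₁ : Plane) (S : Finset ℝ) (a : ℝ) (K : ℕ) {q : Plane → ℝ≥0∞}
    (hq : Measurable q) : Measurable (dirMax u₀ u₁ S a K q) :=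
  Measurable.biSup _ (Finset.countable_toSet _) fun _ _ =>
    Measurable.biSup _ (Finset.countable_toSet _) fun _ _ => measurable_cauchyAvg _ hq

theorem dirMax_le_of_le {u₀ u₁ : Plane} {S : Finset ℝ} {a : ℝ} {K : ℕ} {q : Plane → ℝ≥0∞}
    {B : ℝ≥0∞} (h : ∀ x, q x ≤ B) (x : Plane) :
    dirMax u₀ u₁ S a K q x ≤ ENNReal.ofReal Real.pi * B :=
  iSup₂_le fun _ _ => iSup₂_le fun _ _ => cauchyAvg_le_of_le h x

/-- The supremum over the `K` lengths is replaced by a sum of squares. The factor `K` so lost is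
affordable, since `K` will be logarithmic in `1/δ`. -/
theorem lintegral_dirMax_sq_le (u₀ u₁ : Plane) (S : Finset ℝ) (a : ℝ) (K : ℕ)
    {q : Plane → ℝ≥0∞} (hq : Measurable q) (hfin : ∀ x, q x ≠ ⊤) {p : ℕ} (hp : S.card ≤ 2 ^ p) :
    ∫⁻ x, dirMax u₀ u₁ S a K q x ^ 2
      ≤ ENNReal.ofReal (K * (40 * Real.pi ^ 2 * (p + 1) ^ 2)) * ∫⁻ x, q x ^ 2 := by
  calc ∫⁻ x, dirMax u₀ u₁ S a K q x ^ 2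
      ≤ ∫⁻ x, ∑ k ∈ Finset.range K,
        (⨆ s ∈ S, cauchyAvg ((a * 2 ^ k) • u₀ + s • (a * 2 ^ k) • u₁) q x) ^ 2 :=
        lintegral_mono fun x => sq_biSup_le_sum _ _
    _ = ∑ k ∈ Finset.range K, ∫⁻ x,
        (⨆ s ∈ S, cauchyAvg ((a * 2 ^ k) • u₀ + s • (a * 2 ^ k) • u₁) q x) ^ 2 :=
        lintegral_finsetSum _ fun k _ => (Measurable.biSup _ (Finset.countable_toSet _)
          fun _ _ => measurable_cauchyAvg _ hq).pow_const 2
    _ ≤ ∑ k ∈ Finset.range K, ENNReal.ofReal (40 * Real.pi ^ 2 * (p + 1) ^ 2) * ∫⁻ x, q x ^ 2 :=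
        Finset.sum_le_sum fun k _ => lintegral_iSup_cauchyAvg_sq_le hq hfin _ _ S hp
    _ = _ := by
        rw [Finset.sum_const, Finset.card_range, nsmul_eq_mul,
          ENNReal.ofReal_mul (Nat.cast_nonneg K), ENNReal.ofReal_natCast]
        exact (mul_assoc _ _ _).symm

/-- An average along a segment direction of arbitrary length is controlled by the dyadic ones. -/
theorem cauchyAvg_le_dirMax {u₀ u₁ : Plane} {S : Finset ℝ} {a : ℝ} (ha : 0 < a) {K : ℕ}
    {q : Plane → ℝ≥0∞} {s : ℝ} (hs : s ∈ S) {l : ℝ} (h1 : a ≤ l) (h2 : l < a * 2 ^ K) (x : Plane) :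
    cauchyAvg (l • (u₀ + s • u₁)) q x ≤ 2 * dirMax u₀ u₁ S a K q x := by
  have hex : ∃ n : ℕ, l < a * 2 ^ n := ⟨K, h2⟩
  classical
  -- The least `n` with `l < a * 2 ^ n`. It is positive, and its predecessor gives a dyadic length
  -- below `l` by a factor less than `2`.
  set n := Nat.find hex with hn
  have hn1 : l < a * 2 ^ n := Nat.find_spec hex
  have hn0 : n ≠ 0 := by
    intro h
    rw [h] at hn1
    simp at hn1
    linarith
  obtain ⟨k, hk⟩ := Nat.exists_eq_succ_of_ne_zero hn0
  have hk1 : a * 2 ^ k ≤ l := not_lt.1 (Nat.find_min hex (m := k) (by omega))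
  have hnK : n ≤ K := Nat.find_min' hex h2
  set b := a * 2 ^ k with hb
  have hbpos : 0 < b := by positivity
  have e : l • (u₀ + s • u₁) = (l / b) • (b • u₀ + s • b • u₁) := by
    rw [smul_comm s b u₁, ← smul_add, smul_smul, div_mul_cancel₀ _ hbpos.ne']
  rw [e]
  refine (cauchyAvg_smul_le ((one_le_div hbpos).2 hk1) _ _ _).trans ?_
  gcongr
  · rw [ENNReal.ofReal_le_iff_le_toReal (by norm_num), ENNReal.toReal_ofNat, div_le_iff₀ hbpos]
    rw [hk, pow_succ] at hn1
    linarith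
  · refine le_trans ?_ (le_iSup₂ (f := fun k (_ : k ∈ Finset.range K) => ⨆ s ∈ S,
      cauchyAvg ((a * 2 ^ k) • u₀ + s • (a * 2 ^ k) • u₁) q x) k (Finset.mem_range.2 (by omega)))
    exact le_iSup₂ (f := fun s (_ : s ∈ S) =>
      cauchyAvg ((a * 2 ^ k) • u₀ + s • (a * 2 ^ k) • u₁) q x) s hs

/-! ### Multiplication by strip cutoffs -/

theorem SchwartzMap.exists_le_cauchy (κ : 𝓢(ℝ, ℂ)) :
    ∃ C : ℝ, 0 < C ∧ ∀ s, ‖κ s‖ ≤ C * (1 + s ^ 2)⁻¹ := by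
  obtain ⟨C₀, hC₀, h0⟩ := κ.decay 0 0
  obtain ⟨C₂, hC₂, h2⟩ := κ.decay 2 0
  refine ⟨C₀ + C₂, by positivity, fun s => ?_⟩
  have a0 := h0 s
  have a2 := h2 s
  simp only [norm_iteratedFDeriv_zero, pow_zero, one_mul, Real.norm_eq_abs, sq_abs] at a0 a2
  rw [← div_eq_mul_inv, le_div_iff₀ (by positivity)]
  nlinarith

/-- Fourier inversion for a smooth function of compact support; the density is its Fourier
transform. -/
theorem IsStripCutoff.exists_schwartz {α : ℝ → ℝ} (hα : IsStripCutoff α) :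
    ∃ κ : 𝓢(ℝ, ℂ), ∀ y, (α y : ℂ)
      = ∫ s, κ s * Complex.exp (((2 * Real.pi * s * y : ℝ) : ℂ) * Complex.I) := by
  have hc : HasCompactSupport α :=
    HasCompactSupport.intro (K := Icc (-101 / 100 : ℝ) (101 / 100)) isCompact_Icc hα.eq_zero
  have hg₁ : HasCompactSupport (Complex.ofRealCLM ∘ α) := hc.comp_left rfl
  have hg₂ : ContDiff ℝ ∞ (Complex.ofRealCLM ∘ α) := Complex.ofRealCLM.contDiff.comp hα.contDiff
  set G : 𝓢(ℝ, ℂ) := hg₁.toSchwartzMap hg₂ with hG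
  refine ⟨𝓕 G, fun y => ?_⟩
  have e : (α y : ℂ) = 𝓕⁻ ((𝓕 G : 𝓢(ℝ, ℂ)) : ℝ → ℂ) y := by
    rw [← SchwartzMap.fourierInv_coe, FourierTransform.fourierInv_fourier_eq]
    rfl
  rw [e, Real.fourierInv_eq']
  refine integral_congr_ae (Filter.Eventually.of_forall fun s => ?_)
  simp only [smul_eq_mul, RCLike.inner_apply, conj_trivial]
  rw [mul_comm]
  ring_nf

/-- A strip multiplier is dominated by averages along the normal direction of the strip. -/
theorem IsStripCutoff.exists_enorm_fourier_le {α : ℝ → ℝ} (hα : IsStripCutoff α) :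
    ∃ C : ℝ, 0 < C ∧ ∀ (h : Plane → ℂ), Integrable h → ∀ q : Plane → ℝ≥0∞,
      (∀ x, ‖fourier h x‖ₑ ≤ q x) → ∀ (w : Plane) (u : ℝ) (x : Plane),
      ‖fourier (fun ξ => (α (inner ℝ w ξ - u) : ℂ) * h ξ) x‖ₑ
        ≤ ENNReal.ofReal C * cauchyAvg ((2 * Real.pi) • w) q x := by
  obtain ⟨κ, hκ⟩ := hα.exists_schwartz
  obtain ⟨C, hC, hκC⟩ := SchwartzMap.exists_le_cauchy κ
  refine ⟨C, hC, fun h h1 q hq w u x => ?_⟩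
  -- The shift `u` only multiplies the density by a unimodular factor, so the position of the strip
  -- does not affect the bound.
  set κ' : ℝ → ℂ := fun s => Complex.exp (-((2 * Real.pi * s * u : ℝ) : ℂ) * Complex.I) * κ s
    with hκ'
  have i1 : Integrable κ' := integrable_cexp_mul κ.integrable (by fun_prop)
  have e : (fun ξ => (α (inner ℝ w ξ - u) : ℂ) * h ξ) = fun ξ =>
      (∫ s, κ' s * Complex.exp (((s * inner ℝ ((2 * Real.pi) • w) ξ : ℝ) : ℂ) * Complex.I)) * h ξ := by
    ext ξ
    rw [hκ]
    congr 1
    refine integral_congr_ae (Filter.Eventually.of_forall fun s => ?_)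
    simp only [hκ']
    rw [mul_comm (Complex.exp _), mul_assoc (κ s), ← Complex.exp_add, inner_smul_left, conj_trivial]
    congr 2
    push_cast
    ring
  rw [e, fourier_superposition i1 h1]
  refine (enorm_integral_le_lintegral_enorm _).trans ?_
  rw [cauchyAvg, ← lintegral_const_mul' _ _ ENNReal.ofReal_ne_top]
  refine lintegral_mono fun s => ?_
  rw [enorm_mul, ← mul_assoc, ← ENNReal.ofReal_mul hC.le]
  refine mul_le_mul' ?_ (hq _)
  simp only [hκ']
  rw [enorm_mul, enorm_cexp_mul_I, one_mul, ← ofReal_norm]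
  exact ENNReal.ofReal_le_ofReal (hκC s)

theorem inner_rot_left (θ : ℝ) (η v : Plane) : inner ℝ (rot θ η) v = inner ℝ η (rot (-θ) v) := by
  simp [rot, PiLp.inner_apply, Fin.sum_univ_two]
  ring

/-- The adjoint of the rotation composed with `T` carries the line of vectors `(1, s)` to the affine
family `u₀ + s • u₁`. Strip directions thus stay ordered by slope whatever `T` is, and no bound on
the dilations enters. -/
theorem exists_inner_rot_eq (θ : ℝ) (T : Plane →L[ℝ] Plane) :
    ∃ u₀ u₁ : Plane, ∀ (s : ℝ) (ξ : Plane),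
      inner ℝ (rot θ (T ξ)) (!₂[1, s] : Plane) = inner ℝ (u₀ + s • u₁) ξ := by
  refine ⟨T.adjoint (rot (-θ) !₂[1, 0]), T.adjoint (rot (-θ) !₂[0, 1]), fun s ξ => ?_⟩
  have : (!₂[1, s] : Plane) = !₂[1, 0] + s • !₂[0, 1] := by
    ext i; fin_cases i <;> simp
  rw [this, inner_add_right, inner_smul_right, inner_rot_left, inner_rot_left, inner_add_left,
    inner_smul_left, ContinuousLinearMap.adjoint_inner_left, ContinuousLinearMap.adjoint_inner_left,
    conj_trivial, real_inner_comm (T ξ), real_inner_comm (T ξ)]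

theorem strip_eq {α γ : ℝ → ℝ} {J : ℕ} {b : ℕ → ℝ} {j : ℕ} (hj : j < J) {θ : ℝ}
    {T : Plane →L[ℝ] Plane} {u₀ u₁ : Plane}
    (hu : ∀ (s : ℝ) (ξ : Plane), inner ℝ (rot θ (T ξ)) (!₂[1, s] : Plane) = inner ℝ (u₀ + s • u₁) ξ)
    (ξ : Plane) :
    strip α γ J b j (rot θ (T ξ)) =
      α (inner ℝ (((b (j + 1) - b j)⁻¹ * (Real.sqrt (1 + rightDeriv γ (b j) ^ 2))⁻¹) •
        (u₀ + rightDeriv γ (b j) • u₁)) ξ -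
        (b (j + 1) - b j)⁻¹ * inner ℝ (!₂[b j, γ (b j)] : Plane) (unitTangent γ (b j))) := by
  rw [strip, if_pos hj, inner_sub_left, mul_sub]
  congr 2
  rw [unitTangent, inner_smul_right, hu, inner_smul_left, conj_trivial, mul_assoc]

theorem abs_strip_le {α : ℝ → ℝ} (hα : IsStripCutoff α) (γ : ℝ → ℝ) (J : ℕ) (b : ℕ → ℝ) (j : ℕ)
    (η : Plane) : 0 ≤ strip α γ J b j η ∧ strip α γ J b j η ≤ 1 := by
  unfold strip
  split_ifs
  · exact hα.mem_Icc _
  · simp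

theorem continuous_rot (θ : ℝ) : Continuous (rot θ) := by
  unfold rot
  fun_prop

theorem measurable_strip {α : ℝ → ℝ} (hα : IsStripCutoff α) (γ : ℝ → ℝ) (J : ℕ) (b : ℕ → ℝ)
    (j : ℕ) : Measurable (strip α γ J b j) := by
  unfold strip
  split_ifs
  · exact hα.contDiff.continuous.measurable.comp (by fun_prop)
  · exact measurable_const

theorem integrable_bdd_mul {h : Plane → ℂ} (h1 : Integrable h) {g : Plane → ℝ} (hg : Measurable g)
    {B : ℝ} (hB : ∀ x, |g x| ≤ B) : Integrable fun ξ => (g ξ : ℂ) * h ξ := by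
  refine (h1.norm.const_mul B).mono' ((Complex.measurable_ofReal.comp hg).aestronglyMeasurable.mul
    h1.1) (Filter.Eventually.of_forall fun x => ?_)
  simp only [norm_mul, Complex.norm_real, Real.norm_eq_abs]
  exact mul_le_mul_of_nonneg_right (hB x) (norm_nonneg _)

/-- The product of two consecutive strip cutoffs is dominated by the directional maximal
function. -/
theorem IsStripCutoff.exists_enorm_fourier_strips_le {α : ℝ → ℝ} (hα : IsStripCutoff α) :
    ∃ C : ℝ, 0 < C ∧ ∀ (γ : ℝ → ℝ) (J : ℕ) (b : ℕ → ℝ) (θ : ℝ) (T : Plane →L[ℝ] Plane)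
      (S : Finset ℝ) (a : ℝ) (K : ℕ), 0 < a →
      (∀ j < J, rightDeriv γ (b j) ∈ S) →
      (∀ j < J, a ≤ 2 * Real.pi * ((b (j + 1) - b j)⁻¹ * (Real.sqrt (1 + rightDeriv γ (b j) ^ 2))⁻¹)) →
      (∀ j < J, 2 * Real.pi * ((b (j + 1) - b j)⁻¹ * (Real.sqrt (1 + rightDeriv γ (b j) ^ 2))⁻¹)
        < a * 2 ^ K) →
      ∃ u₀ u₁ : Plane, ∀ (h : Plane → ℂ), Integrable h → ∀ q : Plane → ℝ≥0∞,
      (∀ x, ‖fourier h x‖ₑ ≤ q x) → ∀ j < J, ∀ x,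
      ‖fourier (fun ξ => ((strip α γ J b j (rot θ (T ξ)) *
          (1 - strip α γ J b (j + 1) (rot θ (T ξ))) : ℝ) : ℂ) * h ξ) x‖ₑ
        ≤ ENNReal.ofReal C * (dirMax u₀ u₁ S a K q x
          + dirMax u₀ u₁ S a K (dirMax u₀ u₁ S a K q) x) := by
  obtain ⟨C, hC, hstrip⟩ := hα.exists_enorm_fourier_le
  refine ⟨2 * C + 4 * C ^ 2, by positivity, fun γ J b θ T S a K ha hS h1 h2 => ?_⟩
  obtain ⟨u₀, u₁, hu⟩ := exists_inner_rot_eq θ T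
  refine ⟨u₀, u₁, fun h hh q hq j hj x => ?_⟩
  set D := dirMax u₀ u₁ S a K with hD
  have hTm : Measurable fun ξ => rot θ (T ξ) := (continuous_rot θ).measurable.comp T.continuous.measurable
  have hone : ∀ (h : Plane → ℂ), Integrable h → ∀ q : Plane → ℝ≥0∞,
      (∀ x, ‖fourier h x‖ₑ ≤ q x) → ∀ j < J, ∀ x,
      ‖fourier (fun ξ => (strip α γ J b j (rot θ (T ξ)) : ℂ) * h ξ) x‖ₑ
        ≤ ENNReal.ofReal (2 * C) * D q x := by
    intro h hh q hq j hj x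
    simp_rw [strip_eq hj hu]
    refine (hstrip h hh q hq _ _ x).trans ?_
    rw [smul_smul, mul_comm 2 C, ENNReal.ofReal_mul hC.le, mul_assoc (ENNReal.ofReal C), ENNReal.ofReal_ofNat]
    gcongr
    exact cauchyAvg_le_dirMax ha (hS j hj) (h1 j hj) (h2 j hj) x
  have hb : ∀ j ξ, |strip α γ J b j (rot θ (T ξ))| ≤ 1 := fun j ξ => by
    have := abs_strip_le hα γ J b j (rot θ (T ξ))
    rw [abs_of_nonneg this.1]; exact this.2
  have hm : ∀ j, Measurable fun ξ => strip α γ J b j (rot θ (T ξ)) := fun j =>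
    (measurable_strip hα γ J b j).comp hTm
  have i1 := integrable_bdd_mul hh (hm j) (hb j)
  have i2 := integrable_bdd_mul hh (hm (j + 1)) (hb (j + 1))
  have i3 := integrable_bdd_mul i2 (hm j) (hb j)
  have hsplit : fourier (fun ξ => ((strip α γ J b j (rot θ (T ξ)) *
          (1 - strip α γ J b (j + 1) (rot θ (T ξ))) : ℝ) : ℂ) * h ξ) x
      = fourier (fun ξ => (strip α γ J b j (rot θ (T ξ)) : ℂ) * h ξ) x
      - fourier (fun ξ => (strip α γ J b j (rot θ (T ξ)) : ℂ) *
          ((strip α γ J b (j + 1) (rot θ (T ξ)) : ℂ) * h ξ)) x := by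
    unfold fourier
    rw [← integral_sub (integrable_cexp_mul i1 (by fun_prop)) (integrable_cexp_mul i3 (by fun_prop))]
    refine integral_congr_ae (Filter.Eventually.of_forall fun ξ => ?_)
    push_cast
    ring
  -- The bound for the strip `j + 1` becomes the majorant fed to the strip `j`, which produces the
  -- iterate `D (D q)`. For `j + 1 = J` the strip is zero by definition.
  have hsecond : ‖fourier (fun ξ => (strip α γ J b j (rot θ (T ξ)) : ℂ) *
          ((strip α γ J b (j + 1) (rot θ (T ξ)) : ℂ) * h ξ)) x‖ₑ
      ≤ ENNReal.ofReal (4 * C ^ 2) * D (D q) x := by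
    by_cases hj1 : j + 1 < J
    · have hq' := hone h hh q hq (j + 1) hj1
      have hscale : D (fun x => ENNReal.ofReal (2 * C) * D q x) x ≤
          ENNReal.ofReal (2 * C) * D (D q) x := by
        refine iSup₂_le fun k hk => iSup₂_le fun s hs => ?_
        have : ∀ w, cauchyAvg w (fun x => ENNReal.ofReal (2 * C) * D q x) x
            = ENNReal.ofReal (2 * C) * cauchyAvg w (D q) x := fun w => by
          unfold cauchyAvg
          rw [← lintegral_const_mul' _ _ ENNReal.ofReal_ne_top]
          refine lintegral_congr fun s => by ring
        rw [this]
        gcongr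
        refine le_trans ?_ (le_iSup₂ (f := fun k (_ : k ∈ Finset.range K) => ⨆ s ∈ S,
          cauchyAvg ((a * 2 ^ k) • u₀ + s • (a * 2 ^ k) • u₁) (D q) x) k hk)
        exact le_iSup₂ (f := fun s (_ : s ∈ S) =>
          cauchyAvg ((a * 2 ^ k) • u₀ + s • (a * 2 ^ k) • u₁) (D q) x) s hs
      refine (hone _ i2 _ hq' j hj x).trans ?_
      calc _ ≤ ENNReal.ofReal (2 * C) * (ENNReal.ofReal (2 * C) * D (D q) x) := by gcongr
        _ = _ := by
          rw [← mul_assoc, ← ENNReal.ofReal_mul (by positivity)]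
          ring_nf
    · have : ∀ η, strip α γ J b (j + 1) η = 0 := fun η => by rw [strip, if_neg hj1]
      simp [this, fourier]
  rw [hsplit]
  refine enorm_sub_le.trans ?_
  calc _ ≤ ENNReal.ofReal (2 * C) * D q x + ENNReal.ofReal (4 * C ^ 2) * D (D q) x :=
        add_le_add (hone h hh q hq j hj x) hsecond
    _ ≤ ENNReal.ofReal (2 * C + 4 * C ^ 2) * D q x + ENNReal.ofReal (2 * C + 4 * C ^ 2) * D (D q) x := by
        gcongr
        · nlinarith [sq_nonneg C]
        · nlinarith
    _ = _ := by rw [mul_add]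

/-! ### The rotated boundary graph -/

theorem rot_neg_rot (θ : ℝ) (x : Plane) : rot (-θ) (rot θ x) = x := by
  have := Real.sin_sq_add_cos_sq θ
  ext i
  fin_cases i
  · simp [rot]
    linear_combination (x 0) * this
  · simp [rot]
    linear_combination (x 1) * this

theorem rot_rot_neg (θ : ℝ) (x : Plane) : rot θ (rot (-θ) x) = x := by
  have := rot_neg_rot (-θ) x
  rwa [neg_neg] at this

theorem mem_rot_image {θ : ℝ} {E : Set Plane} {x : Plane} : x ∈ rot θ '' E ↔ rot (-θ) x ∈ E := by
  constructor
  · rintro ⟨y, hy, rfl⟩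
    rwa [rot_neg_rot]
  · exact fun h => ⟨_, h, rot_rot_neg θ x⟩

theorem norm_rot (θ : ℝ) (x : Plane) : ‖rot θ x‖ = ‖x‖ := by
  have : ‖rot θ x‖ ^ 2 = ‖x‖ ^ 2 := by
    rw [← real_inner_self_eq_norm_sq, ← real_inner_self_eq_norm_sq, inner_rot_left, rot_neg_rot]
  exact (sq_eq_sq₀ (norm_nonneg _) (norm_nonneg _)).1 this

theorem rot_combo (θ s t a b y z : ℝ) :
    rot θ (!₂[s * a + t * b, s * y + t * z] : Plane) = s • rot θ !₂[a, y] + t • rot θ !₂[b, z] := by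
  ext i
  fin_cases i <;> simp [rot] <;> ring

theorem norm_pair_sq (a y : ℝ) : ‖(!₂[a, y] : Plane)‖ ^ 2 = a ^ 2 + y ^ 2 := by
  simp [EuclideanSpace.norm_sq_eq, Fin.sum_univ_two]

/-- `γ(a)` is the largest height of a point of the closed rotated domain above `a`. -/
theorem IsConvexDomain.isGreatest_bdry {Ω : Set Plane} {M : ℕ} (hΩ : IsConvexDomain Ω M) (θ : ℝ)
    {a : ℝ} (ha : |a| < 3) :
    IsGreatest {y : ℝ | rot (-θ) !₂[a, y] ∈ closure Ω} (bdry Ω θ a) ∧ 0 < bdry Ω θ a ∧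
      bdry Ω θ a ≤ 2 ^ M := by
  set Y : Set ℝ := {y : ℝ | rot (-θ) !₂[a, y] ∈ closure Ω} with hY
  have hcont : Continuous fun y : ℝ => rot (-θ) (!₂[a, y] : Plane) :=
    (continuous_rot _).comp (by fun_prop)
  have hball := hΩ.isLeast.1.2
  have hbound : ∀ y ∈ Y, y ^ 2 ≤ (2 ^ M) ^ 2 := by
    intro y hy
    have h1 := hball hy
    rw [mem_ball_zero_iff, norm_rot] at h1
    have h2 := norm_pair_sq a y
    have : ‖(!₂[a, y] : Plane)‖ ^ 2 ≤ (2 ^ M) ^ 2 := pow_le_pow_left₀ (norm_nonneg _) h1.le 2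
    nlinarith [sq_nonneg a]
  have hYc : IsCompact Y := by
    refine Metric.isCompact_of_isClosed_isBounded (isClosed_closure.preimage hcont) ?_
    refine (Metric.isBounded_Icc (-(2 : ℝ) ^ M) (2 ^ M)).subset fun y hy => ?_
    exact abs_le.1 (abs_le_of_sq_le_sq (hbound y hy) (by positivity))
  -- Since `a ^ 2 + 1 < 10`, the point at height `1` lies in the disc of radius `8`.
  have h1Y : (1 : ℝ) ∈ Y := by
    refine subset_closure (hΩ.ball_subset ?_)
    rw [mem_closedBall_zero_iff, norm_rot]
    have h2 := norm_pair_sq a 1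
    have h3 := sq_lt_sq' (by linarith [(abs_lt.1 ha).1]) (abs_lt.1 ha).2
    nlinarith [norm_nonneg (!₂[a, 1] : Plane)]
  obtain ⟨y, hy⟩ := hYc.exists_isGreatest ⟨1, h1Y⟩
  have hy1 : 1 ≤ y := hy.2 h1Y
  have hfr : y ∈ {y : ℝ | 0 < y ∧ !₂[a, y] ∈ rot θ '' frontier Ω} := by
    refine ⟨by linarith, mem_rot_image.2 ?_⟩
    rw [hΩ.isOpen.frontier_eq]
    refine ⟨hy.1, fun hin => ?_⟩
    -- An interior top point could be raised slightly, contradicting maximality; the highest point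
    -- is therefore on the frontier.
    have hopen : IsOpen {y : ℝ | rot (-θ) (!₂[a, y] : Plane) ∈ Ω} := hΩ.isOpen.preimage hcont
    obtain ⟨ε, hε, hsub⟩ := Metric.isOpen_iff.1 hopen y hin
    have : y + ε / 2 ∈ Y := by
      refine subset_closure (hsub ?_)
      rw [Metric.mem_ball, Real.dist_eq]
      rw [add_sub_cancel_left, abs_of_pos (by linarith)]
      linarith
    linarith [hy.2 this]
  have hg : IsGreatest {y : ℝ | 0 < y ∧ !₂[a, y] ∈ rot θ '' frontier Ω} y := by
    refine ⟨hfr, fun z hz => hy.2 ?_⟩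
    exact frontier_subset_closure (mem_rot_image.1 hz.2)
  have e : bdry Ω θ a = y := hg.csSup_eq
  rw [e]
  exact ⟨hy, by linarith, (abs_le.1 (abs_le_of_sq_le_sq (hbound y hy.1) (by positivity))).2⟩

/-- A convex combination of two top points lies in the convex set `closure Ω`, hence below the top
point over the same abscissa. -/
theorem IsConvexDomain.concaveOn_bdry {Ω : Set Plane} {M : ℕ} (hΩ : IsConvexDomain Ω M) (θ : ℝ) :
    ConcaveOn ℝ (Metric.ball 0 3) (bdry Ω θ) := by
  refine ⟨convex_ball _ _, fun a ha b hb s t hs ht hst => ?_⟩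
  have hab := (convex_ball (0 : ℝ) 3) ha hb hs ht hst
  rw [mem_ball_zero_iff, Real.norm_eq_abs] at ha hb hab
  refine (hΩ.isGreatest_bdry θ hab).1.2 ?_
  have h1 := (hΩ.isGreatest_bdry θ ha).1.1
  have h2 := (hΩ.isGreatest_bdry θ hb).1.1
  have := hΩ.convex.closure h1 h2 hs ht hst
  simp only [smul_eq_mul, mem_ofPred_eq]
  rwa [rot_combo]

/-- A concave function with values in `(0, 2 ^ M]` has slope at most `2 * 2 ^ M` at distance `1`
from the ends of its interval. All slope bounds thus depend on `M` alone. -/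
theorem IsConvexDomain.lipschitzOnWith_bdry {Ω : Set Plane} {M : ℕ} (hΩ : IsConvexDomain Ω M)
    (θ : ℝ) : LipschitzOnWith (2 ^ (M + 1)) (bdry Ω θ) (Metric.ball 0 2) := by
  have := (hΩ.concaveOn_bdry θ).lipschitzOnWith_of_abs_le (ε := 1) one_pos (M := 2 ^ M)
    fun a ha => by
      rw [Real.dist_eq, sub_zero] at ha
      obtain ⟨-, h1, h2⟩ := hΩ.isGreatest_bdry θ ha
      rwa [abs_of_pos h1]
  have e : (2 * 2 ^ M / 1 : ℝ).toNNReal = 2 ^ (M + 1) := by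
    rw [div_one, ← pow_succ', Real.toNNReal_pow (by norm_num), Real.toNNReal_ofNat]
  rw [e] at this
  norm_num at this
  exact this

/-- Difference quotients are bounded by the Lipschitz constant. Where the derivative fails to exist
or to be unique, the default value `0` satisfies the bound as well. -/
theorem abs_derivWithin_le_of_lipschitzOnWith {f : ℝ → ℝ} {U s : Set ℝ} {C : NNReal}
    (hf : LipschitzOnWith C f U) {x : ℝ} (hU : U ∈ nhds x) : |derivWithin f s x| ≤ C := by
  by_cases hd : DifferentiableWithinAt ℝ f s x
  · by_cases hne : (nhdsWithin x (s \ {x})).NeBot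
    · have ht := (hasDerivWithinAt_iff_tendsto_slope.1 hd.hasDerivWithinAt).abs
      refine le_of_tendsto ht ?_
      filter_upwards [nhdsWithin_le_nhds hU, self_mem_nhdsWithin] with y hy hys
      rw [slope_def_field, abs_div, div_le_iff₀ (abs_pos.2 (sub_ne_zero.2 hys.2))]
      have := hf.dist_le_mul y hy x (mem_of_mem_nhds hU)
      rwa [Real.dist_eq, Real.dist_eq] at this
    · have : derivWithin f s x = 0 := by
        rw [derivWithin_zero_of_not_accPt]
        rwa [accPt_principal_iff_nhdsWithin]
      rw [this]; simp
  · rw [derivWithin_zero_of_not_differentiableWithinAt hd]; simp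

/-! ### Lengths of the division intervals -/

/-- Slopes bounded by `S` force `bend γ a t ≤ 2 S (t - a)`, so the bend cannot exceed `δ` before `t
- a` reaches `δ / (2 S)`. On a last piece the step is at least `2 ^ (-M) δ`, which `hS` makes no
smaller. -/
theorem le_nextBreak_sub {γ : ℝ → ℝ} {M : ℕ} {δ S a : ℝ} (hδ : 0 < δ) (hS : 2 ^ M ≤ 2 * S)
    (hl : ∀ t ∈ Icc (-1 : ℝ) 1, |leftDeriv γ t| ≤ S) (hr : ∀ t ∈ Icc (-1 : ℝ) 1, |rightDeriv γ t| ≤ S)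
    (ha : a ∈ Icc (-1 : ℝ) 1) :
    δ / (2 * S) ≤ nextBreak γ M δ a - a ∧ nextBreak γ M δ a ≤ 1 + δ ∧
      (¬ IsLastPiece γ δ a → nextBreak γ M δ a ≤ 1) := by
  have hM : (0 : ℝ) < 2 ^ M := by positivity
  have hM1 : (1 : ℝ) ≤ 2 ^ M := one_le_pow₀ (by norm_num)
  have hc : δ / (2 * S) ≤ ((2 : ℝ) ^ M)⁻¹ * δ := by
    rw [div_eq_inv_mul]
    gcongr
  have hc1 : ((2 : ℝ) ^ M)⁻¹ * δ ≤ δ := by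
    have : ((2 : ℝ) ^ M)⁻¹ ≤ 1 := inv_le_one_of_one_le₀ hM1
    nlinarith
  unfold nextBreak
  split_ifs with h1 h2
  · exact ⟨by linarith, by linarith, fun h => absurd h1 h⟩
  · exact ⟨by linarith, by linarith [ha.2], fun h => absurd h1 h⟩
  · have hne : {t : ℝ | t ∈ Ioc a 1 ∧ δ < bend γ a t}.Nonempty := by
      simp only [IsLastPiece, not_forall, not_le] at h1
      obtain ⟨t, ht, h⟩ := h1
      exact ⟨t, ht, h⟩
    have hlow : a + δ / (2 * S) ≤ sInf {t : ℝ | t ∈ Ioc a 1 ∧ δ < bend γ a t} := by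
      refine le_csInf hne fun t ht => ?_
      obtain ⟨⟨hat, ht1⟩, hb⟩ := ht
      unfold bend at hb
      have b1 := hl t ⟨by linarith [ha.1], ht1⟩
      have b2 := hr a ha
      have b3 : |leftDeriv γ t - rightDeriv γ a| ≤ 2 * S := (abs_sub _ _).trans (by linarith)
      have b4 : δ ≤ (t - a) * (2 * S) := hb.le.trans (by gcongr)
      have : δ / (2 * S) ≤ t - a := by
        rw [div_le_iff₀ (by linarith)]
        exact b4
      linarith
    have hup : sInf {t : ℝ | t ∈ Ioc a 1 ∧ δ < bend γ a t} ≤ 1 := by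
      obtain ⟨t, ht⟩ := hne
      refine (csInf_le ⟨a, fun s hs => hs.1.1.le⟩ ht).trans ht.1.2
    exact ⟨by linarith, by linarith, fun _ => hup⟩

/-- The division points up to the last one lie in `[-1, 1]`. -/
theorem breakPt_mem {γ : ℝ → ℝ} {M : ℕ} {δ S : ℝ} (hδ : 0 < δ) (hS : 2 ^ M ≤ 2 * S)
    (hl : ∀ t ∈ Icc (-1 : ℝ) 1, |leftDeriv γ t| ≤ S) (hr : ∀ t ∈ Icc (-1 : ℝ) 1, |rightDeriv γ t| ≤ S)
    (l : ℕ) (h : l < lastBreak γ M δ) : breakPt γ M δ l ∈ Icc (-1 : ℝ) 1 := by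
  induction l with
  | zero => simp [breakPt]
  | succ l ih =>
    have h1 := ih (by omega)
    have h2 := le_nextBreak_sub (M := M) hδ hS hl hr h1
    have e : breakPt γ M δ (l + 1) = nextBreak γ M δ (breakPt γ M δ l) := by
      simp only [breakPt, Function.iterate_succ_apply']
    have hnot : ¬ IsLastPiece γ δ (breakPt γ M δ l) := by
      refine Nat.notMem_of_lt_sInf (s := {l : ℕ | IsLastPiece γ δ (breakPt γ M δ l)}) ?_
      unfold lastBreak at h
      omega
    rw [e]
    have hM : (0 : ℝ) < 2 ^ M := by positivity
    have : 0 ≤ δ / (2 * S) := div_nonneg hδ.le (by linarith)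
    exact ⟨by linarith [h1.1, h2.1], h2.2.2 hnot⟩

theorem breakPt_succ_bounds {γ : ℝ → ℝ} {M : ℕ} {δ S : ℝ} (hδ : 0 < δ) (hS : 2 ^ M ≤ 2 * S)
    (hl : ∀ t ∈ Icc (-1 : ℝ) 1, |leftDeriv γ t| ≤ S) (hr : ∀ t ∈ Icc (-1 : ℝ) 1, |rightDeriv γ t| ≤ S)
    (l : ℕ) (h : l < lastBreak γ M δ) :
    δ / (2 * S) ≤ breakPt γ M δ (l + 1) - breakPt γ M δ l ∧ breakPt γ M δ (l + 1) ≤ 1 + δ := by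
  have h2 := le_nextBreak_sub (M := M) hδ hS hl hr (breakPt_mem hδ hS hl hr l h)
  have e : breakPt γ M δ (l + 1) = nextBreak γ M δ (breakPt γ M δ l) := by
    simp only [breakPt, Function.iterate_succ_apply']
  rw [e]
  exact ⟨h2.1, h2.2.1⟩

/-- In a sequence of positive numbers whose neighbouring terms differ by at most the factor `2`, a
sum of at most `n` consecutive terms is at most `4 ^ n` times each of them. -/
theorem sum_Ico_le_four_pow {d : ℕ → ℝ} {p q n : ℕ} (hpos : ∀ i ∈ Finset.Ico p q, 0 < d i)
    (hcmp : ∀ i, p ≤ i → i + 1 < q → d i / 2 ≤ d (i + 1) ∧ d (i + 1) ≤ 2 * d i)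
    (hn : q - p ≤ n) {j : ℕ} (hj : j ∈ Finset.Ico p q) :
    ∑ i ∈ Finset.Ico p q, d i ≤ 4 ^ n * d j := by
  have up : ∀ k i, p ≤ i → i + k < q → d (i + k) ≤ 2 ^ k * d i ∧ d i ≤ 2 ^ k * d (i + k) := by
    intro k
    induction k with
    | zero => intro i _ _; simp
    | succ k ih =>
      intro i hi hk
      have h1 := ih i hi (by omega)
      have h2 := hcmp (i + k) (by omega) (by omega)
      have h3 : (0 : ℝ) < 2 ^ k := by positivity
      rw [← add_assoc, pow_succ]
      exact ⟨by nlinarith [h1.1, h2.2], by nlinarith [h1.2, h2.1]⟩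
  rw [Finset.mem_Ico] at hj
  have hdj := hpos j (Finset.mem_Ico.2 hj)
  have each : ∀ i ∈ Finset.Ico p q, d i ≤ 2 ^ n * d j := by
    intro i hi
    rw [Finset.mem_Ico] at hi
    rcases le_total i j with h | h
    · obtain ⟨k, rfl⟩ := Nat.exists_eq_add_of_le h
      refine (up k i hi.1 hj.2).2.trans ?_
      gcongr
      · norm_num
      · omega
    · obtain ⟨k, rfl⟩ := Nat.exists_eq_add_of_le h
      refine (up k j hj.1 hi.2).1.trans ?_
      gcongr
      · norm_num
      · omega
  calc ∑ i ∈ Finset.Ico p q, d i ≤ ∑ _i ∈ Finset.Ico p q, 2 ^ n * d j := Finset.sum_le_sum each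
    _ = ((q - p : ℕ) : ℝ) * (2 ^ n * d j) := by simp
    -- The number of terms is at most `n ≤ 2 ^ n`.
    _ ≤ 2 ^ n * (2 ^ n * d j) := by
        gcongr
        exact_mod_cast hn.trans Nat.lt_two_pow_self.le
    _ = 4 ^ n * d j := by rw [← mul_assoc, ← mul_pow]; norm_num

/-- The interval `I_j` lies in some `[a_l, a_{l+1}]`, of length at least `δ / (2 S)`, which is cut
into at most `L log (1/δ)` intervals with neighbouring lengths comparable. The factor `4 ^ ⌊L log
(1/δ)⌋` is only a power of `1/δ`. -/
theorem IsRefinement.length_bounds {γ : ℝ → ℝ} {M : ℕ} {δ S L : ℝ} {J : ℕ} {b : ℕ → ℝ}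
    (hb : IsRefinement γ M δ L J b) (hδ : 0 < δ) (hS : 2 ^ M ≤ 2 * S)
    (hl : ∀ t ∈ Icc (-1 : ℝ) 1, |leftDeriv γ t| ≤ S) (hr : ∀ t ∈ Icc (-1 : ℝ) 1, |rightDeriv γ t| ≤ S)
    {j : ℕ} (hj : j < J) :
    0 < b (j + 1) - b j ∧ δ / (2 * S) ≤ 4 ^ ⌊L * Real.log δ⁻¹⌋₊ * (b (j + 1) - b j) ∧
      -1 ≤ b j ∧ b (j + 1) ≤ 1 + δ := by
  set Q := lastBreak γ M δ with hQ
  have hQ1 : 1 ≤ Q := by rw [hQ, lastBreak]; omega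
  have mono := hb.strictMono
  have hmem : ∀ i, i ≤ J → i ∈ Iic J := fun i hi => hi
  have hpos : ∀ i < J, 0 < b (i + 1) - b i := fun i hi =>
    sub_pos.2 (mono (hmem _ (by omega)) (hmem _ (by omega)) (by omega))
  have hfirst : b 0 = -1 := by rw [hb.first]; simp [breakPt]
  have hlow : -1 ≤ b j := by
    rw [← hfirst]
    exact (mono.le_iff_le (hmem _ (by omega)) (hmem _ (by omega))).2 (by omega)
  have hup : b (j + 1) ≤ 1 + δ := by
    have h1 : b (j + 1) ≤ b J := (mono.le_iff_le (hmem _ (by omega)) (hmem _ le_rfl)).2 (by omega)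
    rw [hb.last] at h1
    have h2 := (breakPt_succ_bounds hδ hS hl hr (Q - 1) (by omega)).2
    rw [Nat.sub_add_cancel hQ1] at h2
    exact h1.trans h2
  refine ⟨hpos j hj, ?_, hlow, hup⟩
  classical
  -- The last division point not to the right of `b j`. It precedes `a_Q = b J`, so `a_{l+1}` is
  -- available.
  set l := Nat.findGreatest (fun l => breakPt γ M δ l ≤ b j) Q with hldef
  have hlQ : l ≤ Q := Nat.findGreatest_le _
  have hl0 : breakPt γ M δ l ≤ b j := by
    refine Nat.findGreatest_spec (P := fun l => breakPt γ M δ l ≤ b j) (m := 0) (Nat.zero_le _) ?_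
    simpa [breakPt] using hlow
  have hlt : l < Q := by
    refine lt_of_le_of_ne hlQ fun h => ?_
    rw [h, ← hb.last] at hl0
    exact absurd ((mono.le_iff_le (hmem _ le_rfl) (hmem _ (by omega))).1 hl0) (by omega)
  have hl1 : b j < breakPt γ M δ (l + 1) :=
    not_le.1 (Nat.findGreatest_is_greatest (P := fun l => breakPt γ M δ l ≤ b j) (n := Q)
      (k := l + 1) (by omega) (by omega))
  obtain ⟨p, hpJ, hp⟩ := hb.refines l hlQ
  obtain ⟨q, hqJ, hq⟩ := hb.refines (l + 1) hlt
  have hpj : p ≤ j := (mono.le_iff_le (hmem _ hpJ) (hmem _ (by omega))).1 (by rw [hp]; exact hl0)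
  have hjq : j < q := (mono.lt_iff_lt (hmem _ (by omega)) (hmem _ hqJ)).1 (by rw [hq]; exact hl1)
  have hcard := hb.card_le l hlt
  have hsub : (Finset.Ico p q : Set ℕ) ⊆
      {j : ℕ | j < J ∧ breakPt γ M δ l ≤ b j ∧ b (j + 1) ≤ breakPt γ M δ (l + 1)} := by
    intro i hi
    rw [Finset.coe_Ico, mem_Ico] at hi
    refine ⟨by omega, ?_, ?_⟩
    · rw [← hp]
      exact (mono.le_iff_le (hmem _ hpJ) (hmem _ (by omega))).2 hi.1
    · rw [← hq]
      exact (mono.le_iff_le (hmem _ (by omega)) (hmem _ hqJ)).2 hi.2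
  have hfin : {j : ℕ | j < J ∧ breakPt γ M δ l ≤ b j ∧ b (j + 1) ≤ breakPt γ M δ (l + 1)}.Finite :=
    (Set.finite_lt_nat J).subset fun i hi => hi.1
  have hn : q - p ≤ ⌊L * Real.log δ⁻¹⌋₊ := by
    have h1 := Set.ncard_le_ncard hsub hfin
    rw [Set.ncard_coe_finset, Nat.card_Ico] at h1
    refine Nat.le_floor (le_trans ?_ hcard)
    exact_mod_cast h1
  have hsum := sum_Ico_le_four_pow (d := fun i => b (i + 1) - b i) (p := p) (q := q)
    (fun i hi => hpos i (by have := (Finset.mem_Ico.1 hi).2; omega))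
    (fun i hi1 hi2 => hb.comparable i (by omega)) hn (Finset.mem_Ico.2 ⟨hpj, hjq⟩)
  rw [Finset.sum_Ico_sub _ (by omega : p ≤ q)] at hsum
  have hgap := (breakPt_succ_bounds hδ hS hl hr l hlt).1
  rw [← hp, ← hq] at hgap
  exact hgap.trans hsum

theorem IsRefinement.card_mul_le {γ : ℝ → ℝ} {M : ℕ} {δ L : ℝ} {J : ℕ} {b : ℕ → ℝ}
    (hb : IsRefinement γ M δ L J b) {c B : ℝ} (hc : ∀ j < J, c ≤ b (j + 1) - b j)
    (hB : ∀ j < J, b (j + 1) ≤ B) : J * c ≤ max 0 (B + 1) := by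
  rcases Nat.eq_zero_or_pos J with rfl | hJ
  · simp
  have h1 : ∑ j ∈ Finset.range J, (b (j + 1) - b j) = b J - b 0 := Finset.sum_range_sub b J
  have h2 : J * c ≤ ∑ j ∈ Finset.range J, (b (j + 1) - b j) := by
    have := Finset.card_nsmul_le_sum (Finset.range J) (fun j => b (j + 1) - b j) c
      fun j hj => hc j (Finset.mem_range.1 hj)
    simpa using this
  have h3 : b 0 = -1 := by rw [hb.first]; simp [breakPt]
  have h4 := hB (J - 1) (by omega)
  rw [Nat.sub_add_cancel hJ] at h4
  refine le_trans ?_ (le_max_right _ _)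
  linarith

/-! ### Dilations and the norm function -/

theorem dil_mul (A : Matrix (Fin 2) (Fin 2) ℝ) {s t : ℝ} (hs : 0 < s) (ht : 0 < t) (ξ : Plane) :
    dil A (s * t) ξ = dil A s (dil A t ξ) := by
  let _ : NormedAlgebra ℚ (Plane →L[ℝ] Plane) := NormedAlgebra.restrictScalars ℚ ℝ _
  have e : Real.log (s * t) • act A = Real.log s • act A + Real.log t • act A := by
    rw [Real.log_mul hs.ne' ht.ne']
    exact add_smul (Real.log s) (Real.log t) (act A)
  have hc : Commute (Real.log s • act A) (Real.log t • act A) := by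
    refine ContinuousLinearMap.ext fun x => ?_
    change Real.log s • act A (Real.log t • act A x) = Real.log t • act A (Real.log s • act A x)
    rw [map_smul, map_smul, smul_comm]
  unfold dil
  rw [e, NormedSpace.exp_add_of_commute hc]
  rfl

theorem dil_one (A : Matrix (Fin 2) (Fin 2) ℝ) (ξ : Plane) : dil A 1 ξ = ξ := by
  have e : Real.log 1 • act A = 0 := by
    rw [Real.log_one]
    exact zero_smul ℝ (act A)
  rw [dil, e, NormedSpace.exp_zero]
  rfl

theorem dil_inv_dil (A : Matrix (Fin 2) (Fin 2) ℝ) {t : ℝ} (ht : 0 < t) (ξ : Plane) :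
    dil A t⁻¹ (dil A t ξ) = ξ := by
  rw [← dil_mul A (inv_pos.2 ht) ht, inv_mul_cancel₀ ht.ne', dil_one]

theorem dil_dil_inv (A : Matrix (Fin 2) (Fin 2) ℝ) {t : ℝ} (ht : 0 < t) (ξ : Plane) :
    dil A t (dil A t⁻¹ ξ) = ξ := by
  rw [← dil_mul A ht (inv_pos.2 ht), mul_inv_cancel₀ ht.ne', dil_one]

theorem dil_eq_zero_iff (A : Matrix (Fin 2) (Fin 2) ℝ) {t : ℝ} (ht : 0 < t) {ξ : Plane} :
    dil A t ξ = 0 ↔ ξ = 0 := by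
  constructor
  · intro h
    rw [← dil_inv_dil A ht ξ, h, map_zero]
  · rintro rfl
    simp

theorem continuousOn_dil (A : Matrix (Fin 2) (Fin 2) ℝ) :
    ContinuousOn (fun z : ℝ × Plane => dil A z.1 z.2) (Ioi 0 ×ˢ univ) := by
  let _ : NormedAlgebra ℚ (Plane →L[ℝ] Plane) := NormedAlgebra.restrictScalars ℚ ℝ _
  have h1 : ContinuousOn (fun z : ℝ × Plane => dil A z.1) (Ioi 0 ×ˢ univ) := by
    unfold dil
    refine NormedSpace.exp_continuous.comp_continuousOn ?_
    refine ContinuousOn.smul (ContinuousOn.log continuousOn_fst fun z hz => ?_) continuousOn_const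
    exact (show 0 < z.1 from hz.1).ne'
  exact h1.clm_apply continuousOn_snd

theorem IsConvexDomain.isCompact_frontier {Ω : Set Plane} {M : ℕ} (hΩ : IsConvexDomain Ω M) :
    IsCompact (frontier Ω) :=
  Metric.isCompact_of_isClosed_isBounded isClosed_frontier
    (Metric.isBounded_ball.subset (frontier_subset_closure.trans hΩ.isLeast.1.2))

theorem IsConvexDomain.zero_notMem_frontier {Ω : Set Plane} {M : ℕ} (hΩ : IsConvexDomain Ω M) :
    (0 : Plane) ∉ frontier Ω := by
  rw [hΩ.isOpen.frontier_eq]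
  exact fun h => h.2 (hΩ.ball_subset (by simp))

section Norm

variable {Ω : Set Plane} {M : ℕ} {A : Matrix (Fin 2) (Fin 2) ℝ}

theorem IsCompatible.rho_eq (hA : IsCompatible Ω A) {ξ : Plane} (hξ : ξ ≠ 0) {t : ℝ} (ht : 0 < t)
    (h : dil A t⁻¹ ξ ∈ frontier Ω) : rho Ω A ξ = t := by
  rw [rho, if_neg hξ]
  have : {t : ℝ | 0 < t ∧ dil A t⁻¹ ξ ∈ frontier Ω} = {t} := by
    ext s
    constructor
    · rintro ⟨hs, hs'⟩
      have := (hA.meets_once ξ hξ).unique ⟨inv_pos.2 hs, hs'⟩ ⟨inv_pos.2 ht, h⟩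
      exact inv_injective this
    · rintro rfl
      exact ⟨ht, h⟩
  rw [this, csInf_singleton]

theorem IsCompatible.rho_spec (hA : IsCompatible Ω A) {ξ : Plane} (hξ : ξ ≠ 0) :
    0 < rho Ω A ξ ∧ dil A (rho Ω A ξ)⁻¹ ξ ∈ frontier Ω := by
  obtain ⟨t, ⟨ht, h⟩, -⟩ := hA.meets_once ξ hξ
  have h' : dil A (t⁻¹)⁻¹ ξ ∈ frontier Ω := by rwa [inv_inv]
  rw [hA.rho_eq hξ (inv_pos.2 ht) h']
  exact ⟨inv_pos.2 ht, h'⟩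

theorem rho_zero : rho Ω A 0 = 0 := by simp [rho]

theorem IsCompatible.rho_nonneg (hA : IsCompatible Ω A) (ξ : Plane) : 0 ≤ rho Ω A ξ := by
  by_cases h : ξ = 0
  · rw [h, rho_zero]
  · exact (hA.rho_spec h).1.le

theorem IsCompatible.rho_dil (hA : IsCompatible Ω A) {s : ℝ} (hs : 0 < s) (ξ : Plane) :
    rho Ω A (dil A s ξ) = s * rho Ω A ξ := by
  by_cases h : ξ = 0
  · rw [h, map_zero, rho_zero, mul_zero]
  have h1 := hA.rho_spec h
  refine hA.rho_eq ((dil_eq_zero_iff A hs).not.2 h) (mul_pos hs h1.1) ?_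
  rw [mul_inv, mul_comm, dil_mul A (inv_pos.2 h1.1) (inv_pos.2 hs), dil_inv_dil A hs]
  exact h1.2

/-- The shell is the continuous image of `[a, b] × ∂Ω` under `(t, η) ↦ t ^ A η`. Compactness
supplies both the integrability of the multipliers and the measurability of `ρ`. -/
theorem IsCompatible.isCompact_shell (hΩ : IsConvexDomain Ω M) (hA : IsCompatible Ω A) {a b : ℝ}
    (ha : 0 < a) : IsCompact {ξ | rho Ω A ξ ∈ Icc a b} := by
  have e : {ξ | rho Ω A ξ ∈ Icc a b} =
      (fun z : ℝ × Plane => dil A z.1 z.2) '' (Icc a b ×ˢ frontier Ω) := by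
    ext ξ
    constructor
    · intro h
      have hξ : ξ ≠ 0 := by
        rintro rfl
        have := h.1
        rw [rho_zero] at this
        linarith
      have h1 := hA.rho_spec hξ
      exact ⟨(rho Ω A ξ, dil A (rho Ω A ξ)⁻¹ ξ), ⟨h, h1.2⟩, dil_dil_inv A h1.1 ξ⟩
    · rintro ⟨⟨t, η⟩, ⟨ht, hη⟩, rfl⟩
      have ht0 : 0 < t := lt_of_lt_of_le ha ht.1
      have hη0 : η ≠ 0 := fun h => hΩ.zero_notMem_frontier (h ▸ hη)
      have : rho Ω A (dil A t η) = t :=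
        hA.rho_eq ((dil_eq_zero_iff A ht0).not.2 hη0) ht0 (by rwa [dil_inv_dil A ht0])
      simp only [mem_ofPred_eq, this]
      exact ht
  rw [e]
  refine (isCompact_Icc.prod hΩ.isCompact_frontier).image_of_continuousOn
    ((continuousOn_dil A).mono ?_)
  exact prod_mono (fun t ht => lt_of_lt_of_le ha ht.1) (subset_univ _)

/-- A sublevel set is the origin together with countably many compact shells; continuity of `ρ` is
not needed. -/
theorem IsCompatible.measurable_rho (hΩ : IsConvexDomain Ω M) (hA : IsCompatible Ω A) :
    Measurable (rho Ω A) := by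
  refine measurable_of_Iic fun c => ?_
  rcases lt_or_ge c 0 with hc | hc
  · have : rho Ω A ⁻¹' Iic c = ∅ := by
      ext ξ
      simp only [mem_preimage, mem_Iic, mem_empty_iff_false, iff_false, not_le]
      exact hc.trans_le (hA.rho_nonneg ξ)
    rw [this]
    exact MeasurableSet.empty
  · have : rho Ω A ⁻¹' Iic c = {0} ∪ ⋃ n : ℕ, {ξ | rho Ω A ξ ∈ Icc (1 / ((n : ℝ) + 1)) c} := by
      ext ξ
      simp only [mem_preimage, mem_Iic, mem_union, mem_singleton_iff, mem_iUnion, mem_ofPred_eq,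
        mem_Icc]
      constructor
      · intro h
        by_cases hξ : ξ = 0
        · exact Or.inl hξ
        · obtain ⟨n, hn⟩ := exists_nat_one_div_lt (hA.rho_spec hξ).1
          exact Or.inr ⟨n, hn.le, h⟩
      · rintro (rfl | ⟨n, -, h⟩)
        · rwa [rho_zero]
        · exact h
    rw [this]
    refine (measurableSet_singleton _).union (MeasurableSet.iUnion fun n => ?_)
    exact (hA.isCompact_shell hΩ (by positivity)).measurableSet

end Norm

theorem integrable_of_bounded_of_compact {g : Plane → ℂ} (hg : Measurable g) {B : ℝ}
    (hB : ∀ ξ, ‖g ξ‖ ≤ B) {Z : Set Plane} (hZ : IsCompact Z) (hs : ∀ ξ, g ξ ≠ 0 → ξ ∈ Z) :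
    Integrable g := by
  have : IntegrableOn g Z := by
    refine Measure.integrableOn_of_bounded (M := B) hZ.measure_lt_top.ne hg.aestronglyMeasurable ?_
    exact Filter.Eventually.of_forall hB
  exact (integrableOn_iff_integrable_of_support_subset fun ξ hξ => hs ξ hξ).1 this

/-! ### Maximal functions over a one-parameter family of multipliers -/

/-- The integral over the parameter of the absolute value of a family of multiplier operators. -/
def paramAvg (G : ℝ → Plane → ℝ) (h : Plane → ℂ) (a b : ℝ) (x : Plane) : ℝ≥0∞ :=
  ∫⁻ v in Icc a b, ‖fourier (fun ξ => (G v ξ : ℂ) * h ξ) x‖ₑ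

section Param

variable {G : ℝ → Plane → ℝ} {h : Plane → ℂ} {a b C : ℝ}

theorem measurable_fourier_param (hG : Measurable (Function.uncurry G)) (hh : Measurable h) :
    Measurable fun z : Plane × ℝ => fourier (fun ξ => (G z.2 ξ : ℂ) * h ξ) z.1 := by
  unfold fourier
  refine StronglyMeasurable.measurable ?_
  refine StronglyMeasurable.integral_prod_right' (f := fun p : (Plane × ℝ) × Plane =>
    Complex.exp (-((inner ℝ p.1.1 p.2 : ℝ) : ℂ) * Complex.I) * ((G p.1.2 p.2 : ℂ) * h p.2)) ?_
  have : Measurable fun p : (Plane × ℝ) × Plane => G p.1.2 p.2 :=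
    hG.comp (measurable_fst.snd.prodMk measurable_snd)
  exact Measurable.stronglyMeasurable (by fun_prop)

theorem measurable_paramAvg (hG : Measurable (Function.uncurry G)) (hh : Measurable h) :
    Measurable (paramAvg G h a b) :=
  Measurable.lintegral_prod_right' (f := fun z : Plane × ℝ =>
    ‖fourier (fun ξ => (G z.2 ξ : ℂ) * h ξ) z.1‖ₑ) (measurable_fourier_param hG hh).enorm

theorem norm_mul_le_of_bound (hC : ∀ v ∈ Icc a b, ∀ ξ, h ξ ≠ 0 → |G v ξ| ≤ C) {v : ℝ}
    (hv : v ∈ Icc a b) (ξ : Plane) : ‖(G v ξ : ℂ) * h ξ‖ ≤ C * ‖h ξ‖ := by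
  by_cases h0 : h ξ = 0
  · simp [h0]
  · rw [norm_mul, Complex.norm_real, Real.norm_eq_abs]
    gcongr
    exact hC v hv ξ h0

theorem integrable_param (hG : Measurable (Function.uncurry G)) (h1 : Integrable h)
    (hC : ∀ v ∈ Icc a b, ∀ ξ, h ξ ≠ 0 → |G v ξ| ≤ C) {v : ℝ} (hv : v ∈ Icc a b) :
    Integrable fun ξ => (G v ξ : ℂ) * h ξ := by
  have : Measurable (G v) := hG.comp (measurable_const.prodMk measurable_id)
  refine (h1.norm.const_mul C).mono' ((Complex.measurable_ofReal.comp this).aestronglyMeasurable.mul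
    h1.1) (Filter.Eventually.of_forall fun ξ => norm_mul_le_of_bound hC hv ξ)

theorem enorm_fourier_le {g : Plane → ℂ} (x : Plane) : ‖fourier g x‖ₑ ≤ ∫⁻ ξ, ‖g ξ‖ₑ := by
  refine (enorm_integral_le_lintegral_enorm _).trans (lintegral_mono fun ξ => ?_)
  rw [enorm_mul, enorm_cexp_mul_I, one_mul]

/-- Only the finiteness of `B` matters: the directional maximal theorem is stated for functions with
finite values. -/
theorem paramAvg_le (hC : ∀ v ∈ Icc a b, ∀ ξ, h ξ ≠ 0 → |G v ξ| ≤ C) (h1 : Integrable h)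
    (hC0 : 0 ≤ C) :
    ∃ B : ℝ≥0∞, B ≠ ⊤ ∧ ∀ x, paramAvg G h a b x ≤ B := by
  refine ⟨ENNReal.ofReal (b - a) * (ENNReal.ofReal C * ∫⁻ ξ, ‖h ξ‖ₑ), ENNReal.mul_ne_top
    ENNReal.ofReal_ne_top (ENNReal.mul_ne_top ENNReal.ofReal_ne_top h1.2.ne), fun x => ?_⟩
  calc paramAvg G h a b x ≤ ∫⁻ v in Icc a b, (ENNReal.ofReal C * ∫⁻ ξ, ‖h ξ‖ₑ) := by
        refine setLIntegral_mono measurable_const fun v hv => ?_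
        refine (enorm_fourier_le x).trans ?_
        rw [← lintegral_const_mul' _ _ ENNReal.ofReal_ne_top]
        refine lintegral_mono fun ξ => ?_
        rw [← ofReal_norm, ← ofReal_norm, ← ENNReal.ofReal_mul hC0]
        exact ENNReal.ofReal_le_ofReal (norm_mul_le_of_bound hC hv ξ)
    _ = _ := by rw [setLIntegral_const, Real.volume_Icc, mul_comm]

/-- Cauchy–Schwarz in `v`, then Plancherel for each `v`. Only a sup bound on the multipliers `G v`
enters, and only where `h` does not vanish. -/
theorem lintegral_paramAvg_sq_le (hG : Measurable (Function.uncurry G)) (hh : Measurable h)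
    (h1 : Integrable h) (h2 : MemLp h 2 volume)
    (hC : ∀ v ∈ Icc a b, ∀ ξ, h ξ ≠ 0 → |G v ξ| ≤ C) (hC0 : 0 ≤ C) (hab : a ≤ b) :
    ∫⁻ x, paramAvg G h a b x ^ 2
      ≤ ENNReal.ofReal ((b - a) ^ 2 * C ^ 2 * (2 * Real.pi) ^ 2) * ∫⁻ ξ, ‖h ξ‖ₑ ^ 2 := by
  have hjoint := measurable_fourier_param hG hh
  have hsec : ∀ x, Measurable fun v => ‖fourier (fun ξ => (G v ξ : ℂ) * h ξ) x‖ₑ := fun x =>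
    (hjoint.comp (measurable_const.prodMk measurable_id)).enorm
  calc ∫⁻ x, paramAvg G h a b x ^ 2
      ≤ ∫⁻ x, ENNReal.ofReal (b - a) *
          ∫⁻ v in Icc a b, ‖fourier (fun ξ => (G v ξ : ℂ) * h ξ) x‖ₑ ^ 2 := by
        refine lintegral_mono fun x => ?_
        have := sq_lintegral_mul_le (μ := volume.restrict (Icc a b)) (k := fun _ : ℝ => 1)
          measurable_const (hsec x)
        simpa [paramAvg, Real.volume_Icc] using this
    _ = ENNReal.ofReal (b - a) *
          ∫⁻ v in Icc a b, ∫⁻ x, ‖fourier (fun ξ => (G v ξ : ℂ) * h ξ) x‖ₑ ^ 2 := by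
        rw [lintegral_const_mul' _ _ ENNReal.ofReal_ne_top, lintegral_lintegral_swap]
        exact (hjoint.enorm.pow_const 2).aemeasurable
    _ ≤ ENNReal.ofReal (b - a) * ∫⁻ v in Icc a b,
          (ENNReal.ofReal ((2 * Real.pi) ^ 2) * (ENNReal.ofReal (C ^ 2) * ∫⁻ ξ, ‖h ξ‖ₑ ^ 2)) := by
        refine mul_le_mul' le_rfl ?_
        refine setLIntegral_mono measurable_const fun v hv => ?_
        have m1 := integrable_param hG h1 hC hv
        have m2 : MemLp (fun ξ => (G v ξ : ℂ) * h ξ) 2 volume :=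
          h2.of_le_mul m1.1 (Filter.Eventually.of_forall (norm_mul_le_of_bound hC hv))
        rw [lintegral_enorm_fourierPlane_sq m1 m2]
        gcongr
        rw [← lintegral_const_mul' _ _ ENNReal.ofReal_ne_top]
        refine lintegral_mono fun ξ => ?_
        rw [ENNReal.ofReal_pow hC0, ← mul_pow]
        gcongr
        rw [← ofReal_norm, ← ofReal_norm, ← ENNReal.ofReal_mul hC0]
        exact ENNReal.ofReal_le_ofReal (norm_mul_le_of_bound hC hv ξ)
    _ = _ := by
        rw [setLIntegral_const, Real.volume_Icc, ENNReal.ofReal_mul (by positivity),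
          ENNReal.ofReal_mul (by positivity), ENNReal.ofReal_pow (sub_nonneg.2 hab)]
        ring

/-- By Fubini the operator of an integrated multiplier is the integral of the operators. Taking
absolute values and enlarging the range to `[a, b]` removes the dependence on `v`. -/
theorem enorm_fourier_integral_le (hG : Measurable (Function.uncurry G)) (hh : Measurable h)
    (h1 : Integrable h) (hC : ∀ v ∈ Icc a b, ∀ ξ, h ξ ≠ 0 → |G v ξ| ≤ C) {v : ℝ}
    (hv : v ∈ Icc a b) (x : Plane) :
    ‖fourier (fun ξ => ((∫ t in Icc a v, G t ξ : ℝ) : ℂ) * h ξ) x‖ₑ ≤ paramAvg G h a b x := by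
  have hsub : Icc a v ⊆ Icc a b := Icc_subset_Icc_right hv.2
  have e : fourier (fun ξ => ((∫ t in Icc a v, G t ξ : ℝ) : ℂ) * h ξ) x
      = ∫ t in Icc a v, fourier (fun ξ => (G t ξ : ℂ) * h ξ) x := by
    unfold fourier
    rw [integral_integral_swap]
    · refine integral_congr_ae (Filter.Eventually.of_forall fun ξ => ?_)
      dsimp only
      rw [integral_const_mul, integral_mul_const, integral_complex_ofReal]
    · have hm : Measurable fun z : ℝ × Plane => (G z.1 z.2 : ℂ) * h z.2 := by
        have : Measurable fun z : ℝ × Plane => G z.1 z.2 := hG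
        fun_prop
      have hi : Integrable (fun z : ℝ × Plane => (G z.1 z.2 : ℂ) * h z.2)
          ((volume.restrict (Icc a v)).prod volume) := by
        have hbd : Integrable (fun z : ℝ × Plane => C * ‖h z.2‖)
            ((volume.restrict (Icc a v)).prod volume) := by
          have := (integrable_const (μ := volume.restrict (Icc a v)) C).mul_prod h1.norm
          exact this
        refine hbd.mono' hm.aestronglyMeasurable ?_
        have hr : (volume.restrict (Icc a v)).prod (volume : Measure Plane)
            = (volume.prod volume).restrict (Icc a v ×ˢ univ) := by
          rw [← Measure.prod_restrict, Measure.restrict_univ]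
        rw [hr, ae_restrict_iff' (measurableSet_Icc.prod MeasurableSet.univ)]
        exact Filter.Eventually.of_forall fun z hz => norm_mul_le_of_bound hC (hsub hz.1) z.2
      exact integrable_cexp_mul hi (u := fun z : ℝ × Plane => inner ℝ x z.2) (by fun_prop)
  rw [e]
  exact (enorm_integral_le_lintegral_enorm _).trans (lintegral_mono_set hsub)

end Param

/-! ### The number of directions and of scales -/

/-- A bound for the number of dyadic scales and for the logarithm of the number of directions. -/
def scaleCount (M : ℕ) (L δ : ℝ) : ℕ :=
  2 * M + 7 + 2 * ⌊L * Real.log δ⁻¹⌋₊ + ⌈2 * Real.log δ⁻¹⌉₊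

theorem inv_le_two_pow {δ : ℝ} (hδ : 0 < δ) (hδ1 : δ ≤ 1) : δ⁻¹ ≤ 2 ^ ⌈2 * Real.log δ⁻¹⌉₊ := by
  have hy : 0 ≤ Real.log δ⁻¹ := Real.log_nonneg ((one_le_inv₀ hδ).2 hδ1)
  rw [← Real.log_le_log_iff (inv_pos.2 hδ) (by positivity), Real.log_pow]
  have h1 := Nat.le_ceil (2 * Real.log δ⁻¹)
  have h2 := Real.log_two_gt_d9
  nlinarith

/-- Interval lengths lie between a power of `δ` and `3`, and the normalising root between `1` and `1
+ 2 ^ (M + 1)`. The left end of the range of lengths is the value for the extreme case `3 * (1 + 2 ^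
(M + 1))`. -/
theorem IsConvexDomain.scale_bounds {Ω : Set Plane} {M : ℕ} (hΩ : IsConvexDomain Ω M) {θ δ L : ℝ}
    {J : ℕ} {b : ℕ → ℝ} (hδ : 0 < δ) (hδ1 : δ ≤ 1 / 100)
    (hb : IsRefinement (bdry Ω θ) M δ L J b) :
    J ≤ 2 ^ scaleCount M L δ ∧ ∀ j < J,
      2 * Real.pi / (3 * (1 + 2 ^ (M + 1))) ≤ 2 * Real.pi *
        ((b (j + 1) - b j)⁻¹ * (Real.sqrt (1 + rightDeriv (bdry Ω θ) (b j) ^ 2))⁻¹) ∧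
      2 * Real.pi * ((b (j + 1) - b j)⁻¹ * (Real.sqrt (1 + rightDeriv (bdry Ω θ) (b j) ^ 2))⁻¹) <
        2 * Real.pi / (3 * (1 + 2 ^ (M + 1))) * 2 ^ scaleCount M L δ := by
  set γ := bdry Ω θ with hγ
  set S : ℝ := 2 ^ (M + 1) with hS
  set n := ⌊L * Real.log δ⁻¹⌋₊ with hn
  set e := ⌈2 * Real.log δ⁻¹⌉₊ with he
  have hK : scaleCount M L δ = 2 * M + 7 + 2 * n + e := rfl
  have h2M : (1 : ℝ) ≤ 2 ^ M := one_le_pow₀ (by norm_num)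
  have hSM : S = 2 * 2 ^ M := by rw [hS, pow_succ]; ring
  have hSpos : 0 < S := by positivity
  have hball : ∀ t ∈ Ioo (-2 : ℝ) 2, Metric.ball (0 : ℝ) 2 ∈ nhds t := fun t ht =>
    Metric.isOpen_ball.mem_nhds (by
      rw [mem_ball_zero_iff, Real.norm_eq_abs]; exact abs_lt.2 ht)
  have hslope : ∀ (s : Set ℝ), ∀ t ∈ Ioo (-2 : ℝ) 2, |derivWithin γ s t| ≤ S := by
    intro s t ht
    have := abs_derivWithin_le_of_lipschitzOnWith (s := s) (hΩ.lipschitzOnWith_bdry θ) (hball t ht)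
    simpa [hS] using this
  have hIcc : ∀ t ∈ Icc (-1 : ℝ) 1, t ∈ Ioo (-2 : ℝ) 2 := fun t ht =>
    ⟨by linarith [ht.1], by linarith [ht.2]⟩
  have hlen := fun j (hj : j < J) => hb.length_bounds (S := S) hδ (by rw [hSM]; linarith)
    (fun t ht => hslope _ t (hIcc t ht)) (fun t ht => hslope _ t (hIcc t ht)) hj
  have hδe : δ⁻¹ ≤ 2 ^ e := inv_le_two_pow hδ (by linarith)
  have hδe' : 1 ≤ 2 ^ e * δ := by
    rw [inv_le_iff_one_le_mul₀ hδ] at hδe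
    linarith
  have h4 : (4 : ℝ) ^ n = 2 ^ (2 * n) := by rw [pow_mul]; norm_num
  -- In the exponent, `M + 2` pays for `2 S`, `2 n` for `4 ^ n`, and `e` for `1/δ`.
  have hmin : ∀ j < J, 1 ≤ (2 ^ (M + 2 + 2 * n + e)) * (b (j + 1) - b j) := by
    intro j hj
    obtain ⟨h0, h1, -, -⟩ := hlen j hj
    rw [div_le_iff₀ (by positivity), ← hn, h4] at h1
    have : (2 : ℝ) ^ (M + 2 + 2 * n + e) = 2 ^ e * (2 ^ (2 * n) * (2 * S)) := by
      rw [hS]; ring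
    rw [this]
    have h2e : (0 : ℝ) < 2 ^ e := by positivity
    calc (1 : ℝ) ≤ 2 ^ e * δ := hδe'
      _ ≤ 2 ^ e * (2 ^ (2 * n) * (b (j + 1) - b j) * (2 * S)) := by gcongr
      _ = _ := by ring
  refine ⟨?_, fun j hj => ?_⟩
  · have hc := hb.card_mul_le (c := (2 ^ (M + 2 + 2 * n + e))⁻¹) (B := 1 + δ)
      (fun j hj => by
        have := hmin j hj
        rw [inv_le_iff_one_le_mul₀' (by positivity)]
        exact this) (fun j hj => (hlen j hj).2.2.2)
    have h3 : max (0 : ℝ) (1 + δ + 1) ≤ 4 := max_le (by norm_num) (by linarith)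
    have h5 : (J : ℝ) ≤ 4 * 2 ^ (M + 2 + 2 * n + e) := by
      rw [← div_eq_mul_inv, div_le_iff₀ (by positivity)] at hc
      exact hc.trans (by gcongr)
    have h6 : (J : ℝ) ≤ 2 ^ scaleCount M L δ := by
      refine h5.trans ?_
      rw [hK, show (4 : ℝ) = 2 ^ 2 by norm_num, ← pow_add]
      exact pow_le_pow_right₀ (by norm_num) (by omega)
    exact_mod_cast h6
  · obtain ⟨h0, -, hbl, hbu⟩ := hlen j hj
    have hd := hslope (Ioi (b j)) (b j) ⟨by linarith, by linarith⟩
    change |rightDeriv γ (b j)| ≤ S at hd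
    set s := rightDeriv γ (b j)
    set l := b (j + 1) - b j with hl
    have hs2 : s ^ 2 ≤ S ^ 2 := sq_le_sq' (by linarith [(abs_le.1 hd).1]) (abs_le.1 hd).2
    have hr1 : 1 ≤ Real.sqrt (1 + s ^ 2) := Real.one_le_sqrt.2 (by nlinarith)
    have hr2 : Real.sqrt (1 + s ^ 2) ≤ 1 + S := by
      rw [Real.sqrt_le_left (by linarith)]
      nlinarith
    have hl3 : l ≤ 3 := by linarith
    have hm := hmin j hj
    rw [← mul_inv]
    have hpos : 0 < l * Real.sqrt (1 + s ^ 2) := by positivity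
    constructor
    · rw [div_eq_mul_inv]
      gcongr
    · rw [div_eq_mul_inv, mul_assoc (2 * Real.pi)]
      refine mul_lt_mul_of_pos_left ?_ Real.two_pi_pos
      calc (l * Real.sqrt (1 + s ^ 2))⁻¹ ≤ l⁻¹ := by
            refine inv_anti₀ h0 ?_
            nlinarith
        _ ≤ 2 ^ (M + 2 + 2 * n + e) := by
            rw [inv_le_iff_one_le_mul₀ h0]
            exact hm
        _ < (3 * (1 + S))⁻¹ * 2 ^ scaleCount M L δ := by
            rw [inv_mul_eq_div, lt_div_iff₀ (by positivity), hK]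
            -- The spare factor `32 * 2 ^ M` exceeds `3 * (1 + 2 * 2 ^ M)`.
            have e1 : (2 : ℝ) ^ (2 * M + 7 + 2 * n + e) = 2 ^ (M + 2 + 2 * n + e) * (2 ^ M * 32) := by
              ring
            rw [e1]
            refine mul_lt_mul_of_pos_left ?_ (by positivity)
            rw [hSM]
            linarith

/-! ### Separation of the time parameter -/

/-- The derivative of `Φ((ρ / t - 1) / δ)` with respect to the parameter `v` of `t = X (1 + δ v)`. -/
def timeDeriv (Φ : 𝓢(ℝ, ℝ)) (δ X : ℝ) (ρ : Plane → ℝ) (v : ℝ) (ξ : Plane) : ℝ :=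
  deriv Φ ((ρ ξ / (X * (1 + δ * v)) - 1) / δ) * -(ρ ξ / (X * (1 + δ * v) ^ 2))

theorem measurable_timeDeriv (Φ : 𝓢(ℝ, ℝ)) (δ X : ℝ) {ρ : Plane → ℝ} (hρ : Measurable ρ) :
    Measurable (Function.uncurry (timeDeriv Φ δ X ρ)) := by
  have h1 : Measurable (deriv Φ) := measurable_deriv _
  have h2 : Measurable fun z : ℝ × Plane => ρ z.2 := hρ.comp measurable_snd
  unfold timeDeriv Function.uncurry
  exact (h1.comp (by fun_prop)).mul (by fun_prop)

theorem SchwartzMap.exists_abs_deriv_le (Φ : 𝓢(ℝ, ℝ)) : ∃ C : ℝ, 0 < C ∧ ∀ u, |deriv Φ u| ≤ C := by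
  refine ⟨‖(SchwartzMap.derivCLM ℝ ℝ Φ).toBoundedContinuousFunction‖ + 1, by positivity, fun u => ?_⟩
  have := (SchwartzMap.derivCLM ℝ ℝ Φ).toBoundedContinuousFunction.norm_coe_le_norm u
  simp only [SchwartzMap.toBoundedContinuousFunction_apply, SchwartzMap.derivCLM_apply,
    Real.norm_eq_abs] at this
  linarith

section Time

variable {Φ : 𝓢(ℝ, ℝ)} {δ X r : ℝ}

/-- The factor `1/δ` from inside `Φ` cancels the `δ` in `dt/dv`, so the bound is uniform in `δ`.
What is left is at most `1.1 / 0.88 ^ 2 < 2` times the bound for the derivative of `Φ`. -/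
theorem abs_timeDeriv_le {C : ℝ} (hC : ∀ u, |deriv Φ u| ≤ C) (hδ : 0 < δ) (hδ1 : δ ≤ 1 / 100)
    (hX : 0 < X) {ρ : Plane → ℝ} {ξ : Plane} (h : ρ ξ ∈ Icc (X * (1 - 10 * δ)) (X * (1 + 10 * δ)))
    {v : ℝ} (hv : v ∈ Icc (-12 : ℝ) 13) : |timeDeriv Φ δ X ρ v ξ| ≤ 2 * C := by
  have hC0 : 0 ≤ C := (abs_nonneg _).trans (hC 0)
  have h1 : 88 / 100 ≤ 1 + δ * v := by nlinarith [hv.1]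
  have hρ0 : 0 ≤ ρ ξ := le_trans (by nlinarith) h.1
  unfold timeDeriv
  have hq : 0 ≤ ρ ξ / (X * (1 + δ * v) ^ 2) := by positivity
  rw [abs_mul, abs_neg, abs_of_nonneg hq, mul_comm 2 C]
  refine mul_le_mul (hC _) ?_ (by positivity) hC0
  rw [div_le_iff₀ (by positivity)]
  have h2 : (88 / 100 : ℝ) ^ 2 ≤ (1 + δ * v) ^ 2 := pow_le_pow_left₀ (by norm_num) h1 2
  nlinarith [h.2]

theorem eq_zero_of_support (hΦ : Function.support Φ ⊆ Icc (-1) 1) {u : ℝ} (hu : u ∉ Icc (-1 : ℝ) 1) :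
    Φ u = 0 := by
  by_contra h
  exact hu (hΦ h)

/-- Nonvanishing requires `(1 - δ) t ≤ r ≤ (1 + δ) t`. This clashes with `r = X (1 + O(10 δ))` since
`(1 + δ)(1 - 12 δ) < 1 - 10 δ` and `(1 - δ)(1 + 13 δ) > 1 + 10 δ` for `δ ≤ 1/100`. -/
theorem eq_zero_of_time_notMem (hΦ : Function.support Φ ⊆ Icc (-1) 1) (hδ : 0 < δ)
    (hδ1 : δ ≤ 1 / 100) (hX : 0 < X) (h : r ∈ Icc (X * (1 - 10 * δ)) (X * (1 + 10 * δ))) {v : ℝ}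
    (hpos : 0 < 1 + δ * v) (hv : v ≤ -12 ∨ 13 ≤ v) :
    Φ ((r / (X * (1 + δ * v)) - 1) / δ) = 0 := by
  have hp : 0 < X * (1 + δ * v) := by positivity
  refine eq_zero_of_support hΦ fun hu => ?_
  rw [mem_Icc, le_div_iff₀ hδ, div_le_iff₀ hδ] at hu
  obtain ⟨h1, h2⟩ := hu
  have h3 : (1 - δ) * (X * (1 + δ * v)) ≤ r := by
    rw [← le_div_iff₀ hp]; linarith
  have h4 : r ≤ (1 + δ) * (X * (1 + δ * v)) := by
    rw [← div_le_iff₀ hp]; linarith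
  rcases hv with hv | hv
  · have h5 : X * (1 - 10 * δ) ≤ X * ((1 + δ) * (1 - 12 * δ)) := by
      refine h.1.trans (h4.trans ?_)
      have : 1 + δ * v ≤ 1 - 12 * δ := by nlinarith
      calc (1 + δ) * (X * (1 + δ * v)) = X * ((1 + δ) * (1 + δ * v)) := by ring
        _ ≤ _ := by gcongr
    have := le_of_mul_le_mul_left h5 hX
    nlinarith
  · have h5 : X * ((1 - δ) * (1 + 13 * δ)) ≤ X * (1 + 10 * δ) := by
      refine le_trans ?_ (h3.trans h.2)
      have h6 : 1 + 13 * δ ≤ 1 + δ * v := by nlinarith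
      have h7 : 0 ≤ 1 - δ := by linarith
      calc X * ((1 - δ) * (1 + 13 * δ)) ≤ X * ((1 - δ) * (1 + δ * v)) := by gcongr
        _ = _ := by ring
    have := le_of_mul_le_mul_left h5 hX
    nlinarith

theorem eq_integral_timeDeriv (hΦ : Function.support Φ ⊆ Icc (-1) 1) (hδ : 0 < δ)
    (hδ1 : δ ≤ 1 / 100) (hX : 0 < X) {ρ : Plane → ℝ} {ξ : Plane}
    (h : ρ ξ ∈ Icc (X * (1 - 10 * δ)) (X * (1 + 10 * δ))) {v : ℝ} (hv : v ∈ Icc (-12 : ℝ) 13) :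
    Φ ((ρ ξ / (X * (1 + δ * v)) - 1) / δ) = ∫ t in Icc (-12) v, timeDeriv Φ δ X ρ t ξ := by
  have hpos : ∀ t : ℝ, -12 ≤ t → 0 < 1 + δ * t := fun t ht => by nlinarith
  have hd : ∀ t ∈ uIcc (-12) v,
      HasDerivAt (fun t => Φ ((ρ ξ / (X * (1 + δ * t)) - 1) / δ)) (timeDeriv Φ δ X ρ t ξ) t := by
    intro t ht
    rw [uIcc_of_le hv.1] at ht
    have hp := hpos t ht.1
    have h1 : HasDerivAt (fun t => X * (1 + δ * t)) (X * δ) t := by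
      have := (((hasDerivAt_id t).const_mul δ).const_add 1).const_mul X
      simpa using this
    have h2 := (((h1.inv (by positivity)).const_mul (ρ ξ)).sub_const 1).div_const δ
    have h3 : HasDerivAt Φ (deriv Φ ((ρ ξ / (X * (1 + δ * t)) - 1) / δ))
        ((ρ ξ / (X * (1 + δ * t)) - 1) / δ) := Φ.differentiableAt.hasDerivAt
    have h4 := h3.comp t (h := fun t => (ρ ξ / (X * (1 + δ * t)) - 1) / δ) (h' := _) (by
      simpa only [div_eq_mul_inv, Pi.inv_apply] using h2)
    refine h4.congr_deriv ?_
    unfold timeDeriv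
    congr 1
    field_simp
  have hc : ContinuousOn (fun t => timeDeriv Φ δ X ρ t ξ) (uIcc (-12) v) := by
    rw [uIcc_of_le hv.1]
    have hdc : Continuous (deriv Φ) := by
      have := (SchwartzMap.derivCLM ℝ ℝ Φ).continuous
      exact this
    unfold timeDeriv
    refine ContinuousOn.mul (hdc.comp_continuousOn ?_) ?_
    · refine ContinuousOn.div_const (ContinuousOn.sub (ContinuousOn.div continuousOn_const
        (by fun_prop) fun t ht => ?_) continuousOn_const) _
      have := hpos t ht.1
      positivity
    · refine ContinuousOn.neg (ContinuousOn.div continuousOn_const (by fun_prop) fun t ht => ?_)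
      have := hpos t ht.1
      positivity
  have := intervalIntegral.integral_eq_sub_of_hasDerivAt hd hc.intervalIntegrable
  rw [eq_zero_of_time_notMem hΦ hδ hδ1 hX h (hpos _ le_rfl) (Or.inl le_rfl), sub_zero,
    intervalIntegral.integral_of_le hv.1] at this
  rw [← this, integral_Icc_eq_integral_Ioc]

end Time

/-! ### One piece of the decomposition -/

/-- The right side is free of `t`, so the supremum over `t` costs no more than one integral in `v`.
Parameters outside `[-12, 13]` give the zero multiplier; the others are primitives of `timeDeriv`
starting from `0`. -/
theorem enorm_fourier_time_le {Φ : 𝓢(ℝ, ℝ)} (hΦ : Function.support Φ ⊆ Icc (-1) 1) {C δ X : ℝ}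
    (hC : ∀ u, |deriv Φ u| ≤ C) (hδ : 0 < δ) (hδ1 : δ ≤ 1 / 100) (hX : 0 < X) {ρ : Plane → ℝ}
    (hρ : Measurable ρ) {h : Plane → ℂ} (hh : Measurable h) (h1 : Integrable h)
    (hsupp : ∀ ξ, h ξ ≠ 0 → ρ ξ ∈ Icc (X * (1 - 10 * δ)) (X * (1 + 10 * δ))) {t : ℝ} (ht : 0 < t)
    (x : Plane) :
    ‖fourier (fun ξ => (Φ ((ρ ξ / t - 1) / δ) : ℂ) * h ξ) x‖ₑ
      ≤ paramAvg (timeDeriv Φ δ X ρ) h (-12) 13 x := by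
  set v := (t / X - 1) / δ with hv
  have htv : X * (1 + δ * v) = t := by rw [hv]; field_simp; ring
  have hpos : 0 < 1 + δ * v := by
    rw [← htv] at ht
    exact pos_of_mul_pos_right ht hX.le
  have hcast : ∀ g : Plane → ℝ, (∀ ξ, h ξ ≠ 0 → Φ ((ρ ξ / t - 1) / δ) = g ξ) →
      (fun ξ => (Φ ((ρ ξ / t - 1) / δ) : ℂ) * h ξ) = fun ξ => (g ξ : ℂ) * h ξ := by
    intro g hg
    funext ξ
    by_cases h0 : h ξ = 0
    · simp [h0]
    · rw [hg ξ h0]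
  by_cases hmem : v ∈ Icc (-12 : ℝ) 13
  · rw [hcast (fun ξ => ∫ s in Icc (-12) v, timeDeriv Φ δ X ρ s ξ) fun ξ h0 => by
      rw [← htv]; exact eq_integral_timeDeriv hΦ hδ hδ1 hX (hsupp ξ h0) hmem]
    exact enorm_fourier_integral_le (measurable_timeDeriv Φ δ X hρ) hh h1
      (fun v hv ξ h0 => abs_timeDeriv_le hC hδ hδ1 hX (hsupp ξ h0) hv) hmem x
  · rw [hcast (fun _ => 0) fun ξ h0 => by
      rw [← htv]
      refine eq_zero_of_time_notMem hΦ hδ hδ1 hX (hsupp ξ h0) hpos ?_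
      by_contra! hcon
      exact hmem ⟨hcon.1.le, hcon.2.le⟩]
    simp [fourier]

/-- One application of `D` costs `K (K + 1) ^ 2` up to a constant in the squared norm, so two cost
at most `(K + 1) ^ 6`. The bound `B` supplies the finiteness needed for each application. -/
theorem lintegral_two_dirMax_sq_le (u₀ u₁ : Plane) (S : Finset ℝ) (a : ℝ) (K : ℕ) {C : ℝ}
    (hC : 0 ≤ C) {q : Plane → ℝ≥0∞} (hq : Measurable q) {B : ℝ≥0∞} (hB : B ≠ ⊤)
    (hqB : ∀ x, q x ≤ B) (hS : S.card ≤ 2 ^ K) :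
    ∫⁻ x, (ENNReal.ofReal C * (dirMax u₀ u₁ S a K q x
        + dirMax u₀ u₁ S a K (dirMax u₀ u₁ S a K q) x)) ^ 2
      ≤ ENNReal.ofReal (2 * C ^ 2 * (40 * Real.pi ^ 2 + (40 * Real.pi ^ 2) ^ 2) * (K + 1) ^ 6)
        * ∫⁻ x, q x ^ 2 := by
  set D := dirMax u₀ u₁ S a K with hD
  set κ : ℝ := K * (40 * Real.pi ^ 2 * (K + 1) ^ 2) with hκ
  have hκ0 : 0 ≤ κ := by positivity
  have hDm : Measurable (D q) := measurable_dirMax _ _ _ _ _ hq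
  have hDDm : Measurable (D (D q)) := measurable_dirMax _ _ _ _ _ hDm
  have hD1 := lintegral_dirMax_sq_le u₀ u₁ S a K hq (fun x => ((hqB x).trans_lt hB.lt_top).ne) hS
  have hD2 := lintegral_dirMax_sq_le u₀ u₁ S a K hDm (fun x =>
    ((dirMax_le_of_le hqB x).trans_lt (ENNReal.mul_lt_top ENNReal.ofReal_lt_top hB.lt_top)).ne) hS
  rw [← hD, ← hκ] at hD1 hD2
  have hκ' : κ ≤ 40 * Real.pi ^ 2 * (K + 1) ^ 3 := by
    have : (K : ℝ) ≤ K + 1 := by linarith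
    calc κ ≤ (K + 1) * (40 * Real.pi ^ 2 * (K + 1) ^ 2) := by rw [hκ]; gcongr
      _ = _ := by ring
  have hle : 2 * C ^ 2 * (κ + κ ^ 2)
      ≤ 2 * C ^ 2 * (40 * Real.pi ^ 2 + (40 * Real.pi ^ 2) ^ 2) * (K + 1) ^ 6 := by
    have h1 : κ ^ 2 ≤ (40 * Real.pi ^ 2 * (K + 1) ^ 3) ^ 2 := by gcongr
    have h2 : ((K : ℝ) + 1) ^ 3 ≤ (K + 1) ^ 6 :=
      pow_le_pow_right₀ (by linarith [(Nat.cast_nonneg K : (0 : ℝ) ≤ K)]) (by norm_num)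
    have h3 : κ ≤ 40 * Real.pi ^ 2 * (K + 1) ^ 6 := hκ'.trans (by gcongr)
    calc 2 * C ^ 2 * (κ + κ ^ 2) ≤ 2 * C ^ 2 * (40 * Real.pi ^ 2 * (K + 1) ^ 6 +
          (40 * Real.pi ^ 2 * (K + 1) ^ 3) ^ 2) := by gcongr
      _ = _ := by ring
  calc ∫⁻ x, (ENNReal.ofReal C * (D q x + D (D q) x)) ^ 2
      ≤ ∫⁻ x, ENNReal.ofReal (C ^ 2) * (2 * D q x ^ 2 + 2 * D (D q) x ^ 2) := by
        refine lintegral_mono fun x => ?_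
        rw [mul_pow, ENNReal.ofReal_pow hC]
        exact mul_le_mul' le_rfl (sq_add_le_two_mul _ _)
    _ = ENNReal.ofReal (C ^ 2) * (2 * ∫⁻ x, D q x ^ 2) +
        ENNReal.ofReal (C ^ 2) * (2 * ∫⁻ x, D (D q) x ^ 2) := by
        rw [lintegral_const_mul _ (by fun_prop), lintegral_add_left (by fun_prop),
          lintegral_const_mul _ (by fun_prop), lintegral_const_mul _ (by fun_prop), mul_add]
    _ ≤ ENNReal.ofReal (C ^ 2) * (2 * (ENNReal.ofReal κ * ∫⁻ x, q x ^ 2)) +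
        ENNReal.ofReal (C ^ 2) * (2 * (ENNReal.ofReal κ *
          (ENNReal.ofReal κ * ∫⁻ x, q x ^ 2))) := by
        gcongr
        exact hD2.trans (mul_le_mul' le_rfl hD1)
    _ = ENNReal.ofReal (2 * C ^ 2 * (κ + κ ^ 2)) * ∫⁻ x, q x ^ 2 := by
        rw [ENNReal.ofReal_mul (p := 2 * C ^ 2) (by positivity),
          ENNReal.ofReal_mul (p := 2) (by norm_num),
          ENNReal.ofReal_add hκ0 (by positivity), ENNReal.ofReal_pow hκ0, ENNReal.ofReal_ofNat]
        ring
    _ ≤ _ := by gcongr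

/-- The estimate for one triple `(i, m, n)`. Time is removed first, giving a majorant `q` common to
all `t`; the strips then act on functions dominated by `q`. One function `g` thus serves all `t` and
`j`, with a constant independent of `Ω`, `A` and `T`. -/
theorem exists_maximal_bound {Φ : 𝓢(ℝ, ℝ)} (hΦ : Function.support Φ ⊆ Icc (-1) 1) {α : ℝ → ℝ}
    (hα : IsStripCutoff α) :
    ∃ C : ℝ, 0 < C ∧ ∀ {Ω : Set Plane} {M : ℕ} {A : Matrix (Fin 2) (Fin 2) ℝ} {θ δ L X : ℝ} {J : ℕ}
      {b : ℕ → ℝ} {T : Plane →L[ℝ] Plane} {h : Plane → ℂ}, IsConvexDomain Ω M → IsCompatible Ω A →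
      0 < δ → δ ≤ 1 / 100 → 0 < X → IsRefinement (bdry Ω θ) M δ L J b → Measurable h →
      Integrable h → MemLp h 2 volume →
      (∀ ξ, h ξ ≠ 0 → rho Ω A ξ ∈ Icc (X * (1 - 10 * δ)) (X * (1 + 10 * δ))) →
      ∃ g : Plane → ℝ≥0∞, Measurable g ∧
        ∫⁻ x, g x ^ 2 ≤ ENNReal.ofReal (C * (scaleCount M L δ + 1) ^ 6) * ∫⁻ ξ, ‖h ξ‖ₑ ^ 2 ∧
        ∀ t : ℝ, 0 < t → ∀ j < J, ∀ x,
          ‖fourier (fun ξ => ((strip α (bdry Ω θ) J b j (rot θ (T ξ)) *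
            (1 - strip α (bdry Ω θ) J b (j + 1) (rot θ (T ξ))) : ℝ) : ℂ) *
              ((Φ ((rho Ω A ξ / t - 1) / δ) : ℂ) * h ξ)) x‖ₑ ≤ g x := by
  obtain ⟨C₁, hC₁, hΦ'⟩ := SchwartzMap.exists_abs_deriv_le Φ
  obtain ⟨C, hC, hstrips⟩ := hα.exists_enorm_fourier_strips_le
  refine ⟨2 * C ^ 2 * (40 * Real.pi ^ 2 + (40 * Real.pi ^ 2) ^ 2) *
    ((13 - (-12)) ^ 2 * (2 * C₁) ^ 2 * (2 * Real.pi) ^ 2), by positivity, ?_⟩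
  intro Ω M A θ δ L X J b T h hΩ hA hδ hδ1 hX hb hh h1 h2 hsupp
  set K := scaleCount M L δ with hK
  obtain ⟨hJ, hscale⟩ := hΩ.scale_bounds hδ hδ1 hb
  set a : ℝ := 2 * Real.pi / (3 * (1 + 2 ^ (M + 1))) with ha
  -- The directions, one slope for each interval. The same `K` bounds the number of dyadic lengths
  -- and the logarithm of the number of slopes.
  set S : Finset ℝ := (Finset.range J).image fun j => rightDeriv (bdry Ω θ) (b j) with hS
  have hScard : S.card ≤ 2 ^ K := Finset.card_image_le.trans (by simpa using hJ)
  obtain ⟨u₀, u₁, hu⟩ := hstrips (bdry Ω θ) J b θ T S a K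
    (by positivity) (fun j hj => Finset.mem_image_of_mem _ (Finset.mem_range.2 hj))
    (fun j hj => (hscale j hj).1) (fun j hj => (hscale j hj).2)
  have hρ := hA.measurable_rho hΩ
  set G := timeDeriv Φ δ X (rho Ω A) with hG
  have hGm : Measurable (Function.uncurry G) := measurable_timeDeriv Φ δ X hρ
  have hGC : ∀ v ∈ Icc (-12 : ℝ) 13, ∀ ξ, h ξ ≠ 0 → |G v ξ| ≤ 2 * C₁ := fun v hv ξ h0 =>
    abs_timeDeriv_le hΦ' hδ hδ1 hX (hsupp ξ h0) hv
  set q := paramAvg G h (-12) 13 with hq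
  have hqm : Measurable q := measurable_paramAvg hGm hh
  obtain ⟨B, hB, hqB⟩ := paramAvg_le hGC h1 (by positivity)
  have hqL := lintegral_paramAvg_sq_le hGm hh h1 h2 hGC (by positivity) (by norm_num)
  refine ⟨fun x => ENNReal.ofReal C * (dirMax u₀ u₁ S a K q x
    + dirMax u₀ u₁ S a K (dirMax u₀ u₁ S a K q) x), ?_, ?_, fun t ht j hj x => ?_⟩
  · exact ((measurable_dirMax _ _ _ _ _ hqm).add (measurable_dirMax _ _ _ _ _
      (measurable_dirMax _ _ _ _ _ hqm))).const_mul _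
  · refine (lintegral_two_dirMax_sq_le u₀ u₁ S a K hC.le hqm hB hqB hScard).trans ?_
    refine (mul_le_mul' le_rfl hqL).trans ?_
    rw [← mul_assoc, ← ENNReal.ofReal_mul (by positivity)]
    refine le_of_eq ?_
    congr 2
    ring
  · refine hu _ ?_ q (fun x => enorm_fourier_time_le hΦ hΦ' hδ hδ1 hX hρ hh h1 hsupp ht x) j hj x
    have hB : ∀ u, |Φ u| ≤ ‖Φ.toBoundedContinuousFunction‖ :=
      Φ.toBoundedContinuousFunction.norm_coe_le_norm
    exact integrable_bdd_mul h1 (Φ.continuous.measurable.comp (by fun_prop)) fun ξ => hB _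

/-! ### Kernels given by bounded multipliers of compact support -/

theorem conv_conv_fourier {a b f : Plane → ℂ} (a1 : Integrable a) (a2 : MemLp a 2 volume)
    (b1 : Integrable b) (b2 : MemLp b 2 volume) (f1 : Integrable f) (x : Plane) :
    conv (conv (fourier a) (fourier b)) f x
      = fourier (fun ξ => a ξ * b ξ * ((2 * Real.pi) ^ 2 * fourier f (-ξ))) x := by
  have h1 : conv (fourier a) (fourier b) = fourier fun ξ => (2 * Real.pi) ^ 2 * (a ξ * b ξ) := by
    funext y
    rw [conv_fourier_fourier a1 a2 b1 b2, fourier, fourier, ← integral_const_mul]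
    refine integral_congr_ae (Filter.Eventually.of_forall fun ξ => ?_)
    simp only
    ring
  have h2 : Integrable fun ξ => (2 * Real.pi : ℂ) ^ 2 * (a ξ * b ξ) :=
    (a2.integrable_mul b2).const_mul _
  rw [h1, conv_fourier_left h2 f1]
  congr 1
  funext ξ
  ring

/-! ### Bounded overlap -/

theorem tsum_indicator_le {Z : Set ℤ} {k : ℕ} (h : ∀ a ∈ Z, ∀ b ∈ Z, b ≤ a + k) :
    ∑' n : ℤ, Z.indicator (fun _ => (1 : ℝ≥0∞)) n ≤ 2 * k + 1 := by
  rcases Z.eq_empty_or_nonempty with rfl | ⟨a, ha⟩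
  · simp
  have hsub : ∀ n ∉ Finset.Icc (a - k) (a + k), Z.indicator (fun _ => (1 : ℝ≥0∞)) n = 0 := by
    intro n hn
    refine indicator_of_notMem (fun hz => hn ?_) _
    rw [Finset.mem_Icc]
    have := h a ha n hz
    have := h n hz a ha
    omega
  rw [tsum_eq_sum hsub]
  calc ∑ n ∈ Finset.Icc (a - k) (a + k), Z.indicator (fun _ => (1 : ℝ≥0∞)) n
      ≤ ∑ n ∈ Finset.Icc (a - k) (a + k), 1 :=
        Finset.sum_le_sum fun n _ => indicator_le_self' (fun _ _ => zero_le) n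
    _ = 2 * k + 1 := by
        rw [Finset.sum_const, Int.card_Icc, show (a + k + 1 - (a - k)).toNat = 2 * k + 1 by omega]
        simp

/-- If `b ≥ a + k + 1`, the lower end of shell `b` would exceed the upper end of shell `a`. -/
theorem le_add_of_zpow_bounds {r lo hi s : ℝ} {k : ℕ} (hr : 1 < r) (hlo : 0 < lo)
    (hk : hi < lo * r ^ (k + 1)) {a b : ℤ} (ha : s ≤ r ^ a * hi) (hb : r ^ b * lo ≤ s) :
    b ≤ a + k := by
  by_contra! hcon
  have h0 : 0 < r := by linarith
  have h1 : r ^ (a + (k + 1 : ℕ)) ≤ r ^ b := zpow_le_zpow_right₀ hr.le (by push_cast; omega)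
  rw [zpow_add₀ h0.ne', zpow_natCast] at h1
  have h2 : r ^ a * (lo * r ^ (k + 1)) ≤ r ^ a * hi := by
    calc r ^ a * (lo * r ^ (k + 1)) = r ^ a * r ^ (k + 1) * lo := by ring
      _ ≤ r ^ b * lo := by gcongr
      _ ≤ _ := hb.trans ha
  exact absurd (le_of_mul_le_mul_left h2 (zpow_pos h0 a)) (not_le.2 hk)

/-- The shell in the frequency plane that carries `σ_{i,j,m,n}`, in terms of `s = ρ(ξ)`. -/
def shellSet (δ : ℝ) (m n : ℤ) : Set ℝ :=
  {s | (2 : ℝ) ^ (-n) * s ∈ Icc (1 / 2 : ℝ) 2 ∧ (2 : ℝ) ^ (-n) * s ∈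
    Icc (((1 + 2 * δ) / (1 - 2 * δ)) ^ m * (1 - 10 * δ)) (((1 + 2 * δ) / (1 - 2 * δ)) ^ m * (1 + 10 * δ))}

theorem measurableSet_shellSet (δ : ℝ) (m n : ℤ) : MeasurableSet (shellSet δ m n) :=
  (measurableSet_Icc.preimage (measurable_const_mul _)).inter
    (measurableSet_Icc.preimage (measurable_const_mul _))

/-- The dyadic condition admits at most `5` values of `n`. For fixed `n` at most `13` values of `m`
remain: the ratio is at least `1 + 4 δ`, so its seventh power exceeds `(1 + 10 δ) / (1 - 10 δ)`. The
product is `65`. -/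
theorem tsum_indicator_shellSet_le {δ : ℝ} (hδ : 0 < δ) (hδ1 : δ < 1 / 100) (s : ℝ) :
    ∑' (m : ℤ) (n : ℤ), (shellSet δ m n).indicator (fun _ => (1 : ℝ≥0∞)) s ≤ 65 := by
  set Z₁ : ℤ → Set ℤ := fun n => {m | s ∈ shellSet δ m n} with hZ₁
  set Z₂ : Set ℤ := {n | (2 : ℝ) ^ (-n) * s ∈ Icc (1 / 2 : ℝ) 2} with hZ₂
  have hr : 1 + 4 * δ ≤ (1 + 2 * δ) / (1 - 2 * δ) := by
    rw [le_div_iff₀ (by linarith)]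
    nlinarith
  have h1 : ∀ n, ∑' m : ℤ, (Z₁ n).indicator (fun _ => (1 : ℝ≥0∞)) m ≤ 13 := by
    intro n
    refine (tsum_indicator_le (k := 6) fun a ha b hb => ?_).trans (by norm_num)
    refine le_add_of_zpow_bounds (lt_of_lt_of_le (by linarith) hr) (by linarith) ?_ ha.2.2 hb.2.1
    have h2 : 1 + 28 * δ ≤ ((1 + 2 * δ) / (1 - 2 * δ)) ^ 7 := by
      have := one_add_mul_le_pow (show (-2 : ℝ) ≤ 4 * δ by linarith) 7
      refine le_trans ?_ (pow_le_pow_left₀ (by linarith) hr 7)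
      push_cast at this
      linarith
    have h3 : 0 < 1 - 10 * δ := by linarith
    calc 1 + 10 * δ < (1 - 10 * δ) * (1 + 28 * δ) := by nlinarith
      _ ≤ _ := by gcongr
  have h2 : ∑' n : ℤ, Z₂.indicator (fun _ => (1 : ℝ≥0∞)) n ≤ 5 := by
    refine (tsum_indicator_le (k := 2) fun a ha b hb => ?_).trans (by norm_num)
    have hp : ∀ n : ℤ, (2 : ℝ) ^ n * ((2 : ℝ) ^ (-n) * s) = s := fun n => by
      rw [← mul_assoc, ← zpow_add₀ two_ne_zero, add_neg_cancel, zpow_zero, one_mul]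
    refine le_add_of_zpow_bounds (r := 2) (lo := 1 / 2) (hi := 2) (s := s) one_lt_two
      (by norm_num) (by norm_num) ?_ ?_
    · calc s = 2 ^ a * ((2 : ℝ) ^ (-a) * s) := (hp a).symm
        _ ≤ _ := by gcongr; exact ha.2
    · calc (2 : ℝ) ^ b * (1 / 2) ≤ 2 ^ b * ((2 : ℝ) ^ (-b) * s) := by gcongr; exact hb.1
        _ = s := hp b
  rw [ENNReal.tsum_comm]
  calc ∑' (n : ℤ) (m : ℤ), (shellSet δ m n).indicator (fun _ => (1 : ℝ≥0∞)) s
      ≤ ∑' n : ℤ, 13 * Z₂.indicator (fun _ => (1 : ℝ≥0∞)) n := by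
        refine ENNReal.tsum_le_tsum fun n => ?_
        by_cases hn : n ∈ Z₂
        · rw [indicator_of_mem hn, mul_one]
          exact h1 n
        · rw [indicator_of_notMem hn, mul_zero]
          refine (ENNReal.tsum_eq_zero.2 fun m => indicator_of_notMem (fun h => hn h.1) _).le
    _ ≤ 13 * 5 := by rw [ENNReal.tsum_mul_left]; exact mul_le_mul' le_rfl h2
    _ = 65 := by norm_num

/-! ### The multipliers `σ_{i,j,m,n}` -/

/-- The factor of `σ_{i,j,m,n}` that does not depend on `j`. -/
def baseMult {N : ℕ} (P : Choices N) (Ω : Set Plane) (A : Matrix (Fin 2) (Fin 2) ℝ) (φ : ℝ → ℝ)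
    (δ : ℝ) (i : Fin (N + 1)) (m n : ℤ) (ξ : Plane) : ℝ :=
  shell φ (rho Ω A (dil A ((2 : ℝ) ^ (-n)) ξ)) *
    P.angular i (dil A (((1 - 2 * δ) / (1 + 2 * δ)) ^ m) (dil A ((2 : ℝ) ^ (-n)) ξ)) *
    P.radial m (rho Ω A (dil A ((2 : ℝ) ^ (-n)) ξ))

theorem IsShellCutoff.mem_Icc_of_shell_ne_zero {φ : ℝ → ℝ} (hφ : IsShellCutoff φ) {s : ℝ}
    (hs : 0 ≤ s) (h : shell φ s ≠ 0) : s ∈ Icc (1 / 2 : ℝ) 2 := by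
  by_contra hcon
  refine h ?_
  have hz : ∀ u, u ∉ Icc (-1 : ℝ) 1 → φ u = 0 := fun u hu => by
    by_contra h0
    exact hu (hφ.support h0)
  rcases lt_or_ge s (1 / 2) with h1 | h1
  · rw [shell, hφ.eq_one _ ⟨by linarith, by linarith⟩, hφ.eq_one _ ⟨by linarith, by linarith⟩, sub_self]
  · have h2 : 2 < s := by
      by_contra! h2
      exact hcon ⟨h1, h2⟩
    rw [shell, hz _ fun hu => by linarith [hu.2], hz _ fun hu => by linarith [hu.2], sub_self]

theorem IsShellCutoff.exists_abs_shell_le {φ : ℝ → ℝ} (hφ : IsShellCutoff φ) :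
    ∃ B : ℝ, 0 < B ∧ ∀ s, |shell φ s| ≤ B := by
  have hc : HasCompactSupport φ := HasCompactSupport.of_support_subset_isCompact isCompact_Icc hφ.support
  obtain ⟨B, hB⟩ := hc.exists_bound_of_continuous hφ.contDiff.continuous
  refine ⟨B + B + 1, ?_, fun s => ?_⟩
  · linarith [(norm_nonneg _).trans (hB 0)]
  · have h1 := hB (s / 2)
    have h2 := hB s
    rw [Real.norm_eq_abs] at h1 h2
    have := abs_sub (φ (s / 2)) (φ s)
    unfold shell
    linarith

theorem norm_fourier_le (f : Plane → ℂ) (x : Plane) : ‖fourier f x‖ ≤ ∫ ξ, ‖f ξ‖ := by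
  refine (norm_integral_le_integral_norm _).trans (le_of_eq ?_)
  refine integral_congr_ae (Filter.Eventually.of_forall fun ξ => ?_)
  have := enorm_cexp_mul_I (-inner ℝ x ξ)
  simp only [norm_mul]
  rw [show -((inner ℝ x ξ : ℝ) : ℂ) = ((-inner ℝ x ξ : ℝ) : ℂ) by push_cast; rfl,
    Complex.norm_exp_ofReal_mul_I, one_mul]

section Multiplier

variable {N : ℕ} {P : Choices N} {Ω : Set Plane} {M : ℕ} {A : Matrix (Fin 2) (Fin 2) ℝ} {φ : ℝ → ℝ}
  {c d : ℕ → ℝ} {L δ : ℝ}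

/-- The two dilations combine into one linear map, and all dependence on `j` sits in the two strip
factors. -/
theorem sigma_eq (α : ℝ → ℝ) (i : Fin (N + 1)) (j : ℕ) (m n : ℤ) (ξ : Plane) :
    sigma P Ω A φ α δ i j m n ξ = strip α (bdry Ω (P.angle i)) (P.J i) (P.b i) j
        (rot (P.angle i) (((dil A (((1 - 2 * δ) / (1 + 2 * δ)) ^ m)).comp (dil A ((2 : ℝ) ^ (-n)))) ξ)) *
      (1 - strip α (bdry Ω (P.angle i)) (P.J i) (P.b i) (j + 1)
        (rot (P.angle i) (((dil A (((1 - 2 * δ) / (1 + 2 * δ)) ^ m)).comp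
          (dil A ((2 : ℝ) ^ (-n)))) ξ))) * baseMult P Ω A φ δ i m n ξ := by
  simp only [sigma, sigmaZero, baseMult, ContinuousLinearMap.comp_apply]
  ring

theorem Choices.IsAdmissible.abs_baseMult_le (hP : P.IsAdmissible Ω M φ c d L δ) {B : ℝ}
    (hB : ∀ s, |shell φ s| ≤ B) (i : Fin (N + 1)) (m n : ℤ) (ξ : Plane) :
    |baseMult P Ω A φ δ i m n ξ| ≤ B * |d 0| * |c 0| := by
  unfold baseMult
  rw [abs_mul, abs_mul]
  have hd : ∀ η, |P.angular i η| ≤ |d 0| := fun η => by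
    have := hP.angular_bound 0 i η
    rw [norm_iteratedFDeriv_zero, Real.norm_eq_abs] at this
    exact this.trans (le_abs_self _)
  have hc : ∀ s, |P.radial m s| ≤ |c 0| := fun s => by
    have := hP.radial_bound 0 m s
    rw [iteratedDeriv_zero, pow_zero, inv_one, mul_one] at this
    exact this.trans (le_abs_self _)
  have hB0 : 0 ≤ B := (abs_nonneg _).trans (hB 0)
  exact mul_le_mul (mul_le_mul (hB _) (hd _) (abs_nonneg _) hB0) (hc _) (abs_nonneg _) (by positivity)

theorem Choices.IsAdmissible.measurable_baseMult (hP : P.IsAdmissible Ω M φ c d L δ)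
    (hΩ : IsConvexDomain Ω M) (hA : IsCompatible Ω A) (hφ : IsShellCutoff φ) (i : Fin (N + 1))
    (m n : ℤ) : Measurable (baseMult P Ω A φ δ i m n) := by
  have h1 : Measurable (shell φ) := by
    unfold shell
    have := hφ.contDiff.continuous.measurable
    fun_prop
  have hρ : Measurable fun ξ => rho Ω A (dil A ((2 : ℝ) ^ (-n)) ξ) :=
    (hA.measurable_rho hΩ).comp (dil A _).continuous.measurable
  exact ((h1.comp hρ).mul ((hP.angular_contDiff i).continuous.measurable.comp
    ((dil A _).continuous.comp (dil A _).continuous).measurable)).mul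
      ((hP.radial_contDiff m).continuous.measurable.comp hρ)

theorem Choices.IsAdmissible.rho_mem_shellSet (hP : P.IsAdmissible Ω M φ c d L δ)
    (hA : IsCompatible Ω A) (hφ : IsShellCutoff φ) {i : Fin (N + 1)} {m n : ℤ} {ξ : Plane}
    (h : baseMult P Ω A φ δ i m n ξ ≠ 0) : rho Ω A ξ ∈ shellSet δ m n := by
  unfold baseMult at h
  have h2 : (0 : ℝ) < 2 ^ (-n) := by positivity
  rw [hA.rho_dil h2] at h
  have h3 : 0 ≤ 2 ^ (-n) * rho Ω A ξ := mul_nonneg h2.le (hA.rho_nonneg ξ)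
  exact ⟨hφ.mem_Icc_of_shell_ne_zero h3 fun h0 => h (by rw [h0, zero_mul, zero_mul]),
    hP.radial_support m fun h0 => h (by rw [h0, mul_zero])⟩

theorem mem_Icc_of_mem_shellSet {m n : ℤ} {s : ℝ} (h : s ∈ shellSet δ m n) :
    s ∈ Icc ((2 : ℝ) ^ n * (1 / 2)) (2 ^ n * 2) ∧
      s ∈ Icc (2 ^ n * ((1 + 2 * δ) / (1 - 2 * δ)) ^ m * (1 - 10 * δ))
        (2 ^ n * ((1 + 2 * δ) / (1 - 2 * δ)) ^ m * (1 + 10 * δ)) := by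
  have hp : s = (2 : ℝ) ^ n * ((2 : ℝ) ^ (-n) * s) := by
    rw [← mul_assoc, ← zpow_add₀ two_ne_zero, add_neg_cancel, zpow_zero, one_mul]
  have h2 : (0 : ℝ) < 2 ^ n := by positivity
  obtain ⟨⟨h3, h4⟩, h5, h6⟩ := h
  simp only [mem_Icc, mul_assoc]
  exact ⟨⟨hp ▸ mul_le_mul_of_nonneg_left h3 h2.le, hp ▸ mul_le_mul_of_nonneg_left h4 h2.le⟩,
    hp ▸ mul_le_mul_of_nonneg_left h5 h2.le, hp ▸ mul_le_mul_of_nonneg_left h6 h2.le⟩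

theorem Choices.IsAdmissible.integrable_baseMult_mul (hP : P.IsAdmissible Ω M φ c d L δ)
    (hΩ : IsConvexDomain Ω M) (hA : IsCompatible Ω A) (hφ : IsShellCutoff φ) {B B' : ℝ}
    (hB : ∀ s, |shell φ s| ≤ B) (i : Fin (N + 1)) (m n : ℤ) {g : Plane → ℂ} (hg : Measurable g)
    (hgB : ∀ ξ, ‖g ξ‖ ≤ B') :
    Measurable (fun ξ => (baseMult P Ω A φ δ i m n ξ : ℂ) * g ξ) ∧
      Integrable (fun ξ => (baseMult P Ω A φ δ i m n ξ : ℂ) * g ξ) ∧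
      MemLp (fun ξ => (baseMult P Ω A φ δ i m n ξ : ℂ) * g ξ) 2 volume := by
  have hm : Measurable (fun ξ => (baseMult P Ω A φ δ i m n ξ : ℂ) * g ξ) :=
    (Complex.measurable_ofReal.comp (hP.measurable_baseMult hΩ hA hφ i m n)).mul hg
  have hb : ∀ ξ, ‖(baseMult P Ω A φ δ i m n ξ : ℂ) * g ξ‖ ≤ B * |d 0| * |c 0| * B' := by
    intro ξ
    rw [norm_mul, Complex.norm_real, Real.norm_eq_abs]
    have := hP.abs_baseMult_le (A := A) hB i m n ξ
    exact mul_le_mul this (hgB ξ) (norm_nonneg _) ((abs_nonneg _).trans this)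
  have hi := integrable_of_bounded_of_compact hm hb
    (hA.isCompact_shell hΩ (a := (2 : ℝ) ^ n * (1 / 2)) (b := 2 ^ n * 2) (by positivity))
    fun ξ h => (mem_Icc_of_mem_shellSet (hP.rho_mem_shellSet (i := i) (m := m) hA hφ fun h0 => h (by simp [h0]))).1
  exact ⟨hm, hi, memLp_two_of_bounded hi hb⟩

theorem integrable_time_multiplier {Φ : 𝓢(ℝ, ℝ)} (hΦ : Function.support Φ ⊆ Icc (-1) 1)
    (hΦ_le : ∀ s, |Φ s| ≤ 1) (hΩ : IsConvexDomain Ω M) (hA : IsCompatible Ω A) (hδ : 0 < δ)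
    (hδ1 : δ < 1) {t : ℝ} (ht : 0 < t) :
    Integrable (fun ξ => (Φ ((rho Ω A ξ / t - 1) / δ) : ℂ)) ∧
      MemLp (fun ξ => (Φ ((rho Ω A ξ / t - 1) / δ) : ℂ)) 2 volume := by
  have hρ := hA.measurable_rho hΩ
  have hm : Measurable fun ξ => (Φ ((rho Ω A ξ / t - 1) / δ) : ℂ) :=
    Complex.measurable_ofReal.comp (Φ.continuous.measurable.comp (by fun_prop))
  have hb : ∀ ξ, ‖(Φ ((rho Ω A ξ / t - 1) / δ) : ℂ)‖ ≤ 1 := fun ξ => by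
    rw [Complex.norm_real]; exact hΦ_le _
  have hi := integrable_of_bounded_of_compact hm hb
    (hA.isCompact_shell hΩ (a := (1 - δ) * t) (b := (1 + δ) * t) (by nlinarith)) fun ξ h => by
      have h1 : Φ ((rho Ω A ξ / t - 1) / δ) ≠ 0 := by exact_mod_cast h
      have h2 := hΦ h1
      rw [mem_Icc, le_div_iff₀ hδ, div_le_iff₀ hδ] at h2
      constructor
      · rw [← le_div_iff₀ ht]; linarith [h2.1]
      · rw [← div_le_iff₀ ht]; linarith [h2.2]
  exact ⟨hi, memLp_two_of_bounded hi hb⟩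

end Multiplier

/-! ### The maximal inequality -/

/-- Summing the squares of the majorants `g i m n` is affordable because each is controlled by the
part of `F` on its own shell. Bounded overlap reassembles the norm of `F`, which Plancherel turns
into that of `f`. -/
theorem exists_lintegral_maxFn_sq_le {Φ : 𝓢(ℝ, ℝ)} (hΦ : Function.support Φ ⊆ Icc (-1) 1)
    (hΦ_le : ∀ s, |Φ s| ≤ 1) {φ : ℝ → ℝ} (hφ : IsShellCutoff φ) {α : ℝ → ℝ} (hα : IsStripCutoff α)
    (N : ℕ) (c d : ℕ → ℝ) :
    ∃ C : ℝ, 0 ≤ C ∧ ∀ (Ω : Set Plane) (M : ℕ) (A : Matrix (Fin 2) (Fin 2) ℝ) (L δ : ℝ)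
      (P : Choices N), IsConvexDomain Ω M → IsCompatible Ω A → 0 < δ → δ < 1 / 100 →
      P.IsAdmissible Ω M φ c d L δ → ∀ f : 𝓢(Plane, ℂ),
      ∫⁻ x, maxFn P Ω A Φ φ α δ f x ^ 2
        ≤ ENNReal.ofReal (C * (scaleCount M L δ + 1) ^ 6) * ∫⁻ x, ‖f x‖ₑ ^ 2 := by
  obtain ⟨C, hC, hmax⟩ := exists_maximal_bound hΦ hα
  obtain ⟨B, hB0, hB⟩ := hφ.exists_abs_shell_le
  set B₀ : ℝ := B * |d 0| * |c 0| with hB₀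
  have hB₀0 : 0 ≤ B₀ := by positivity
  refine ⟨(N + 1) * C * (B₀ * (2 * Real.pi) ^ 2) ^ 2 * (65 * (2 * Real.pi) ^ 2), by positivity, ?_⟩
  intro Ω M A L δ P hΩ hA hδ hδ1 hP f
  have hf1 : Integrable f := f.integrable
  have hf2 : MemLp f 2 volume := f.memLp 2
  -- The reflected transform of `f` with its constant: convolving with `ψ_t` and `K_{i,j,m,n}`
  -- amounts to multiplying `F` by the product of their multipliers.
  set F : Plane → ℂ := fun ξ => (2 * Real.pi) ^ 2 * fourier f (-ξ) with hF
  have hFc : Continuous F := ((continuous_fourierPlane hf1).comp continuous_neg).const_mul _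
  have hpi : ‖((2 * Real.pi : ℂ)) ^ 2‖ = (2 * Real.pi) ^ 2 := by
    rw [show (2 * Real.pi : ℂ) = ((2 * Real.pi : ℝ) : ℂ) by push_cast; rfl, norm_pow,
      Complex.norm_real, Real.norm_of_nonneg Real.two_pi_pos.le]
  have hFB : ∀ ξ, ‖F ξ‖ ≤ (2 * Real.pi) ^ 2 * ∫ ξ, ‖f ξ‖ := fun ξ => by
    rw [hF, norm_mul, hpi]
    gcongr
    exact norm_fourier_le f _
  set h : Fin (N + 1) → ℤ → ℤ → Plane → ℂ := fun i m n ξ => (baseMult P Ω A φ δ i m n ξ : ℂ) * F ξ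
    with hh
  have hr : 0 < (1 + 2 * δ) / (1 - 2 * δ) := div_pos (by linarith) (by linarith)
  have hreg := fun i m n => hP.integrable_baseMult_mul hΩ hA hφ hB i m n hFc.measurable hFB
  have hg := fun (i : Fin (N + 1)) (m n : ℤ) =>
    hmax (X := (2 : ℝ) ^ n * ((1 + 2 * δ) / (1 - 2 * δ)) ^ m)
    (T := (dil A (((1 - 2 * δ) / (1 + 2 * δ)) ^ m)).comp (dil A ((2 : ℝ) ^ (-n)))) hΩ hA hδ hδ1.le
    (by positivity) (hP.refinement i) (hreg i m n).1 (hreg i m n).2.1 (hreg i m n).2.2 fun ξ h0 =>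
      (mem_Icc_of_mem_shellSet (hP.rho_mem_shellSet (i := i) hA hφ fun h1 => h0 (by simp [h1]))).2
  choose g hgm hgL hgle using hg
  have hpt : ∀ x, maxFn P Ω A Φ φ α δ f x ^ 2 ≤ ∑ i, ∑' (m : ℤ) (n : ℤ), g i m n x ^ 2 := by
    intro x
    -- Taking the square root on the other side leaves a bare supremum, to be bounded term by term.
    have key : ∀ y : ℝ≥0∞, maxFn P Ω A Φ φ α δ f x ≤ y ^ (1 / 2 : ℝ) → maxFn P Ω A Φ φ α δ f x ^ 2 ≤ y := by
      intro y hy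
      rw [← ENNReal.rpow_natCast, ← ENNReal.le_rpow_inv_iff (by norm_num)]
      simpa using hy
    refine key _ (iSup_le fun i => iSup_le fun j => iSup_le fun m => iSup_le fun n => iSup₂_le fun t ht => ?_)
    have ht0 : 0 < t := lt_of_lt_of_le (by positivity) ht.1
    set γ := bdry Ω (P.angle i) with hγ
    set T := (dil A (((1 - 2 * δ) / (1 + 2 * δ)) ^ m)).comp (dil A ((2 : ℝ) ^ (-n))) with hT
    set s : Plane → ℝ := fun ξ => strip α γ (P.J i) (P.b i) j (rot (P.angle i) (T ξ)) *
      (1 - strip α γ (P.J i) (P.b i) (j + 1) (rot (P.angle i) (T ξ))) with hs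
    have hsm : Measurable s := by
      have hTm : Measurable fun ξ => rot (P.angle i) (T ξ) :=
        ((continuous_rot _).comp T.continuous).measurable
      exact ((measurable_strip hα _ _ _ _).comp hTm).mul
        (measurable_const.sub ((measurable_strip hα _ _ _ _).comp hTm))
    have hs1 : ∀ ξ, |s ξ| ≤ 1 := fun ξ => by
      obtain ⟨h1, h2⟩ := abs_strip_le hα γ (P.J i) (P.b i) j (rot (P.angle i) (T ξ))
      obtain ⟨h3, h4⟩ := abs_strip_le hα γ (P.J i) (P.b i) (j + 1) (rot (P.angle i) (T ξ))
      rw [hs, abs_of_nonneg (mul_nonneg h1 (by linarith))]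
      exact mul_le_one₀ h2 (by linarith) (by linarith)
    have hone := (hP.integrable_baseMult_mul hΩ hA hφ hB i m n (g := fun _ => 1) measurable_const
      (B' := 1) (fun _ => by simp)).2.1
    simp only [mul_one] at hone
    have hσ : ∀ ξ, (sigma P Ω A φ α δ i j m n ξ : ℂ) = (s ξ : ℂ) * (baseMult P Ω A φ δ i m n ξ : ℂ) :=
      fun ξ => by rw [sigma_eq, Complex.ofReal_mul]
    have hσ1 : Integrable fun ξ => (sigma P Ω A φ α δ i j m n ξ : ℂ) := by
      simp only [hσ]
      exact integrable_bdd_mul hone hsm hs1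
    have hσ2 : MemLp (fun ξ => (sigma P Ω A φ α δ i j m n ξ : ℂ)) 2 volume := by
      refine memLp_two_of_bounded (B := 1 * B₀) hσ1 fun ξ => ?_
      rw [hσ, norm_mul, Complex.norm_real, Complex.norm_real]
      exact mul_le_mul (hs1 ξ) (hP.abs_baseMult_le hB i m n ξ) (norm_nonneg _) zero_le_one
    obtain ⟨hΦ1, hΦ2⟩ := integrable_time_multiplier hΦ hΦ_le hΩ hA hδ (by linarith) ht0
    have hbound : ‖conv (conv (psiKernel Ω A Φ δ t) (kernelK P Ω A φ α δ i j m n)) f x‖ₑ ≤ g i m n x := by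
      rw [psiKernel, kernelK, conv_conv_fourier hΦ1 hΦ2 hσ1 hσ2 hf1]
      refine le_trans (le_of_eq ?_) (hgle i m n t ht0 j j.2 x)
      congr 2
      funext ξ
      rw [hσ]
      simp only [hF, hs]
      ring
    refine hbound.trans ?_
    rw [one_div, ENNReal.le_rpow_inv_iff (by norm_num), ENNReal.rpow_ofNat]
    exact ((ENNReal.le_tsum n).trans (ENNReal.le_tsum (f := fun m => ∑' n, g i m n x ^ 2) m)).trans
      (Finset.single_le_sum (f := fun i => ∑' (m : ℤ) (n : ℤ), g i m n x ^ 2)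
        (fun _ _ => zero_le) (Finset.mem_univ i))
  set κ : ℝ := C * (scaleCount M L δ + 1) ^ 6 with hκ
  have hκ0 : 0 ≤ κ := by positivity
  set b₀ : ℝ := B₀ ^ 2 with hb₀
  have hρ := hA.measurable_rho hΩ
  have hEm : ∀ m n, Measurable fun ξ => (shellSet δ m n).indicator (fun _ => (1 : ℝ≥0∞)) (rho Ω A ξ) :=
    fun m n => (measurable_const.indicator (measurableSet_shellSet δ m n)).comp hρ
  have hEFm : ∀ m n, Measurable fun ξ =>
      (shellSet δ m n).indicator (fun _ => (1 : ℝ≥0∞)) (rho Ω A ξ) * ‖F ξ‖ₑ ^ 2 :=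
    fun m n => (hEm m n).mul (hFc.measurable.enorm.pow_const 2)
  have hhE : ∀ i m n, ∫⁻ ξ, ‖h i m n ξ‖ₑ ^ 2 ≤ ENNReal.ofReal b₀ *
      ∫⁻ ξ, (shellSet δ m n).indicator (fun _ => (1 : ℝ≥0∞)) (rho Ω A ξ) * ‖F ξ‖ₑ ^ 2 := by
    intro i m n
    rw [← lintegral_const_mul _ (hEFm m n)]
    refine lintegral_mono fun ξ => ?_
    by_cases h0 : baseMult P Ω A φ δ i m n ξ = 0
    · simp [hh, h0]
    · rw [indicator_of_mem (hP.rho_mem_shellSet hA hφ h0), one_mul, hh]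
      simp only [enorm_mul, mul_pow]
      gcongr
      rw [hb₀, ENNReal.ofReal_pow hB₀0]
      gcongr
      rw [← ofReal_norm, Complex.norm_real]
      exact ENNReal.ofReal_le_ofReal (hP.abs_baseMult_le hB i m n ξ)
  have hFL : ∫⁻ ξ, ‖F ξ‖ₑ ^ 2 =
      ENNReal.ofReal (((2 * Real.pi) ^ 2) ^ 2 * (2 * Real.pi) ^ 2) * ∫⁻ x, ‖f x‖ₑ ^ 2 := by
    have e : ∀ ξ, ‖F ξ‖ₑ ^ 2 = ENNReal.ofReal (((2 * Real.pi) ^ 2) ^ 2) * ‖fourier f (-ξ)‖ₑ ^ 2 := by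
      intro ξ
      change ‖((2 * Real.pi : ℂ)) ^ 2 * fourier f (-ξ)‖ₑ ^ 2 = _
      rw [enorm_mul, mul_pow, ← ofReal_norm (((2 : ℂ) * Real.pi) ^ 2), hpi, ← ENNReal.ofReal_pow (by positivity)]
    have hm : Measurable fun ξ => ‖fourier f (-ξ)‖ₑ ^ 2 :=
      ((continuous_fourierPlane hf1).comp continuous_neg).measurable.enorm.pow_const 2
    simp_rw [e]
    rw [lintegral_const_mul _ hm,
      lintegral_neg_eq_self (fun ξ => ‖fourier f ξ‖ₑ ^ 2),
      lintegral_enorm_fourierPlane_sq hf1 hf2, ← mul_assoc, ← ENNReal.ofReal_mul (by positivity)]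
  calc ∫⁻ x, maxFn P Ω A Φ φ α δ f x ^ 2
      ≤ ∫⁻ x, ∑ i, ∑' (m : ℤ) (n : ℤ), g i m n x ^ 2 := lintegral_mono hpt
    _ = ∑ i, ∑' (m : ℤ) (n : ℤ), ∫⁻ x, g i m n x ^ 2 := by
        have hgm2 : ∀ i m n, Measurable fun x => g i m n x ^ 2 := fun i m n => (hgm i m n).pow_const 2
        rw [lintegral_finsetSum _ fun i _ => Measurable.tsum fun m =>
          Measurable.tsum fun n => hgm2 i m n]
        refine Finset.sum_congr rfl fun i _ => ?_
        rw [lintegral_tsum fun m => (Measurable.tsum fun n => hgm2 i m n).aemeasurable]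
        refine tsum_congr fun m => ?_
        rw [lintegral_tsum fun n => (hgm2 i m n).aemeasurable]
    _ ≤ ∑ i : Fin (N + 1), ∑' (m : ℤ) (n : ℤ), ENNReal.ofReal κ * (ENNReal.ofReal b₀ *
        ∫⁻ ξ, (shellSet δ m n).indicator (fun _ => (1 : ℝ≥0∞)) (rho Ω A ξ) * ‖F ξ‖ₑ ^ 2) := by
        refine Finset.sum_le_sum fun i _ => ENNReal.tsum_le_tsum fun m => ENNReal.tsum_le_tsum fun n => ?_
        exact (hgL i m n).trans (mul_le_mul' le_rfl (hhE i m n))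
    _ = (N + 1) * (ENNReal.ofReal κ * (ENNReal.ofReal b₀ * ∫⁻ ξ, (∑' (m : ℤ) (n : ℤ),
          (shellSet δ m n).indicator (fun _ => (1 : ℝ≥0∞)) (rho Ω A ξ)) * ‖F ξ‖ₑ ^ 2)) := by
        simp_rw [← ENNReal.tsum_mul_right]
        rw [lintegral_tsum fun m => (Measurable.tsum fun n => hEFm m n).aemeasurable]
        simp_rw [lintegral_tsum fun n => (hEFm _ n).aemeasurable]
        simp_rw [ENNReal.tsum_mul_left]
        rw [Finset.sum_const, Finset.card_univ, Fintype.card_fin, nsmul_eq_mul]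
        push_cast
        rfl
    _ ≤ (N + 1) * (ENNReal.ofReal κ * (ENNReal.ofReal b₀ * ∫⁻ ξ, 65 * ‖F ξ‖ₑ ^ 2)) := by
        gcongr with ξ
        exact tsum_indicator_shellSet_le hδ hδ1 _
    _ = _ := by
        rw [lintegral_const_mul _ (hFc.measurable.enorm.pow_const 2), hFL]
        have e1 : ((N : ℝ≥0∞) + 1) = ENNReal.ofReal (N + 1) := by
          rw [ENNReal.ofReal_add (by positivity) zero_le_one, ENNReal.ofReal_natCast, ENNReal.ofReal_one]
        have e2 : (65 : ℝ≥0∞) = ENNReal.ofReal 65 := by simp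
        rw [e1, e2]
        simp only [← mul_assoc]
        rw [← ENNReal.ofReal_mul (by positivity), ← ENNReal.ofReal_mul (by positivity),
          ← ENNReal.ofReal_mul (by positivity), ← ENNReal.ofReal_mul (by positivity)]
        congr 2
        rw [hκ, hb₀]
        ring

/-! ### Absorbing the logarithms and taking square roots -/

/-- `scaleCount` is affine in `log (1/δ)` up to rounding, and `log (1/δ) ≤ δ ^ (-ε) / ε`. -/
theorem exists_scaleCount_le (M : ℕ) (L : ℝ) {ε : ℝ} (hε : 0 < ε) :
    ∃ C : ℝ, 0 < C ∧ ∀ δ : ℝ, 0 < δ → δ < 1 → (scaleCount M L δ : ℝ) + 1 ≤ C * δ ^ (-ε) := by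
  refine ⟨2 * M + 9 + (2 * |L| + 2) / ε, by positivity, fun δ hδ hδ1 => ?_⟩
  have hy : 0 ≤ Real.log δ⁻¹ := Real.log_nonneg ((one_le_inv₀ hδ).2 hδ1.le)
  have h1 : (⌊L * Real.log δ⁻¹⌋₊ : ℝ) ≤ |L| * Real.log δ⁻¹ := by
    refine (Nat.cast_le.2 (Nat.floor_le_floor
      (mul_le_mul_of_nonneg_right (le_abs_self L) hy))).trans ?_
    exact Nat.floor_le (by positivity)
  have h2 : (⌈2 * Real.log δ⁻¹⌉₊ : ℝ) ≤ 2 * Real.log δ⁻¹ + 1 := (Nat.ceil_lt_add_one (by positivity)).le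
  have h3 : Real.log δ⁻¹ ≤ δ ^ (-ε) / ε := by
    have := Real.log_le_rpow_div (inv_nonneg.2 hδ.le) hε
    rwa [Real.inv_rpow hδ.le, ← Real.rpow_neg hδ.le] at this
  have h4 : 1 ≤ δ ^ (-ε) := Real.one_le_rpow_of_pos_of_le_one_of_nonpos hδ hδ1.le (by linarith)
  have h5 : (scaleCount M L δ : ℝ) =
      2 * M + 7 + 2 * ⌊L * Real.log δ⁻¹⌋₊ + ⌈2 * Real.log δ⁻¹⌉₊ := by
    rw [scaleCount]; push_cast; ring
  calc (scaleCount M L δ : ℝ) + 1 ≤ (2 * M + 9) * 1 + (2 * |L| + 2) * Real.log δ⁻¹ := by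
        rw [h5]; linarith
    _ ≤ (2 * M + 9) * δ ^ (-ε) + (2 * |L| + 2) * (δ ^ (-ε) / ε) := by gcongr
    _ = _ := by ring

theorem eLpNorm_two_le_of_lintegral_sq_le {X E F : Type*} [MeasurableSpace X] {μ : Measure X}
    [ENorm E] [ENorm F] [TopologicalSpace E] [TopologicalSpace F] {f : X → E} {g : X → F} {B : ℝ} (hB : 0 ≤ B)
    (h : ∫⁻ x, ‖f x‖ₑ ^ 2 ∂μ ≤ ENNReal.ofReal (B ^ 2) * ∫⁻ x, ‖g x‖ₑ ^ 2 ∂μ) :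
    eLpNorm f 2 μ ≤ ENNReal.ofReal B * eLpNorm g 2 μ := by
  rw [eLpNorm_eq_lintegral_rpow_enorm_toReal two_ne_zero ENNReal.ofNat_ne_top,
    eLpNorm_eq_lintegral_rpow_enorm_toReal two_ne_zero ENNReal.ofNat_ne_top]
  simp only [ENNReal.toReal_ofNat, ENNReal.rpow_ofNat]
  calc (∫⁻ x, ‖f x‖ₑ ^ 2 ∂μ) ^ (1 / 2 : ℝ)
      ≤ (ENNReal.ofReal (B ^ 2) * ∫⁻ x, ‖g x‖ₑ ^ 2 ∂μ) ^ (1 / 2 : ℝ) := by gcongr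
    _ = _ := by
      rw [ENNReal.mul_rpow_of_nonneg _ _ (by norm_num), ENNReal.ofReal_rpow_of_nonneg (by positivity)
        (by norm_num), ← Real.sqrt_eq_rpow, Real.sqrt_sq hB]

end BochnerRiesz

end

theorem proposition5p1
    -- the cutoff functions, fixed once and for all
    (Φ : 𝓢(ℝ, ℝ)) (_hΦ : Function.support Φ ⊆ Set.Icc (-1) 1) (_hΦ_le : ∀ s, |Φ s| ≤ 1)
    (φ : ℝ → ℝ) (_hφ : BochnerRiesz.IsShellCutoff φ)
    (α : ℝ → ℝ) (_hα : BochnerRiesz.IsStripCutoff α)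
    -- the quantities on which the constants may depend
    (M : ℕ) (re₁ re₂ θ : ℝ) (_h₁ : 0 < re₁) (_h₂ : 0 < re₂) (_hθ : 0 < θ)
    -- the number of rotations and the implied constants in the construction
    (N : ℕ) (c d : ℕ → ℝ) (L : ℝ) :
    ∃ C : ℝ, 0 < C ∧ ∀ ε : ℝ, 0 < ε → ∃ K : ℝ, 0 < K ∧
      ∀ (Ω : Set BochnerRiesz.Plane) (A : Matrix (Fin 2) (Fin 2) ℝ) (l₁ l₂ : ℂ),
        BochnerRiesz.IsConvexDomain Ω M →
        (A.map (algebraMap ℝ ℂ)).charpoly.roots = {l₁, l₂} → l₁.re = re₁ → l₂.re = re₂ →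
        BochnerRiesz.IsCompatible Ω A → BochnerRiesz.Theta Ω A = θ →
      ∀ δ : ℝ, 0 < δ → δ < C →
      ∀ P : BochnerRiesz.Choices N, P.IsAdmissible Ω M φ c d L δ →
      ∀ f : 𝓢(BochnerRiesz.Plane, ℂ),
        eLpNorm (BochnerRiesz.maxFn P Ω A Φ φ α δ f) 2 volume
          ≤ ENNReal.ofReal (K * δ ^ (-ε)) * eLpNorm f 2 volume := by
  obtain ⟨C, hC, hmax⟩ := BochnerRiesz.exists_lintegral_maxFn_sq_le _hΦ _hΦ_le _hφ _hα N c d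
  refine ⟨1 / 100, by norm_num, fun ε hε => ?_⟩
  -- The sixth power in the squared norm is a cube in the norm, hence `ε / 3`.
  obtain ⟨K, hK, hscale⟩ := BochnerRiesz.exists_scaleCount_le M L (ε := ε / 3) (by positivity)
  -- Adding `1` to the root keeps the constant positive even if `C = 0`.
  refine ⟨(Real.sqrt C + 1) * K ^ 3, by positivity, ?_⟩
  intro Ω A l₁ l₂ hΩ _ _ _ hA _ δ hδ hδ1 P hP f
  refine BochnerRiesz.eLpNorm_two_le_of_lintegral_sq_le (by positivity) ?_
  simp only [enorm_eq_self]
  refine (hmax Ω M A L δ P hΩ hA hδ hδ1 hP f).trans ?_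
  gcongr
  have h1 := hscale δ hδ (by linarith)
  have h2 : δ ^ (-ε) = (δ ^ (-(ε / 3))) ^ 3 := by
    rw [← Real.rpow_natCast, ← Real.rpow_mul hδ.le]
    congr 1
    push_cast
    ring
  have h3 : C ≤ (Real.sqrt C + 1) ^ 2 := by
    nlinarith [Real.sq_sqrt hC, Real.sqrt_nonneg C]
  calc C * ((BochnerRiesz.scaleCount M L δ : ℝ) + 1) ^ 6
      ≤ (Real.sqrt C + 1) ^ 2 * (K * δ ^ (-(ε / 3))) ^ 6 := by gcongr
    _ = _ := by rw [h2]; ring
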